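/- **Setting.** All digraphs are finite, without loops or parallel arcs. An out-branching of $D$ is a spanning subdigraph $T$ of $D$ that is an oriented tree with exactly one vertex of in-degree zero; its leaves are the vertices of out-degree $0$ in $T$, and its other vertices are internal. $\ell_{\min}(D)$ is the least number of leaves of an out-branching of $D$ (and $0$ if there is none). An instance of MinLOB-PBGV is a pair $(D,k)$ with $\ell_{\min}(D)>0$ and an integer $k\ge 1$; it is a yes-instance if $\ell_{\min}(D)\le |V(D)|-k$. An out-branching $T$ of $D$ is minimal if for no arc $(u,v)\in A(D)\setminus A(T)$ the 1-change (adding $(u,v)$ to $T$ and removing the arc of $T$ that enters $v$) yields an out-branching with more internal vertices. Put $U_T=\{u: u \text{ is internal in } T\}\cup\{u : u\text{ is a leaf of } T\text{ and the only child of its parent}\}$. A crown of a graph $G$ is a pair $(H,C)$ of disjoint vertex sets, $C=C_m\sqcup C_u$, such that $H=N(C)$, $C$ is independent, and there is a perfect matching between $C_m$ and $H$. For a vertex cover $U$ of (the underlying graph of) $D$, enlarge $U$ by the vertices of in-degree $0$ and put $W=V(D)\setminus U$. Let $B$ be the bipartite graph with vertex set $N^-(W)\cup(U\times U)\cup W$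 and edges $\{xy,w\}$ for $x,y\in U$, $w\in W$, $(x,w),(w,y)\in A(D)$, and $\{x,w\}$ for $x\in U$, $w\in W$, $(x,w)\in A(D)$. Reduction Rule 1 applies to $D$ with $U$ if $B$ has a crown $(H,C_m\sqcup C_u)$ with $C\subseteq W$ and $C_u\ne\emptyset$ (the rule then removes $C_u$ from $D$). $D$ is irreducible if the rule applies to $D$ with no vertex cover $U$. **Lemma (Kernelization Lemma).** Let $(D,k)$ be an instance of MinLOB-PBGV. 1. If $D$ is irreducible and $|V(D)|>8k^2+6k$, then $D$ has an out-branching with at least $k$ internal vertices. 2. If $T$ is a minimal out-branching of $D$, Rule 1 does not apply to $D$ with $U_T$, and $|V(D)|>8k^2+6k$, then $T$ has at least $k$ internal vertices. 3. MinLOB-PBGV has a kernel with at most $8k^2+6k$ vertices, computable in $O(n^6)$ steps. That is, there are a program $P$ for a random access machine (finitely many registers and arrays of natural numbers; constants, reads, writes, addition, truncated subtraction and zero tests at unit cost) and a constant $c$ such that $P$, started on any instance $(D,k)$ with $V(D)=\{0,\dots,n-1\}$ ($D$ given by its adjacency matrix), halts after at most $c\,n^6$ steps with an instance $(D',k')$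 of MinLOB-PBGV such that $k'\le k$, $|V(D')|\le 8k^2+6k$, and $(D,k)$ is a yes-instance if and only if $(D',k')$ is. Moreover, $P$ reports which of the following holds: either it also outputs an out-branching of $D$ with at most $n-k$ leaves, or $k'=k$ and $D'$ is isomorphic to an induced subdigraph of $D$. -/

import Mathlib

namespace MinLOB

section Digraphs

variable {V : Type*}

/-- No loops. (Parallel arcs cannot occur in a `Digraph`.) -/
def Loopless (D : Digraph V) : Prop := ∀ v, ¬ D.Adj v v

/-- The underlying graph `UG(D)`. -/
abbrev underlying (D : Digraph V) : SimpleGraph V := D.toSimpleGraphInclusive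

/-- A vertex of in-degree zero. -/
def InDegreeZero (D : Digraph V) (v : V) : Prop := ∀ u, ¬ D.Adj u v

/-- The out-degree of a vertex. -/
noncomputable def outDegree (D : Digraph V) (v : V) : ℕ := {w | D.Adj v w}.ncard

/-- `T` is an out-branching of `D`: a spanning subdigraph that is an oriented tree (no pair of
opposite arcs, and the underlying graph is a tree) with exactly one vertex of in-degree zero. -/
structure IsOutBranching (D T : Digraph V) : Prop where
  le : T ≤ D
  oriented : ∀ u v, T.Adj u v → ¬ T.Adj v u
  isTree : (underlying T).IsTree
  existsUnique_root : ∃! r, InDegreeZero T r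

/-- The leaves of `T`: the vertices of out-degree zero. -/
def leaves (T : Digraph V) : Set V := {v | ∀ w, ¬ T.Adj v w}

/-- The internal vertices of `T`: the vertices that are not leaves. -/
def internals (T : Digraph V) : Set V := {v | ∃ w, T.Adj v w}

/-- `ℓ_min(D)`: the least number of leaves of an out-branching of `D`, and `0` if there is none
(`sInf ∅ = 0` in `ℕ`). -/
noncomputable def lmin (D : Digraph V) : ℕ :=
  sInf {l | ∃ T, IsOutBranching D T ∧ (leaves T).ncard = l}

/-! ### One-changes and minimal out-branchings -/

/-- The 1-change for `(u, v)`: add the arc `(u, v)` to `T` and remove the arc of `T` that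
enters `v`. -/
def oneChange (T : Digraph V) (u v : V) : Digraph V where
  Adj x y := (x = u ∧ y = v) ∨ (T.Adj x y ∧ y ≠ v)

/-- `T` is a minimal out-branching of `D`: no 1-change for an arc of `A(D) \ A(T)` leads to an
out-branching with more internal vertices. -/
def IsMinimalOutBranching (D T : Digraph V) : Prop :=
  IsOutBranching D T ∧ ∀ u v, D.Adj u v → ¬ T.Adj u v → IsOutBranching D (oneChange T u v) →
    (internals (oneChange T u v)).ncard ≤ (internals T).ncard

/-- The set attached to a minimal out-branching `T`: the internal vertices of `T` together with
the leaves of `T` that are the only child of their parent. -/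
def coverOf (T : Digraph V) : Set V :=
  internals T ∪ {u | u ∈ leaves T ∧ ∃ p, T.Adj p u ∧ outDegree T p = 1}

/-! ### Crowns and the reduction rule -/

/-- `(H, C)` with `C = Cm ⊔ Cu` is a crown of `G`. -/
structure IsCrown (G : SimpleGraph V) (H Cm Cu : Set V) : Prop where
  disjoint_HC : Disjoint H (Cm ∪ Cu)
  disjoint_C : Disjoint Cm Cu
  neighbors : H = {v | ∃ c ∈ Cm ∪ Cu, G.Adj c v}
  indep : G.IsIndepSet (Cm ∪ Cu)
  matching : ∃ f : Cm ≃ H, ∀ c : Cm, G.Adj (c : V) (f c : V)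

/-- A vertex cover modified by including the vertices of in-degree zero. -/
def modifiedCover (D : Digraph V) (U : Set V) : Set V := U ∪ {v | InDegreeZero D v}

/-- The bipartite graph `B` built from `D` and `U`, with `W = Uᶜ`. A vertex `x` of `D` is
`Sum.inl x` and a pair `xy` is `Sum.inr (x, y)`. Its edges are the `{xy, w}` with `x, y ∈ U`,
`w ∈ W` and `(x, w), (w, y) ∈ A(D)`, and the `{x, w}` with `x ∈ U`, `w ∈ W` and `(x, w) ∈ A(D)`.
Elements of the carrier type outside `V(B) = N⁻(W) ∪ (U × U) ∪ W` are isolated; they belong to no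
crown `(H, C)` with `C ⊆ W`, because `H` is the set of neighbours of `C`. -/
def auxGraph (D : Digraph V) (U : Set V) : SimpleGraph (V ⊕ V × V) :=
  SimpleGraph.fromRel fun a b =>
    (∃ x ∈ U, ∃ y ∈ U, ∃ w ∈ Uᶜ, D.Adj x w ∧ D.Adj w y ∧ a = Sum.inr (x, y) ∧ b = Sum.inl w) ∨
    (∃ x ∈ U, ∃ w ∈ Uᶜ, D.Adj x w ∧ a = Sum.inl x ∧ b = Sum.inl w)

/-- The crown reduction rule applies to `D` with the vertex cover `U`: after `U` is modified, the
graph `B` has a crown `(H, C = Cm ⊔ Cu)` with `C ⊆ W` and `Cu ≠ ∅`. (The rule then removes `Cu`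
from `D`.) -/
def RuleApplies (D : Digraph V) (U : Set V) : Prop :=
  ∃ H Cm Cu : Set (V ⊕ V × V),
    IsCrown (auxGraph D (modifiedCover D U)) H Cm Cu ∧
    Cm ∪ Cu ⊆ Sum.inl '' (modifiedCover D U)ᶜ ∧ Cu.Nonempty

/-- `D` is irreducible: the crown reduction rule applies to `D` with no vertex cover. -/
def Irreducible (D : Digraph V) : Prop :=
  ∀ U : Set V, (underlying D).IsVertexCover U → ¬ RuleApplies D U

/-! ### The parameterized problem -/

/-- `(D, k)` is an instance of MinLOB-PBGV. -/
def IsInstance (D : Digraph V) (k : ℕ) : Prop := Loopless D ∧ 0 < lmin D ∧ 1 ≤ k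

/-- The question of MinLOB-PBGV: `ℓ_min(D) ≤ n - k` (an inequality between integers). -/
def Yes (D : Digraph V) (k : ℕ) : Prop := lmin D + k ≤ Nat.card V

end Digraphs

/-! ### A random access machine with a step count

Programs are structured programs over finitely many registers and arrays of natural numbers, with
indirect addressing. The only arithmetic operations are addition and truncated subtraction, each
of unit cost. -/

section Machine

/-- The memory: registers `reg i` and arrays `arr a` with cells `arr a i`. -/
structure Store where
  reg : ℕ → ℕ
  arr : ℕ → ℕ → ℕ

/-- Expressions: constants, registers, array cells, addition and truncated subtraction. -/
inductive Expr where
  | lit (m : ℕ)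
  | reg (i : ℕ)
  | cell (a : ℕ) (e : Expr)
  | add (e f : Expr)
  | sub (e f : Expr)

/-- The value of an expression. -/
def Expr.eval (s : Store) : Expr → ℕ
  | .lit m => m
  | .reg i => s.reg i
  | .cell a e => s.arr a (e.eval s)
  | .add e f => e.eval s + f.eval s
  | .sub e f => e.eval s - f.eval s

/-- The cost of evaluating an expression: one step for each constant, read and operation. -/
def Expr.cost : Expr → ℕ
  | .lit _ => 1
  | .reg _ => 1
  | .cell _ e => e.cost + 1
  | .add e f => e.cost + f.cost + 1
  | .sub e f => e.cost + f.cost + 1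

/-- Programs. A test succeeds if the value of its expression is not zero. -/
inductive Cmd where
  | skip
  | setReg (i : ℕ) (e : Expr)
  | setCell (a : ℕ) (e f : Expr)
  | seq (c d : Cmd)
  | ifte (e : Expr) (c d : Cmd)
  | loop (e : Expr) (c : Cmd)

/-- `reg i := m`. -/
def Store.setReg (s : Store) (i m : ℕ) : Store :=
  { s with reg := Function.update s.reg i m }

/-- `arr a j := m`. -/
def Store.setCell (s : Store) (a j m : ℕ) : Store :=
  { s with arr := Function.update s.arr a (Function.update (s.arr a) j m) }

/-- `Exec c s t s'`: program `c`, started in `s`, halts in `s'` after exactly `t` steps. -/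
inductive Exec : Cmd → Store → ℕ → Store → Prop
  | skip (s : Store) : Exec .skip s 1 s
  | setReg (s : Store) (i : ℕ) (e : Expr) :
      Exec (.setReg i e) s (e.cost + 1) (s.setReg i (e.eval s))
  | setCell (s : Store) (a : ℕ) (e f : Expr) :
      Exec (.setCell a e f) s (e.cost + f.cost + 1) (s.setCell a (e.eval s) (f.eval s))
  | seq {c d : Cmd} {s s' s'' : Store} {t t' : ℕ} :
      Exec c s t s' → Exec d s' t' s'' → Exec (.seq c d) s (t + t') s''
  | ifTrue {e : Expr} {c d : Cmd} {s s' : Store} {t : ℕ} :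
      e.eval s ≠ 0 → Exec c s t s' → Exec (.ifte e c d) s (e.cost + 1 + t) s'
  | ifFalse {e : Expr} {c d : Cmd} {s s' : Store} {t : ℕ} :
      e.eval s = 0 → Exec d s t s' → Exec (.ifte e c d) s (e.cost + 1 + t) s'
  | loopStop {e : Expr} {c : Cmd} {s : Store} :
      e.eval s = 0 → Exec (.loop e c) s (e.cost + 1) s
  | loopStep {e : Expr} {c : Cmd} {s s' s'' : Store} {t t' : ℕ} :
      e.eval s ≠ 0 → Exec c s t s' → Exec (.loop e c) s' t' s'' →
        Exec (.loop e c) s (e.cost + 1 + t + t') s''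

/-- The array `A` holds the adjacency matrix of `D`, row by row. -/
def EncodesArcs (A : ℕ → ℕ) {n : ℕ} (D : Digraph (Fin n)) : Prop :=
  ∀ u v : Fin n, (D.Adj u v → A (u * n + v) = 1) ∧ (¬ D.Adj u v → A (u * n + v) = 0)

/-- Registers `0`, `1` and array `0` hold `n`, `k` and the adjacency matrix of `D`. -/
def EncodesInstance (s : Store) {n : ℕ} (D : Digraph (Fin n)) (k : ℕ) : Prop :=
  s.reg 0 = n ∧ s.reg 1 = k ∧ EncodesArcs (s.arr 0) D

open Classical in
/-- The memory that holds the instance `(D, k)` and is zero elsewhere. -/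
noncomputable def initStore {n : ℕ} (D : Digraph (Fin n)) (k : ℕ) : Store where
  reg i := if i = 0 then n else if i = 1 then k else 0
  arr a i := if a = 0 ∧ ∃ u v : Fin n, D.Adj u v ∧ i = u * n + v then 1 else 0

end Machine

end MinLOB

/-!
Let `T` be an out-branching, given by a parent function, and call a leaf *spare* if it has a
sibling. All other vertices are the root, internal vertices, or only children, so that there are
at most `2 i + 1` of them when `T` has `i` internal vertices (`ncard_diff_spare_le`). If some arc
joins two spare leaves, then moving its head below its tail creates an internal vertex and
destroys none (`insert_inner_subset_update`). Hence the spare leaves `W` of a minimal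
out-branching are independent: the remaining vertices form a vertex cover `U`, and every vertex of
`W` has its neighbours in `U`.

*Irreducible digraphs.* The neighbours of `W` in the auxiliary bipartite graph are vertices `x`
and pairs `(x, y)` of the cover. If `W` outnumbers them, then by Hall's theorem it contains a
crown with an unmatched vertex (`exists_crown`), and the reduction rule applies. Otherwise `|V| ≤
2 |U| + |U| ^ 2` with `|U| ≤ 2 k - 1` if there are fewer than `k` internal vertices, which
contradicts `|V| > 8 k ^ 2 + 6 k`.

*The kernelization.* The program finds an out-branching by graph search and moves spare leaves
until they are independent. With at least `k` internal vertices, it outputs the tree and a trivial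
positive instance. Otherwise it matches the spare leaves one after the other into the auxiliary
graph by augmenting paths, and gives up each leaf `w₀` for which there is none. The set `R` of
vertices reached by alternating paths from `w₀` then has all its neighbours matched into `R \
{w₀}`, and this is enough to delete `w₀` on its own (`HasArb.diff_singleton`): in any
out-branching, each `v ∈ R` is hung below the vertex of its match, and each child `y` of a vertex
`w ∈ R` with parent `x` is hung below the vertex matched to `(x, y)`. Internal vertices are
replaced injectively. If the root is in `R`, an arc into it closes a cycle, and the vertex that
replaces the root on this cycle becomes the new root. The vertices that remain are those of `U`
and the matched ones.

*The machine.* `Prog` consists of programs with loops of length `n + O(1)`. Such programs are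
interpreted by a total function `Prog.run`, about which correctness is proved with an invariant
rule (`Prog.run_rep`), and they are executed by the machine in a number of steps whose degree is
the nesting depth of the loops (`Prog.exists_exec`), which is `5` for `kernelProg`.
-/

namespace MinLOB

/-! ### Arborescences given by parent functions -/

section Arborescence

variable {V : Type*} {G : V → V → Prop} {A : Set V} {r : V} {p : V → V}

/-- The parent function `p` describes an arborescence of the digraph `G` on the vertex set `A` with
root `r`; the values of `p` at `r` and outside `A` are irrelevant. Acyclicity is witnessed by a rank
that decreases from each vertex to its parent. -/
structure Arb (G : V → V → Prop) (A : Set V) (r : V) (p : V → V) : Prop where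
  root_mem : r ∈ A
  parent_mem : ∀ v ∈ A, v ≠ r → p v ∈ A
  adj : ∀ v ∈ A, v ≠ r → G (p v) v
  rank : ∃ d : V → ℕ, ∀ v ∈ A, v ≠ r → d (p v) < d v

/-- The internal vertices of an arborescence: the parents of the non-roots. -/
def inner (A : Set V) (r : V) (p : V → V) : Set V := p '' (A \ {r})

/-- `G` has an arborescence on `A` with at least `k` internal vertices. -/
def HasArb (G : V → V → Prop) (A : Set V) (k : ℕ) : Prop :=
  ∃ r p, Arb G A r p ∧ k ≤ (inner A r p).ncard

/-- The spare leaves of an arborescence: the leaves other than the root that have a sibling. They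
can be moved without turning their parent into a leaf. -/
def spare (A : Set V) (r : V) (p : V → V) : Set V :=
  {u | u ∈ A ∧ u ≠ r ∧ (∀ z ∈ A, z ≠ r → p z ≠ u) ∧ ∃ z ∈ A, z ≠ r ∧ z ≠ u ∧ p z = p u}

theorem inner_finite (hA : A.Finite) : (inner A r p).Finite := (hA.subset Set.sdiff_subset).image p

theorem mem_inner {u : V} : u ∈ inner A r p ↔ ∃ v ∈ A, v ≠ r ∧ p v = u := by
  simp [inner, and_assoc]

/-- Apart from the root, a vertex that is not spare is internal or the only child of its parent, and
there are at most as many only children as internal vertices. -/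
theorem ncard_diff_spare_le (hA : A.Finite) :
    (A \ spare A r p).ncard ≤ 2 * (inner A r p).ncard + 1 := by
  classical
  set O : Set V := {u | u ∈ A ∧ u ≠ r ∧ ∀ z ∈ A, z ≠ r → z ≠ u → p z ≠ p u} with hO
  have hsub : A \ spare A r p ⊆ insert r (inner A r p ∪ O) := by
    intro u hu
    by_cases hr : u = r
    · exact Or.inl hr
    refine Or.inr ?_
    by_contra hcon
    simp only [Set.mem_union, not_or] at hcon
    refine hu.2 ⟨hu.1, hr, fun z hz hzr h => hcon.1 (mem_inner.2 ⟨z, hz, hzr, h⟩), ?_⟩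
    have := hcon.2
    simp only [hO, Set.mem_ofPred_eq, not_and, not_forall, not_not] at this
    obtain ⟨z, h1, h2, h3, h4⟩ := this hu.1 hr
    exact ⟨z, h1, h2, h3, h4⟩
  have hOfin : O.Finite := hA.subset fun u hu => hu.1
  have hI := inner_finite (r := r) (p := p) hA
  have hOle : O.ncard ≤ (inner A r p).ncard := by
    refine Set.ncard_le_ncard_of_injOn p (fun u hu => mem_inner.2 ⟨u, hu.1, hu.2.1, rfl⟩) ?_ hI
    intro u hu v hv huv
    by_contra hne
    exact hv.2.2 u hu.1 hu.2.1 hne huv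
  calc (A \ spare A r p).ncard ≤ (insert r (inner A r p ∪ O)).ncard :=
        Set.ncard_le_ncard hsub ((hI.union hOfin).insert r)
    _ ≤ (inner A r p ∪ O).ncard + 1 := Set.ncard_insert_le _ _
    _ ≤ (inner A r p).ncard + O.ncard + 1 := by gcongr; exact Set.ncard_union_le _ _
    _ ≤ _ := by omega

section Update

variable [DecidableEq V] {u v : V}

/-- A spare leaf `v` is moved below `u`. Its rank is adapted; no other vertex has `v` as parent. -/
theorem Arb.update (h : Arb G A r p) (hu : u ∈ A) (hv : v ∈ spare A r p)
    (huv : G u v) (hne : u ≠ v) : Arb G A r (Function.update p v u) := by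
  obtain ⟨d, hd⟩ := h.rank
  refine ⟨h.root_mem, fun z hz hzr => ?_, fun z hz hzr => ?_, ⟨Function.update d v (d u + 1), ?_⟩⟩
  · by_cases hzv : z = v
    · subst hzv; simpa
    · simpa [hzv] using h.parent_mem z hz hzr
  · by_cases hzv : z = v
    · subst hzv; simpa
    · simpa [hzv] using h.adj z hz hzr
  · intro z hz hzr
    by_cases hzv : z = v
    · subst hzv; simp [hne]
    · have := hv.2.2.1 z hz hzr
      simpa [hzv, this] using hd z hz hzr

/-- When a spare leaf is moved below another one, no leaf becomes spare. -/
theorem spare_update_subset (hu : u ∈ spare A r p) (hv : v ∈ spare A r p) (hne : u ≠ v) :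
    spare A r (Function.update p v u) ⊆ spare A r p \ {v} := by
  intro z hz
  obtain ⟨hzA, hzr, hleaf, t, htA, htr, htz, ht⟩ := hz
  have hzv : z ≠ v := by
    rintro rfl
    rw [Function.update_of_ne htz, Function.update_self] at ht
    exact hu.2.2.1 t htA htr ht
  rw [Function.update_of_ne hzv] at ht
  refine ⟨⟨hzA, hzr, fun s hs hsr hsz => ?_, ?_⟩, hzv⟩
  · by_cases hsv : s = v
    · subst hsv
      obtain ⟨b, hb, hbr, hbs, hbp⟩ := hv.2.2.2
      refine hleaf b hb hbr ?_
      rw [Function.update_of_ne hbs, hbp, hsz]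
    · exact hleaf s hs hsr (by rw [Function.update_of_ne hsv, hsz])
  · by_cases htv : t = v
    · subst htv
      rw [Function.update_self] at ht
      exact absurd ht.symm (hu.2.2.1 z hzA hzr)
    · rw [Function.update_of_ne htv] at ht
      exact ⟨t, htA, htr, htz, ht⟩

/-- When a spare leaf is moved below `u`, its former parent stays internal because of the sibling.
-/
theorem insert_inner_subset_update (hv : v ∈ spare A r p) :
    insert u (inner A r p) ⊆ inner A r (Function.update p v u) := by
  rintro x (rfl | hx)
  · exact mem_inner.2 ⟨v, hv.1, hv.2.1, by simp⟩
  · obtain ⟨z, hz, hzr, rfl⟩ := mem_inner.1 hx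
    by_cases hzv : z = v
    · subst hzv
      obtain ⟨b, hb, hbr, hbs, hbp⟩ := hv.2.2.2
      exact mem_inner.2 ⟨b, hb, hbr, by rw [Function.update_of_ne hbs, hbp]⟩
    · exact mem_inner.2 ⟨z, hz, hzr, by rw [Function.update_of_ne hzv]⟩

end Update

/-- Arborescences are transported along an embedding of digraphs. -/
theorem hasArb_range_iff {V' : Type*} {G' : V' → V' → Prop} (f : V → V')
    (hf : Function.Injective f) (hG : ∀ u v, G u v ↔ G' (f u) (f v)) (k : ℕ) :
    HasArb G Set.univ k ↔ HasArb G' (Set.range f) k := by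
  constructor
  · rintro ⟨r, p, h, hk⟩
    have : Nonempty V := ⟨r⟩
    have hinv := Function.leftInverse_invFun hf
    obtain ⟨d, hd⟩ := h.rank
    refine ⟨f r, fun v => f (p (Function.invFun f v)), ⟨⟨r, rfl⟩, ?_, ?_,
      ⟨fun v => d (Function.invFun f v), ?_⟩⟩, ?_⟩
    · rintro _ ⟨v, rfl⟩ _
      exact ⟨_, rfl⟩
    · rintro _ ⟨v, rfl⟩ hv
      rw [hinv v, ← hG]
      exact h.adj v trivial fun e => hv (by rw [e])
    · rintro _ ⟨v, rfl⟩ hv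
      rw [hinv v]
      simp only [hinv _]
      exact hd v trivial fun e => hv (by rw [e])
    · have : inner (Set.range f) (f r) (fun v => f (p (Function.invFun f v))) =
          f '' inner Set.univ r p := by
        ext x
        simp only [mem_inner, Set.mem_range, exists_exists_eq_and, hinv _, Set.mem_image,
          hf.ne_iff, Set.mem_univ, true_and]
        constructor
        · rintro ⟨v, hv, rfl⟩; exact ⟨_, ⟨v, hv, rfl⟩, rfl⟩
        · rintro ⟨_, ⟨v, hv, rfl⟩, rfl⟩; exact ⟨v, hv, rfl⟩
      rwa [this, Set.ncard_image_of_injective _ hf]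
  · rintro ⟨_, p, h, hk⟩
    obtain ⟨r, rfl⟩ := h.root_mem
    have : Nonempty V := ⟨r⟩
    have hinv := Function.leftInverse_invFun hf
    have hp : ∀ v, v ≠ r → f (Function.invFun f (p (f v))) = p (f v) := fun v hv =>
      Function.invFun_eq (h.parent_mem _ ⟨v, rfl⟩ (hf.ne hv))
    obtain ⟨d, hd⟩ := h.rank
    refine ⟨r, fun v => Function.invFun f (p (f v)), ⟨trivial, fun _ _ _ => trivial, ?_,
      ⟨fun v => d (f v), ?_⟩⟩, ?_⟩
    · intro v _ hv
      rw [hG, hp v hv]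
      exact h.adj _ ⟨v, rfl⟩ (hf.ne hv)
    · intro v _ hv
      simp only [hp v hv]
      exact hd _ ⟨v, rfl⟩ (hf.ne hv)
    · have : inner (Set.range f) (f r) p =
          f '' inner Set.univ r (fun v => Function.invFun f (p (f v))) := by
        ext x
        simp only [mem_inner, Set.mem_range, exists_exists_eq_and, Set.mem_image,
          hf.ne_iff, Set.mem_univ, true_and]
        constructor
        · rintro ⟨v, hv, rfl⟩; exact ⟨_, ⟨v, hv, rfl⟩, hp v hv⟩
        · rintro ⟨_, ⟨v, hv, rfl⟩, rfl⟩; exact ⟨v, hv, (hp v hv).symm⟩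
      rwa [this, Set.ncard_image_of_injective _ hf] at hk

end Arborescence

/-! ### Removing an unmatched vertex -/

section Reduction

variable {V : Type*} {G : V → V → Prop} {A U R : Set V} {w₀ : V} {m : V → V × Option V} {k : ℕ}

/-- `m` matches the vertices of `M` injectively to neighbours in the bipartite graph that joins
`(x, none)` to the out-neighbours `w` of `x`, and `(x, some y)` to the middle vertices `w` of the
directed paths `x, w, y`. -/
structure Matches (G : V → V → Prop) (M : Set V) (m : V → V × Option V) : Prop where
  injOn : Set.InjOn m M
  adj_fst : ∀ v ∈ M, G (m v).1 v
  adj_snd : ∀ v ∈ M, ∀ y, (m v).2 = some y → G v y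

/-- `R` is closed with respect to alternating paths of the matching `m` of `R \ {w₀}`: everything
adjacent to `R` is matched. -/
def Saturates (G : V → V → Prop) (R : Set V) (w₀ : V) (m : V → V × Option V) : Prop :=
  ∀ v ∈ R, ∀ x, G x v → (∃ v' ∈ R \ {w₀}, m v' = (x, none)) ∧
    ∀ y, G v y → ∃ v' ∈ R \ {w₀}, m v' = (x, some y)

/-- The new parents: a vertex of `R` is attached to the first component of its match, and a vertex
`v` whose parent `w` was in `R` becomes a child of the vertex `c (x w) (some v)` matched to
`(x w, v)`. -/
noncomputable def rewire (R : Set V) (p x : V → V) (m : V → V × Option V) (c : V → Option V → V)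
    (v : V) : V :=
  open Classical in
  if v ∈ R then (m v).1 else if p v ∈ R then c (x (p v)) (some v) else p v

/-- The common part of the cases whether or not the root lies in `R`. The function `x` gives the
parents of the vertices of `R`, where the old root, if it is in `R`, gets one of its in-neighbours
as parent. The new root is `r'`. The function `e` ranks the vertices outside `R`, a vertex of `R`
comes one above its new parent, and the new root, if it is in `R`, gets rank `0`. The function `c`
inverts the matching. -/
theorem hasArb_rewire {r r' : V} {p x : V → V} {c : V → Option V → V} {e : V → ℕ} (hA : A.Finite)
    (hUA : U ⊆ A) (hcov : ∀ u v, G u v → u ∈ U ∨ v ∈ U) (hRA : R ⊆ A) (hRU : Disjoint R U)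
    (hw₀ : w₀ ∈ R) (hm : Matches G (R \ {w₀}) m) (hsat : Saturates G R w₀ m)
    (hc : ∀ z o, (∃ v ∈ R \ {w₀}, m v = (z, o)) → c z o ∈ R \ {w₀} ∧ m (c z o) = (z, o))
    (h : Arb G A r p) (hk : k ≤ (inner A r p).ncard)
    (hx : ∀ w ∈ R, G (x w) w) (hr' : r' ∈ A \ {w₀}) (hroot : ∀ v ∈ A, v ∉ R → (v = r' ↔ v = r))
    (hsome : r' ∈ R → (m r').2 ≠ none)
    (he₁ : ∀ v ∈ A, v ∉ R → v ≠ r' → p v ∉ R → e (p v) < e v)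
    (he₂ : ∀ v ∈ A, v ∉ R → v ≠ r' → p v ∈ R → c (x (p v)) (some v) ≠ r' →
      e (x (p v)) + 1 < e v)
    (he₀ : r' ∈ R → ∀ v, 0 < e v) : HasArb G (A \ {w₀}) k := by
  classical
  have hnU : ∀ v ∈ R, v ∉ U := fun v hv hvU => hRU.le_bot ⟨hv, hvU⟩
  have hinU : ∀ v ∈ R, ∀ u, G u v → u ∈ U := fun v hv u huv =>
    (hcov u v huv).resolve_right (hnU v hv)
  have houtU : ∀ v ∈ R, ∀ u, G v u → u ∈ U := fun v hv u huv =>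
    (hcov v u huv).resolve_left (hnU v hv)
  have hUR : ∀ u ∈ U, u ∉ R := fun u hu hR => hnU u hR hu
  have hUne : ∀ u ∈ U, u ∈ A \ {w₀} := fun u hu =>
    ⟨hUA hu, fun e => hUR u hu (by rw [Set.mem_singleton_iff.1 e]; exact hw₀)⟩
  -- the replacement of the parent of `v`
  have hcv : ∀ v ∈ A, v ∉ R → v ≠ r' → p v ∈ R →
      c (x (p v)) (some v) ∈ R \ {w₀} ∧ m (c (x (p v)) (some v)) = (x (p v), some v) := by
    intro v hv hvR hvr hpR
    have hvr0 : v ≠ r := fun e => hvr ((hroot v hv hvR).2 e)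
    exact hc _ _ ((hsat _ hpR _ (hx _ hpR)).2 v (h.adj v hv hvr0))
  have hq₁ : ∀ v ∈ R, rewire R p x m c v = (m v).1 := fun v hv => by simp [rewire, hv]
  have hq₂ : ∀ v ∉ R, p v ∈ R → rewire R p x m c v = c (x (p v)) (some v) := fun v hv hp => by
    simp [rewire, hv, hp]
  have hq₃ : ∀ v ∉ R, p v ∉ R → rewire R p x m c v = p v := fun v hv hp => by
    simp [rewire, hv, hp]
  refine ⟨r', rewire R p x m c, ⟨hr', ?_, ?_, ?_⟩, hk.trans ?_⟩
  · rintro v ⟨hv, hvw⟩ hvr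
    by_cases hvR : v ∈ R
    · rw [hq₁ v hvR]
      exact hUne _ (hinU v hvR _ (hm.adj_fst v ⟨hvR, hvw⟩))
    · by_cases hpR : p v ∈ R
      · rw [hq₂ v hvR hpR]
        have := (hcv v hv hvR hvr hpR).1
        exact ⟨hRA this.1, this.2⟩
      · rw [hq₃ v hvR hpR]
        refine ⟨h.parent_mem v hv fun e => hvr ((hroot v hv hvR).2 e), ?_⟩
        rintro e
        exact hpR (by rw [Set.mem_singleton_iff.1 e]; exact hw₀)
  · rintro v ⟨hv, hvw⟩ hvr
    by_cases hvR : v ∈ R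
    · rw [hq₁ v hvR]
      exact hm.adj_fst v ⟨hvR, hvw⟩
    · by_cases hpR : p v ∈ R
      · rw [hq₂ v hvR hpR]
        have := hcv v hv hvR hvr hpR
        exact hm.adj_snd _ this.1 v (by rw [this.2])
      · rw [hq₃ v hvR hpR]
        exact h.adj v hv fun e => hvr ((hroot v hv hvR).2 e)
  · refine ⟨fun v => if v = r' ∧ v ∈ R then 0 else if v ∈ R then e (m v).1 + 1 else e v, ?_⟩
    rintro v ⟨hv, hvw⟩ hvr
    by_cases hvR : v ∈ R
    · have := hUR _ (hinU v hvR _ (hm.adj_fst v ⟨hvR, hvw⟩))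
      simp [hq₁ v hvR, hvr, hvR, this]
    · by_cases hpR : p v ∈ R
      · have h2 := hcv v hv hvR hvr hpR
        rw [hq₂ v hvR hpR]
        by_cases hcr : c (x (p v)) (some v) = r'
        · have hrR : r' ∈ R := hcr ▸ h2.1.1
          simp [hcr, hvR, he₀ hrR v, hrR]
        · simp [hcr, hvR, h2.1.1, h2.2, he₂ v hv hvR hvr hpR hcr]
      · simp [hq₃ v hvR hpR, hvR, hpR, he₁ v hv hvR hvr hpR]
  · -- an internal vertex outside `R` stays internal, and one in `R` is replaced by the match of a
    -- pair that contains one of its children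
    have hch : ∀ u ∈ inner A r p, ∃ v ∈ A, v ≠ r ∧ p v = u := fun u hu => mem_inner.1 hu
    choose! ch hchA hchr hchp using hch
    have hR : ∀ u ∈ inner A r p, u ∈ R → ch u ∉ R ∧ ch u ≠ r' ∧ p (ch u) ∈ R := by
      intro u hu huR
      have h1 : ch u ∉ R := hUR _ (houtU u huR _ (by
        have := h.adj _ (hchA u hu) (hchr u hu)
        rwa [hchp u hu] at this))
      exact ⟨h1, fun e => hchr u hu ((hroot _ (hchA u hu) h1).1 e), by rwa [hchp u hu]⟩
    have hw₀' : ∀ v, v ∉ R → v ≠ w₀ := fun v hv e => hv (e ▸ hw₀)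
    refine Set.ncard_le_ncard_of_injOn
      (fun u => if u ∈ R then rewire R p x m c (ch u) else u) ?_ ?_
      (inner_finite (hA.subset Set.sdiff_subset))
    · intro u hu
      split_ifs with huR
      · obtain ⟨h1, h2, _⟩ := hR u hu huR
        exact mem_inner.2 ⟨ch u, ⟨hchA u hu, hw₀' _ h1⟩, h2, rfl⟩
      · obtain ⟨v, hv, hvr, rfl⟩ := mem_inner.1 hu
        by_cases hvR : v ∈ R
        · obtain ⟨⟨h1, h2⟩, h3⟩ := hc _ _ (hsat v hvR _ (h.adj v hv hvr)).1
          refine mem_inner.2 ⟨_, ⟨hRA h1, h2⟩, ?_, by rw [hq₁ _ h1, h3]⟩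
          intro e
          rw [e] at h1 h3
          exact hsome h1 (by rw [h3])
        · exact mem_inner.2
            ⟨v, ⟨hv, hw₀' _ hvR⟩, fun e => hvr ((hroot v hv hvR).1 e), hq₃ v hvR huR⟩
    · intro u hu u' hu' huu
      have key : ∀ z ∈ inner A r p, z ∈ R → rewire R p x m c (ch z) ∈ R ∧
          (m (rewire R p x m c (ch z))).2 = some (ch z) := by
        intro z hz hzR
        obtain ⟨h1, h2, h3⟩ := hR z hz hzR
        have := hcv _ (hchA z hz) h1 h2 h3
        rw [hq₂ _ h1 h3]
        exact ⟨this.1.1, by rw [this.2]⟩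
      simp only at huu
      split_ifs at huu with h1 h2 h2
      · have h3 := (key u hu h1).2
        rw [huu, (key u' hu' h2).2, Option.some_inj] at h3
        rw [← hchp u hu, ← hchp u' hu', h3]
      · exact absurd (huu ▸ (key u hu h1).1) h2
      · exact absurd (huu ▸ (key u' hu' h2).1) h1
      · exact huu

/-- **Removing an unmatched vertex.** Let `U` be a vertex cover and `R` a set of other vertices
such that everything adjacent to `R` in the auxiliary bipartite graph is matched into `R \ {w₀}`.
Then arborescences need not use `w₀`. -/
theorem HasArb.diff_singleton (hA : A.Finite) (hUA : U ⊆ A)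
    (hcov : ∀ u v, G u v → u ∈ U ∨ v ∈ U) (hRA : R ⊆ A) (hRU : Disjoint R U) (hw₀ : w₀ ∈ R)
    (hin : ∀ v ∈ R, ∃ u, G u v) (hm : Matches G (R \ {w₀}) m) (hsat : Saturates G R w₀ m)
    (h : HasArb G A k) : HasArb G (A \ {w₀}) k := by
  classical
  obtain ⟨r, p, h, hk⟩ := h
  have hUR : ∀ u ∈ U, u ∉ R := fun u hu hR => hRU.le_bot ⟨hR, hu⟩
  obtain ⟨d, hd⟩ := h.rank
  obtain ⟨c, hc⟩ : ∃ c : V → Option V → V, ∀ z o, (∃ v ∈ R \ {w₀}, m v = (z, o)) →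
      c z o ∈ R \ {w₀} ∧ m (c z o) = (z, o) :=
    ⟨fun z o => if h : ∃ v ∈ R \ {w₀}, m v = (z, o) then h.choose else w₀, fun z o h => by
      simp only [h, dif_pos]
      exact h.choose_spec⟩
  by_cases hrR : r ∈ R
  swap
  · -- doubled ranks leave room for the vertex of `R` on the way from `p (p v)` to `v`
    refine hasArb_rewire (x := p) (e := fun v => 2 * d v) (r' := r) hA hUA hcov hRA hRU hw₀ hm hsat
      hc h hk ?_ ?_ ?_ ?_ ?_ ?_ ?_
    · exact fun w hw => h.adj w (hRA hw) fun e => hrR (e ▸ hw)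
    · exact ⟨h.root_mem, fun e => hrR (by rw [Set.mem_singleton_iff.1 e]; exact hw₀)⟩
    · exact fun v _ _ => Iff.rfl
    · exact fun h => absurd h hrR
    · intro v hv _ hvr _
      have := hd v hv hvr
      omega
    · intro v hv _ hvr hp _
      have h1 := hd v hv hvr
      have h2 := hd (p v) (hRA hp) fun e => hrR (e ▸ hp)
      omega
    · exact fun h => absurd h hrR
  -- The root `r` is in `R`. An arc from `x₀` to `r` closes a directed cycle through a child `y` of
  -- `r`, and the new root is the replacement of `r` on this cycle. The descendants `S` of `y`, with
  -- `x₀` among them, keep their order, and the ranks of the other vertices are shifted above that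
  -- of `x₀`, since the other children of `r` end up below `x₀`.
  obtain ⟨x₀, hx₀⟩ := hin r hrR
  have hx₀U : x₀ ∈ U := (hcov _ _ hx₀).resolve_right fun hr => hUR r hr hrR
  have hx₀r : x₀ ≠ r := fun e => hUR _ hx₀U (e ▸ hrR)
  set step : V → V → Prop := fun a b => b ∈ A ∧ b ≠ r ∧ p b = a with hstep
  have hex : ∀ i, ∀ v ∈ A, v ≠ r → d v ≤ i →
      ∃ y ∈ A, y ≠ r ∧ p y = r ∧ Relation.ReflTransGen step y v := by
    intro i
    induction i with
    | zero =>
      intro v hv hvr hi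
      have := hd v hv hvr
      omega
    | succ i ih =>
      intro v hv hvr hi
      by_cases hpr : p v = r
      · exact ⟨v, hv, hvr, hpr, .refl⟩
      · have := hd v hv hvr
        obtain ⟨y, hy, hyr, hyp, hyv⟩ := ih (p v) (h.parent_mem v hv hvr) hpr (by omega)
        exact ⟨y, hy, hyr, hyp, hyv.tail ⟨hv, hvr, rfl⟩⟩
  obtain ⟨y, hy, hyr, hyp, hyx⟩ := hex _ x₀ (hUA hx₀U) hx₀r le_rfl
  set S : Set V := {v | Relation.ReflTransGen step y v} with hS
  have hrS : r ∉ S := by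
    intro hr
    rcases Relation.ReflTransGen.cases_tail hr with e | ⟨b, _, hb⟩
    · exact hyr e.symm
    · exact hb.2.1 rfl
  have hSp : ∀ v ∈ A, v ≠ r → v ≠ y → (v ∈ S ↔ p v ∈ S) := by
    intro v hv hvr hvy
    constructor
    · intro hvS
      rcases Relation.ReflTransGen.cases_tail hvS with e | ⟨b, hb, hb'⟩
      · exact absurd e hvy
      · rw [hb'.2.2]; exact hb
    · exact fun hp => Relation.ReflTransGen.tail hp ⟨hv, hvr, rfl⟩
  have hyU : y ∈ U := (hcov r y (hyp ▸ h.adj y hy hyr)).resolve_left fun hr => hUR r hr hrR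
  obtain ⟨⟨hr'R, hr'w⟩, hr'm⟩ := hc _ _ ((hsat r hrR x₀ hx₀).2 y (hyp ▸ h.adj y hy hyr))
  set r' := c x₀ (some y) with hr'
  have hne : ∀ v, v ∉ R → v ≠ r' ∧ v ≠ r := fun v hv =>
    ⟨fun e => hv (e ▸ hr'R), fun e => hv (e ▸ hrR)⟩
  refine hasArb_rewire (x := fun w => if w = r then x₀ else p w)
    (e := fun v => if v ∈ S then 2 * d v + 2 else 2 * d v + 2 * d x₀ + 4) (r' := r')
    hA hUA hcov hRA hRU hw₀ hm hsat hc h hk ?_ ?_ ?_ ?_ ?_ ?_ ?_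
  · intro w hw
    by_cases hwr : w = r
    · simpa [hwr] using hx₀
    · simpa [hwr] using h.adj w (hRA hw) hwr
  · exact ⟨hRA hr'R, hr'w⟩
  · exact fun v _ hv => iff_of_false (hne v hv).1 (hne v hv).2
  · intro _ e
    rw [hr'm] at e
    cases e
  · intro v hv hvR _ hpR
    have hvy : v ≠ y := fun e => hpR (by rw [e, hyp]; exact hrR)
    have h1 := hSp v hv (hne v hvR).2 hvy
    have h2 := hd v hv (hne v hvR).2
    by_cases hvS : v ∈ S
    · simp only [hvS, h1.1 hvS, if_true]
      omega
    · simp only [hvS, mt h1.2 hvS, if_false]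
      omega
  · intro v hv hvR _ hpR hcr
    have hvr := (hne v hvR).2
    have h2 := hd v hv hvr
    by_cases hpr : p v = r
    · have hvy : v ≠ y := by
        rintro rfl
        exact hcr (by simp [hpr, hr'])
      have hvS : v ∉ S := by
        rw [hSp v hv hvr hvy, hpr]
        exact hrS
      have hx₀S : x₀ ∈ S := hyx
      simp only [hpr, if_true, hx₀S, hvS, if_false]
      omega
    · have hvy : v ≠ y := fun e => hpr (by rw [e, hyp])
      have hpy : p v ≠ y := fun e => hUR y hyU (e ▸ hpR)
      have h3 := hd (p v) (hRA hpR) hpr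
      have h1 := (hSp v hv hvr hvy).trans (hSp (p v) (hRA hpR) hpr hpy)
      simp only [hpr, if_false]
      by_cases hvS : v ∈ S
      · simp only [hvS, h1.1 hvS, if_true]
        omega
      · simp only [hvS, mt h1.2 hvS, if_false]
        omega
  · intro _ v
    split_ifs <;> omega

/-- A vertex outside a vertex cover can be attached to an arborescence as a leaf. -/
theorem HasArb.of_diff_singleton (hA : A.Finite) (hUA : U ⊆ A) (hw₀A : w₀ ∈ A) (hw₀U : w₀ ∉ U)
    (hcov : ∀ u v, G u v → u ∈ U ∨ v ∈ U) (hin : ∃ u, G u w₀) (h : HasArb G (A \ {w₀}) k) :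
    HasArb G A k := by
  classical
  obtain ⟨r, p, h, hk⟩ := h
  obtain ⟨x, hx⟩ := hin
  have hxU : x ∈ U := (hcov _ _ hx).resolve_right hw₀U
  have hxw : x ≠ w₀ := fun e => hw₀U (e ▸ hxU)
  obtain ⟨d, hd⟩ := h.rank
  refine ⟨r, Function.update p w₀ x, ⟨h.root_mem.1, ?_, ?_, Function.update d w₀ (d x + 1), ?_⟩,
    hk.trans (Set.ncard_le_ncard ?_ (inner_finite hA))⟩
  · intro v hv hvr
    by_cases hvw : v = w₀
    · subst hvw; simpa using hUA hxU
    · simpa [hvw] using (h.parent_mem v ⟨hv, hvw⟩ hvr).1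
  · intro v hv hvr
    by_cases hvw : v = w₀
    · subst hvw; simpa
    · simpa [hvw] using h.adj v ⟨hv, hvw⟩ hvr
  · intro v hv hvr
    by_cases hvw : v = w₀
    · subst hvw; simp [hxw]
    · have hp : p v ≠ w₀ := (h.parent_mem v ⟨hv, hvw⟩ hvr).2
      simpa [hvw, hp] using hd v ⟨hv, hvw⟩ hvr
  · intro u hu
    obtain ⟨v, ⟨hv, hvw⟩, hvr, rfl⟩ := mem_inner.1 hu
    exact mem_inner.2 ⟨v, hv, hvr, by rw [Function.update_of_ne hvw]⟩

end Reduction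

/-! ### Out-branchings as arborescences -/

section Bridge

variable {V : Type*} {D T : Digraph V} {r : V} {p : V → V}

/-- The digraph of a parent function. -/
def treeOf (r : V) (p : V → V) : Digraph V where
  Adj u v := v ≠ r ∧ p v = u

theorem underlying_adj {u v : V} : (underlying T).Adj u v ↔ u ≠ v ∧ (T.Adj u v ∨ T.Adj v u) :=
  Iff.rfl

theorem internals_treeOf : internals (treeOf r p) = inner Set.univ r p := by
  ext u
  simp [internals, treeOf, mem_inner]

/-- The modified cover contains no spare leaf; in particular the vertices of in-degree zero are
added to it at no cost, since the root is not spare. -/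
theorem coverOf_treeOf_subset (h : Arb D.Adj Set.univ r p) :
    modifiedCover D (coverOf (treeOf r p)) ⊆ Set.univ \ spare Set.univ r p := by
  rintro u ((hu | ⟨_, q, hq, hq1⟩) | hu) <;> refine ⟨trivial, fun hs => ?_⟩
  · obtain ⟨v, hv, hvp⟩ := hu
    exact hs.2.2.1 v trivial hv hvp
  · obtain ⟨z, _, hzr, hzu, hz⟩ := hs.2.2.2
    obtain ⟨a, ha⟩ := Set.ncard_eq_one.1 hq1
    have h1 : u = a := by
      rw [← Set.mem_singleton_iff, ← ha]
      exact hq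
    have h2 : z = a := by
      rw [← Set.mem_singleton_iff, ← ha]
      exact ⟨hzr, hz.trans hq.2⟩
    exact hzu (h2.trans h1.symm)
  · exact hu _ (h.adj u trivial hs.2.1)

section Finite

variable [Finite V]

theorem ncard_leaves_add_ncard_internals (T : Digraph V) :
    (leaves T).ncard + (internals T).ncard = Nat.card V := by
  have : leaves T = (internals T)ᶜ := by
    ext v
    simp [leaves, internals]
  rw [this, Set.ncard_compl_add_ncard]

/-- The underlying graph is connected because every vertex is joined to the root, and it has one
edge for each vertex other than the root, so that it is a tree. -/
theorem Arb.isOutBranching (h : Arb D.Adj Set.univ r p) : IsOutBranching D (treeOf r p) := by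
  classical
  obtain ⟨d, hd⟩ := h.rank
  have hd' : ∀ u v, (treeOf r p).Adj u v → d u < d v := by
    rintro u v ⟨hv, rfl⟩
    exact hd v trivial hv
  have hadj : ∀ v, v ≠ r → (underlying (treeOf r p)).Adj (p v) v := fun v hv =>
    underlying_adj.2 ⟨fun e => (hd v trivial hv).ne (by rw [e]), Or.inl ⟨hv, rfl⟩⟩
  refine ⟨?_, fun u v huv hvu => (hd' _ _ huv).asymm (hd' _ _ hvu), ?_,
    ⟨r, fun u hu => hu.1 rfl, fun v hv => ?_⟩⟩
  · rintro u v ⟨hv, rfl⟩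
    exact h.adj v trivial hv
  · rw [SimpleGraph.isTree_iff_connected_and_card]
    have hreach : ∀ i v, d v ≤ i → (underlying (treeOf r p)).Reachable v r := by
      intro i
      induction i with
      | zero =>
        intro v hv
        by_cases hvr : v = r
        · rw [hvr]
        · have := hd v trivial hvr
          omega
      | succ i ih =>
        intro v hv
        by_cases hvr : v = r
        · rw [hvr]
        · have := hd v trivial hvr
          exact (hadj v hvr).symm.reachable.trans (ih _ (by omega))
    have : Nonempty V := ⟨r⟩
    refine ⟨⟨fun u v => (hreach _ u le_rfl).trans (hreach _ v le_rfl).symm⟩, ?_⟩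
    let f : {v : V // v ≠ r} → (underlying (treeOf r p)).edgeSet := fun v =>
      ⟨s(p v, v), hadj v v.2⟩
    have hf : Function.Bijective f := by
      constructor
      · rintro ⟨u, hu⟩ ⟨v, hv⟩ huv
        rcases Sym2.eq_iff.1 (congrArg Subtype.val huv) with ⟨_, rfl⟩ | ⟨h1, h2⟩
        · rfl
        · have h3 := hd u trivial hu
          have h4 := hd v trivial hv
          rw [h1] at h3
          rw [← h2] at h4
          exact absurd h3 h4.asymm
      · rintro ⟨e, he⟩
        induction e using Sym2.ind with
        | _ u v =>
          have he' : (underlying (treeOf r p)).Adj u v := he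
          rcases (underlying_adj.1 he').2 with ⟨h1, h2⟩ | ⟨h1, h2⟩
          · exact ⟨⟨v, h1⟩, Subtype.ext (by simp [f, h2])⟩
          · exact ⟨⟨u, h1⟩, Subtype.ext (by simp [f, h2, Sym2.eq_swap])⟩
    rw [← Nat.card_eq_of_bijective f hf]
    have := Set.ncard_add_ncard_compl ({r} : Set V)
    rw [Set.ncard_singleton] at this
    rw [← this, add_comm]
    rfl
  · by_contra hvr
    exact hv (p v) ⟨hvr, rfl⟩

/-- Counting edges shows that every vertex other than the root has exactly one in-neighbour; hence
the distance from the root increases along arcs. -/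
theorem IsOutBranching.exists_arb (h : IsOutBranching D T) :
    ∃ r p, Arb D.Adj Set.univ r p ∧ T = treeOf r p := by
  classical
  obtain ⟨r, hr, hr'⟩ := h.existsUnique_root
  have hex : ∀ v, ∃ u, v ≠ r → T.Adj u v := by
    intro v
    by_cases hvr : v = r
    · exact ⟨v, fun e => absurd hvr e⟩
    · have := mt (hr' v) hvr
      simp only [InDegreeZero, not_forall, not_not] at this
      obtain ⟨u, hu⟩ := this
      exact ⟨u, fun _ => hu⟩
  choose p hp using hex
  have hirr : ∀ v, ¬ T.Adj v v := fun v hv => h.oriented v v hv hv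
  have hund : ∀ u v, T.Adj u v → (underlying T).Adj u v := fun u v huv =>
    underlying_adj.2 ⟨fun e => hirr v (e ▸ huv), Or.inl huv⟩
  have huniq : ∀ u v, T.Adj u v → p v = u := by
    let f : {v : V // v ≠ r} → (underlying T).edgeSet := fun v => ⟨s(p v, v), hund _ _ (hp v v.2)⟩
    have hf : Function.Injective f := by
      rintro ⟨u, hu⟩ ⟨v, hv⟩ huv
      rcases Sym2.eq_iff.1 (congrArg Subtype.val huv) with ⟨_, rfl⟩ | ⟨h1, h2⟩
      · rfl
      · have h3 := hp u hu
        have h4 := hp v hv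
        rw [h1] at h3
        rw [← h2] at h4
        exact absurd h3 (h.oriented _ _ h4)
    have hcard : Nat.card (underlying T).edgeSet ≤ Nat.card {v : V // v ≠ r} := by
      have h1 := (SimpleGraph.isTree_iff_connected_and_card.1 h.isTree).2
      have h2 := Set.ncard_add_ncard_compl ({r} : Set V)
      rw [Set.ncard_singleton] at h2
      have h3 : Nat.card {v : V // v ≠ r} = ({r}ᶜ : Set V).ncard := rfl
      omega
    have hsurj : Function.Surjective f := (hf.bijective_of_nat_card_le hcard).2
    intro u v huv
    obtain ⟨⟨w, hw⟩, hw'⟩ := hsurj ⟨s(u, v), hund _ _ huv⟩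
    rcases Sym2.eq_iff.1 (congrArg Subtype.val hw') with ⟨h1, h2⟩ | ⟨h1, h2⟩
    · rw [← h2, h1]
    · have := hp w hw
      rw [h1, show w = u from h2] at this
      exact absurd this (h.oriented _ _ huv)
  have hadj : ∀ u v, T.Adj u v ↔ v ≠ r ∧ p v = u := by
    intro u v
    constructor
    · exact fun huv => ⟨fun e => hr u (e ▸ huv), huniq u v huv⟩
    · rintro ⟨hv, rfl⟩
      exact hp v hv
  have hT : T = treeOf r p := by
    ext u v
    exact hadj u v
  refine ⟨r, p, ⟨trivial, fun _ _ _ => trivial, fun v _ hv => h.le (hp v hv), ?_⟩, hT⟩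
  -- a neighbour of `v` that is closer to the root is the parent of `v`
  have hdist : ∀ i v, v ≠ r → (underlying T).dist r v = i → (underlying T).dist r (p v) < i := by
    intro i
    induction i using Nat.strong_induction_on with
    | _ i ih =>
      intro v hv hi
      obtain ⟨w, hw⟩ := h.isTree.connected.exists_walk_length_eq_dist v r
      cases w with
      | nil => exact absurd rfl hv
      | @cons _ u _ huv w =>
        have hlt : (underlying T).dist r u < i := by
          have h1 := SimpleGraph.dist_le w
          rw [SimpleGraph.Walk.length_cons, SimpleGraph.dist_comm, hi] at hw
          rw [SimpleGraph.dist_comm]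
          omega
        rcases (underlying_adj.1 huv).2 with hvu | hvu
        · -- otherwise `v` would be the parent of `u`
          have hur : u ≠ r := fun e => hr v (e ▸ hvu)
          have := ih _ hlt u hur rfl
          rw [huniq v u hvu, hi] at this
          omega
        · rwa [huniq u v hvu]
  exact ⟨fun v => (underlying T).dist r v, fun v _ hv => hdist _ v hv rfl⟩

theorem exists_isOutBranching_iff {k : ℕ} :
    (∃ T, IsOutBranching D T ∧ k ≤ (internals T).ncard) ↔ HasArb D.Adj Set.univ k := by
  constructor
  · rintro ⟨T, hT, hk⟩
    obtain ⟨r, p, h, rfl⟩ := hT.exists_arb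
    exact ⟨r, p, h, by rwa [internals_treeOf] at hk⟩
  · rintro ⟨r, p, h, hk⟩
    exact ⟨_, h.isOutBranching, by rwa [internals_treeOf]⟩

/-- A vertex of largest rank is a leaf. -/
theorem IsOutBranching.leaves_nonempty (h : IsOutBranching D T) : (leaves T).Nonempty := by
  obtain ⟨r, p, ha, rfl⟩ := h.exists_arb
  obtain ⟨d, hd⟩ := ha.rank
  have : Nonempty V := ⟨r⟩
  obtain ⟨v, hv⟩ := Finite.exists_max d
  exact ⟨v, fun w hw => absurd (hw.2 ▸ hd w trivial hw.1) (hv w).not_gt⟩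

/-- As every out-branching has a leaf, the value `0` of `lmin` occurs only if there is none. -/
theorem lmin_pos_iff : 0 < lmin D ↔ ∃ T, IsOutBranching D T := by
  constructor
  · intro h
    by_contra hcon
    push Not at hcon
    have : {l | ∃ T, IsOutBranching D T ∧ (leaves T).ncard = l} = ∅ := by
      ext l
      simpa using fun T hT => absurd hT (hcon T)
    rw [lmin, this, Nat.sInf_empty] at h
    exact h.false
  · rintro ⟨T, hT⟩
    obtain ⟨T', hT', h⟩ := Nat.sInf_mem (s := {l | ∃ T, IsOutBranching D T ∧ (leaves T).ncard = l})
      ⟨_, T, hT, rfl⟩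
    rw [lmin, ← h]
    exact (Set.ncard_pos).2 hT'.leaves_nonempty

theorem lmin_pos_iff_hasArb : 0 < lmin D ↔ HasArb D.Adj Set.univ 0 := by
  rw [lmin_pos_iff, ← exists_isOutBranching_iff]
  simp

/-- The hypothesis excludes the value `0` that `lmin` takes when there is no out-branching. -/
theorem yes_iff_hasArb (h : 0 < lmin D) (k : ℕ) : Yes D k ↔ HasArb D.Adj Set.univ k := by
  rw [← exists_isOutBranching_iff, Yes]
  constructor
  · intro hk
    obtain ⟨T, hT⟩ := lmin_pos_iff.1 h
    obtain ⟨T', hT', h'⟩ := Nat.sInf_mem (s := {l | ∃ T, IsOutBranching D T ∧ (leaves T).ncard = l})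
      ⟨_, T, hT, rfl⟩
    refine ⟨T', hT', ?_⟩
    have := ncard_leaves_add_ncard_internals T'
    rw [lmin, ← h'] at hk
    omega
  · rintro ⟨T, hT, hk⟩
    have h1 := ncard_leaves_add_ncard_internals T
    have h2 : lmin D ≤ (leaves T).ncard := Nat.sInf_le ⟨T, hT, rfl⟩
    omega

/-! ### Crowns from counting -/

/-- Among the sets `C ⊆ W` with fewer neighbours than elements take a minimal one. Removing any
element of it leaves a set that satisfies Hall's condition and has as many elements as `C` has
neighbours. -/
theorem exists_crown (B : SimpleGraph V) (W : Set V) (hW : B.IsIndepSet W)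
    (hlt : {v | ∃ c ∈ W, B.Adj c v}.ncard < W.ncard) :
    ∃ H Cm Cu, IsCrown B H Cm Cu ∧ Cm ∪ Cu ⊆ W ∧ Cu.Nonempty := by
  classical
  let N : Set V → Set V := fun C => {v | ∃ c ∈ C, B.Adj c v}
  have hNmono : ∀ {C C'}, C ⊆ C' → N C ⊆ N C' := fun h v ⟨c, hc, hv⟩ => ⟨c, h hc, hv⟩
  obtain ⟨C, ⟨⟨hCW, hC⟩, hmin⟩⟩ :=
    (Set.toFinite {C : Set V | C ⊆ W ∧ (N C).ncard < C.ncard}).exists_minimal ⟨W, subset_rfl, hlt⟩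
  have hmin' : ∀ S ⊆ C, S ≠ C → S.ncard ≤ (N S).ncard := by
    intro S hS hne
    by_contra hcon
    exact hne (hS.antisymm (hmin ⟨hS.trans hCW, not_le.1 hcon⟩ hS))
  obtain ⟨c, hc⟩ : C.Nonempty := by
    rw [← Set.ncard_pos]
    omega
  have hCc : (C \ {c}).ncard + 1 = C.ncard := Set.ncard_sdiff_singleton_add_one hc
  have hhall : ∀ s : Finset ↥(C \ {c}),
      s.card ≤ (s.biUnion fun v => (N {(v : V)}).toFinite.toFinset).card := by
    intro s
    have h1 : (Subtype.val '' (s : Set ↥(C \ {c}))).ncard = s.card := by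
      rw [Set.ncard_image_of_injective _ Subtype.val_injective, Set.ncard_coe_finset]
    have h2 : (N (Subtype.val '' (s : Set ↥(C \ {c})))).ncard =
        (s.biUnion fun v => (N {(v : V)}).toFinite.toFinset).card := by
      rw [← Set.ncard_coe_finset]
      congr 1
      ext v
      simp [N]
    rw [← h1, ← h2]
    refine hmin' _ ?_ ?_
    · rintro _ ⟨v, _, rfl⟩
      exact v.2.1
    · intro e
      rw [← e] at hc
      obtain ⟨v, _, hv⟩ := hc
      exact v.2.2 hv
  obtain ⟨f, hf, hfN⟩ := (Finset.all_card_le_biUnion_card_iff_exists_injective _).1 hhall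
  have hfN' : ∀ v : ↥(C \ {c}), B.Adj v (f v) := fun v => by simpa [N] using hfN v
  let g : ↥(C \ {c}) → ↥(N C) := fun v => ⟨f v, v, v.2.1, hfN' v⟩
  have hg : Function.Injective g := fun u v h => hf (congrArg Subtype.val h)
  have hg' : Function.Bijective g := by
    refine hg.bijective_of_nat_card_le ?_
    change (N C).ncard ≤ (C \ {c}).ncard
    omega
  have hun : C \ {c} ∪ {c} = C := by simp [hc]
  refine ⟨N C, C \ {c}, {c}, ⟨?_, ?_, ?_, ?_, ?_⟩, by rwa [hun], Set.singleton_nonempty c⟩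
  · rw [hun, Set.disjoint_left]
    rintro v ⟨u, hu, huv⟩ hv
    exact hW (hCW hu) (hCW hv) huv.ne huv
  · exact Set.disjoint_sdiff_left
  · rw [hun]
  · rw [hun]
    exact fun u hu v hv => hW (hCW hu) (hCW hv)
  · exact ⟨Equiv.ofBijective g hg', hfN'⟩

/-- If no crown is found, the vertices outside the modified cover are at most as many as their
neighbours in the auxiliary graph, which are vertices and pairs of vertices of the cover. -/
theorem card_le_of_not_ruleApplies {U : Set V} (h : ¬ RuleApplies D U) :
    Nat.card V ≤ 2 * (modifiedCover D U).ncard + (modifiedCover D U).ncard ^ 2 := by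
  set X := modifiedCover D U with hX
  by_contra hcon
  refine h ?_
  have hadj : ∀ w ∉ X, ∀ b, (auxGraph D X).Adj (Sum.inl w) b →
      b ∈ Sum.inl '' X ∪ Sum.inr '' (X ×ˢ X) := by
    rintro w hw b ⟨_, h | h⟩
    · rcases h with ⟨x, hx, y, hy, w', hw', h1, h2, h3, h4⟩ | ⟨x, hx, w', hw', h1, h3, h4⟩
      · cases h3
      · exact absurd (Sum.inl_injective h3 ▸ hx) hw
    · rcases h with ⟨x, hx, y, hy, w', hw', h1, h2, h3, h4⟩ | ⟨x, hx, w', hw', h1, h3, h4⟩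
      · exact Or.inr ⟨(x, y), ⟨hx, hy⟩, h3.symm⟩
      · exact Or.inl ⟨x, hx, h3.symm⟩
  refine exists_crown (auxGraph D X) (Sum.inl '' Xᶜ) ?_ ?_
  · rintro _ ⟨u, hu, rfl⟩ _ ⟨v, hv, rfl⟩ _ huv
    rcases hadj u hu _ huv with ⟨x, hx, e⟩ | ⟨x, hx, e⟩
    · exact hv (Sum.inl_injective e ▸ hx)
    · cases e
  · rw [Set.ncard_image_of_injective _ Sum.inl_injective]
    have h1 := Set.ncard_add_ncard_compl X
    have h2 : {v | ∃ c ∈ Sum.inl '' Xᶜ, (auxGraph D X).Adj c v}.ncard ≤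
        (Sum.inl '' X ∪ Sum.inr '' (X ×ˢ X) : Set (V ⊕ V × V)).ncard := by
      refine Set.ncard_le_ncard ?_
      rintro b ⟨_, ⟨w, hw, rfl⟩, hb⟩
      exact hadj w hw b hb
    have h3 := Set.ncard_union_le (Sum.inl '' X : Set (V ⊕ V × V)) (Sum.inr '' (X ×ˢ X))
    rw [Set.ncard_image_of_injective _ Sum.inl_injective,
      Set.ncard_image_of_injective _ Sum.inr_injective, Set.ncard_prod, ← sq] at h3
    omega

/-! ### Large irreducible digraphs -/

/-- With fewer than `k` internal vertices, the cover would have at most `2 k - 1` elements. -/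
theorem le_ncard_internals_of_not_ruleApplies {k : ℕ} (hT : IsOutBranching D T)
    (hcard : 8 * k ^ 2 + 6 * k < Nat.card V) (hrule : ¬ RuleApplies D (coverOf T)) :
    k ≤ (internals T).ncard := by
  obtain ⟨r, p, h, rfl⟩ := hT.exists_arb
  rw [internals_treeOf]
  by_contra hlt
  have h1 := card_le_of_not_ruleApplies hrule
  have h2 : (modifiedCover D (coverOf (treeOf r p))).ncard ≤ 2 * k - 1 :=
    (Set.ncard_le_ncard (coverOf_treeOf_subset h)).trans
      ((ncard_diff_spare_le Set.finite_univ).trans (by omega))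
  obtain ⟨j, rfl⟩ : ∃ j, k = j + 1 := ⟨k - 1, by omega⟩
  have h3 := Nat.pow_le_pow_left h2 2
  have h4 : 2 * (j + 1) - 1 = 2 * j + 1 := by omega
  rw [h4] at h2 h3
  nlinarith

/-- An arc between two vertices outside the cover joins two spare leaves, and its 1-change leads to
an out-branching with an additional internal vertex. -/
theorem isVertexCover_coverOf (hD : Loopless D) (hT : IsMinimalOutBranching D T) :
    (underlying D).IsVertexCover (coverOf T) := by
  classical
  obtain ⟨hT, hmin⟩ := hT
  obtain ⟨r, p, h, rfl⟩ := hT.exists_arb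
  have key : ∀ u v, u ∉ coverOf (treeOf r p) → v ∉ coverOf (treeOf r p) → ¬ D.Adj u v := by
    intro u v hu hv huv
    have hne : u ≠ v := fun e => hD v (e ▸ huv)
    have hui : u ∉ inner Set.univ r p := fun h => hu (Or.inl (by rwa [internals_treeOf]))
    -- a leaf that is not spare is the root or an only child
    have hspare : ∀ x, x ≠ r → x ∉ coverOf (treeOf r p) → x ∈ spare Set.univ r p := by
      intro x hxr hx
      have hxi : x ∉ inner Set.univ r p := fun h => hx (Or.inl (by rwa [internals_treeOf]))
      refine ⟨trivial, hxr, fun z hz hzr e => hxi (mem_inner.2 ⟨z, hz, hzr, e⟩), ?_⟩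
      by_contra hcon
      refine hx (Or.inr ⟨fun z hz => hxi (mem_inner.2 ⟨z, trivial, hz⟩), p x, ⟨hxr, rfl⟩, ?_⟩)
      rw [outDegree, Set.ncard_eq_one]
      refine ⟨x, Set.eq_singleton_iff_unique_mem.2 ⟨⟨hxr, rfl⟩, fun z hz => ?_⟩⟩
      by_contra hzx
      exact hcon ⟨z, trivial, hz.1, hzx, hz.2⟩
    -- the root is internal unless it is the only vertex
    have hri : ∀ x, x ≠ r → r ∈ inner Set.univ r p := by
      obtain ⟨d, hd⟩ := h.rank
      have : ∀ i x, d x ≤ i → x ≠ r → r ∈ inner Set.univ r p := by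
        intro i
        induction i with
        | zero =>
          intro x hx hxr
          have := hd x trivial hxr
          omega
        | succ i ih =>
          intro x hx hxr
          by_cases hp : p x = r
          · exact mem_inner.2 ⟨x, trivial, hxr, hp⟩
          · have := hd x trivial hxr
            exact ih (p x) (by omega) hp
      exact fun x hx => this _ x le_rfl hx
    have hrx : ∀ x, x ≠ r → r ∈ coverOf (treeOf r p) := fun x hx =>
      Or.inl (by rw [internals_treeOf]; exact hri x hx)
    have hur : u ≠ r := fun e => hu (e ▸ hrx v fun e' => hne (e.trans e'.symm))
    have hvr : v ≠ r := fun e => hv (e ▸ hrx u hur)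
    have hus := hspare u hur hu
    have hvs := hspare v hvr hv
    have heq : oneChange (treeOf r p) u v = treeOf r (Function.update p v u) := by
      ext x y
      simp only [oneChange, treeOf]
      by_cases hyv : y = v
      · subst hyv
        simp [hvr, eq_comm]
      · simp [hyv]
    have h1 := hmin u v huv (fun hT => hui (mem_inner.2 ⟨v, trivial, hT.1, hT.2⟩))
      (by rw [heq]; exact (h.update trivial hvs huv hne).isOutBranching)
    rw [heq, internals_treeOf, internals_treeOf] at h1
    have h2 := Set.ncard_le_ncard (insert_inner_subset_update (u := u) hvs)
    rw [Set.ncard_insert_of_notMem hui] at h2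
    omega
  rintro u v huv
  by_contra hcon
  simp only [not_or] at hcon
  rcases (underlying_adj.1 huv).2 with h' | h'
  · exact key u v hcon.1 hcon.2 h'
  · exact key v u hcon.2 hcon.1 h'

/-- An out-branching with the most internal vertices is minimal. -/
theorem exists_isMinimalOutBranching (h : 0 < lmin D) : ∃ T, IsMinimalOutBranching D T := by
  have : Nonempty {T : Digraph V // IsOutBranching D T} := by
    obtain ⟨T, hT⟩ := lmin_pos_iff.1 h
    exact ⟨T, hT⟩
  have hfin : Finite (Digraph V) :=
    Finite.of_injective (fun T : Digraph V => T.Adj) fun S T hST => by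
      ext u v
      exact iff_of_eq (congrFun (congrFun hST u) v)
  obtain ⟨T, hT⟩ := Finite.exists_max fun T : {T : Digraph V // IsOutBranching D T} =>
    (internals T.1).ncard
  exact ⟨T, T.2, fun u v _ _ h => hT ⟨_, h⟩⟩

end Finite

end Bridge

/-! ### Bounded programs -/

/-- Programs whose only loops are bounded: `rep b i c` runs `c` for the values `0, …, n + b - 1` of
register `i`, where `n` is the content of register `3`. -/
inductive Prog where
  | skip
  | setReg (i : ℕ) (e : Expr)
  | setCell (a : ℕ) (e f : Expr)
  | seq (c d : Prog)
  | ifte (e : Expr) (c d : Prog)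
  | rep (b i : ℕ) (c : Prog)

namespace Prog

/-- The program of the random access machine. The counter of a loop is increased after the body, and
the loop stops when the truncated difference `n + b - i` vanishes. -/
def compile : Prog → Cmd
  | skip => .skip
  | setReg i e => .setReg i e
  | setCell a e f => .setCell a e f
  | seq c d => .seq c.compile d.compile
  | ifte e c d => .ifte e c.compile d.compile
  | rep b i c => .seq (.setReg i (.lit 0)) (.loop (.sub (.add (.reg 3) (.lit b)) (.reg i))
      (.seq c.compile (.setReg i (.add (.reg i) (.lit 1)))))

/-- The effect of a program on the memory, when register `3` holds `n`. In a loop the counter is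
set to `j + 1` after round `j`; this agrees with the compiled program if the body does not write to
it. -/
def run (n : ℕ) : Prog → Store → Store
  | skip, s => s
  | setReg i e, s => s.setReg i (e.eval s)
  | setCell a e f, s => s.setCell a (e.eval s) (f.eval s)
  | seq c d, s => d.run n (c.run n s)
  | ifte e c d, s => if e.eval s = 0 then d.run n s else c.run n s
  | rep b i c, s => Nat.rec (s.setReg i 0) (fun j t => (c.run n t).setReg i (j + 1)) (n + b)

/-- The program writes to register `i`. -/
def WritesReg : Prog → ℕ → Bool
  | skip, _ => false
  | setReg j _, i => i == j
  | setCell _ _ _, _ => false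
  | seq c d, i => c.WritesReg i || d.WritesReg i
  | ifte _ c d, i => c.WritesReg i || d.WritesReg i
  | rep _ j c, i => i == j || c.WritesReg i

/-- The program writes to array `a`. -/
def WritesArr : Prog → ℕ → Bool
  | skip, _ => false
  | setReg _ _, _ => false
  | setCell b _ _, a => a == b
  | seq c d, a => c.WritesArr a || d.WritesArr a
  | ifte _ c d, a => c.WritesArr a || d.WritesArr a
  | rep _ _ c, a => c.WritesArr a

/-- Loop bodies do not write to their counters, and register `3` is never written. -/
def WellFormed : Prog → Bool
  | skip => true
  | setReg i _ => i != 3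
  | setCell _ _ _ => true
  | seq c d => c.WellFormed && d.WellFormed
  | ifte _ c d => c.WellFormed && d.WellFormed
  | rep _ i c => i != 3 && !c.WritesReg i && c.WellFormed

/-- The nesting depth of the loops. -/
def depth : Prog → ℕ
  | skip => 0
  | setReg _ _ => 0
  | setCell _ _ _ => 0
  | seq c d => max c.depth d.depth
  | ifte _ c d => max c.depth d.depth
  | rep _ _ c => c.depth + 1

end Prog

section Store

variable (s : Store) (i j a b x m : ℕ)

@[simp] theorem Store.setReg_reg : (s.setReg i m).reg j = if j = i then m else s.reg j := by
  simp [Store.setReg, Function.update_apply]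

@[simp] theorem Store.setReg_arr : (s.setReg i m).arr = s.arr := rfl

@[simp] theorem Store.setCell_reg : (s.setCell a x m).reg = s.reg := rfl

@[simp] theorem Store.setCell_arr :
    (s.setCell a x m).arr b = if b = a then Function.update (s.arr a) x m else s.arr b := by
  simp [Store.setCell, Function.update_apply]

end Store

namespace Prog

theorem run_reg {n i : ℕ} : ∀ {c : Prog} {s : Store}, c.WritesReg i = false →
    (c.run n s).reg i = s.reg i
  | skip, _, _ => rfl
  | setReg j e, s, h => by
    simp only [WritesReg, beq_eq_false_iff_ne] at h
    simp [run, h]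
  | setCell _ _ _, _, _ => rfl
  | seq c d, s, h => by
    simp only [WritesReg, Bool.or_eq_false_iff] at h
    rw [run, run_reg h.2, run_reg h.1]
  | ifte e c d, s, h => by
    simp only [WritesReg, Bool.or_eq_false_iff] at h
    rw [run]
    split_ifs
    · rw [run_reg h.2]
    · rw [run_reg h.1]
  | rep b j c, s, h => by
    simp only [WritesReg, Bool.or_eq_false_iff, beq_eq_false_iff_ne] at h
    rw [run]
    induction n + b with
    | zero => simp [h.1]
    | succ l ih => simp only [Store.setReg_reg, h.1, if_false, run_reg h.2, ih]

theorem run_arr {n a : ℕ} : ∀ {c : Prog} {s : Store}, c.WritesArr a = false →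
    (c.run n s).arr a = s.arr a
  | skip, _, _ => rfl
  | setReg j e, s, h => rfl
  | setCell b _ _, _, h => by
    simp only [WritesArr, beq_eq_false_iff_ne] at h
    simp [run, h]
  | seq c d, s, h => by
    simp only [WritesArr, Bool.or_eq_false_iff] at h
    rw [run, run_arr h.2, run_arr h.1]
  | ifte e c d, s, h => by
    simp only [WritesArr, Bool.or_eq_false_iff] at h
    rw [run]
    split_ifs
    · rw [run_arr h.2]
    · rw [run_arr h.1]
  | rep b j c, s, h => by
    simp only [WritesArr] at h
    rw [run]
    induction n + b with
    | zero => simp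
    | succ l ih => simp only [Store.setReg_arr, run_arr h, ih]

theorem writesReg_three : ∀ {c : Prog}, c.WellFormed = true → c.WritesReg 3 = false
  | skip, _ => rfl
  | setReg j e, h => by
    simp only [WellFormed, bne_iff_ne] at h
    simpa [WritesReg] using h.symm
  | setCell _ _ _, _ => rfl
  | seq c d, h => by
    simp only [WellFormed, Bool.and_eq_true] at h
    simp [WritesReg, writesReg_three h.1, writesReg_three h.2]
  | ifte e c d, h => by
    simp only [WellFormed, Bool.and_eq_true] at h
    simp [WritesReg, writesReg_three h.1, writesReg_three h.2]
  | rep b j c, h => by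
    simp only [WellFormed, Bool.and_eq_true, bne_iff_ne] at h
    simpa [WritesReg, writesReg_three h.2] using h.1.1.symm

/-- A bounded program is executed by the machine in a number of steps that is polynomial of degree
at most the nesting depth of its loops. -/
theorem exists_exec : ∀ c : Prog, c.WellFormed = true → ∃ K, ∀ n s, s.reg 3 = n →
    ∃ t, Exec c.compile s t (c.run n s) ∧ t ≤ K * (n + 1) ^ c.depth
  | skip, _ => ⟨1, fun n s _ => ⟨1, .skip s, by simp [depth]⟩⟩
  | setReg i e, _ => ⟨e.cost + 1, fun n s _ => ⟨_, .setReg s i e, by simp [depth]⟩⟩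
  | setCell a e f, _ => ⟨e.cost + f.cost + 1, fun n s _ => ⟨_, .setCell s a e f, by simp [depth]⟩⟩
  | seq c d, h => by
    simp only [WellFormed, Bool.and_eq_true] at h
    obtain ⟨K, hK⟩ := exists_exec c h.1
    obtain ⟨L, hL⟩ := exists_exec d h.2
    refine ⟨K + L, fun n s hs => ?_⟩
    obtain ⟨t, ht, htK⟩ := hK n s hs
    obtain ⟨u, hu, huL⟩ := hL n (c.run n s) (by rw [run_reg (writesReg_three h.1), hs])
    refine ⟨t + u, .seq ht hu, ?_⟩
    calc t + u ≤ K * (n + 1) ^ c.depth + L * (n + 1) ^ d.depth := add_le_add htK huL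
      _ ≤ K * (n + 1) ^ max c.depth d.depth + L * (n + 1) ^ max c.depth d.depth := by
        gcongr <;> omega
      _ = _ := by rw [depth]; ring
  | ifte e c d, h => by
    simp only [WellFormed, Bool.and_eq_true] at h
    obtain ⟨K, hK⟩ := exists_exec c h.1
    obtain ⟨L, hL⟩ := exists_exec d h.2
    refine ⟨K + L + e.cost + 1, fun n s hs => ?_⟩
    have hpos : 1 ≤ (n + 1) ^ max c.depth d.depth := Nat.one_le_pow _ _ (by omega)
    have hc : (n + 1) ^ c.depth ≤ (n + 1) ^ max c.depth d.depth :=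
      Nat.pow_le_pow_right (by omega) (by simp)
    have hd : (n + 1) ^ d.depth ≤ (n + 1) ^ max c.depth d.depth :=
      Nat.pow_le_pow_right (by omega) (by simp)
    simp only [depth]
    by_cases he : e.eval s = 0
    · obtain ⟨u, hu, huL⟩ := hL n s hs
      refine ⟨e.cost + 1 + u, ?_, ?_⟩
      · rw [run, if_pos he]
        exact .ifFalse he hu
      · nlinarith [Nat.mul_le_mul_left L hd, Nat.zero_le (K * (n + 1) ^ max c.depth d.depth),
          Nat.mul_le_mul_left (e.cost + 1) hpos]
    · obtain ⟨u, hu, huK⟩ := hK n s hs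
      refine ⟨e.cost + 1 + u, ?_, ?_⟩
      · rw [run, if_neg he]
        exact .ifTrue he hu
      · nlinarith [Nat.mul_le_mul_left K hc, Nat.zero_le (L * (n + 1) ^ max c.depth d.depth),
          Nat.mul_le_mul_left (e.cost + 1) hpos]
  | rep b i c, h => by
    simp only [WellFormed, Bool.and_eq_true, bne_iff_ne, Bool.not_eq_true'] at h
    obtain ⟨⟨hi, hci⟩, hc⟩ := h
    obtain ⟨K, hK⟩ := exists_exec c hc
    refine ⟨(b + 1) * (K + 12) + 12, fun n s hs => ?_⟩
    set S : ℕ → Store := fun l =>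
      Nat.rec (s.setReg i 0) (fun j t => (c.run n t).setReg i (j + 1)) l with hS
    have hS3 : ∀ l, (S l).reg 3 = n := by
      intro l
      induction l with
      | zero => simp [hS, hi.symm, hs]
      | succ l ih =>
        change ((c.run n (S l)).setReg i (l + 1)).reg 3 = n
        simp [hi.symm, run_reg (writesReg_three hc), ih]
    have hSi : ∀ l, (S l).reg i = l := by
      intro l
      cases l with
      | zero => simp [hS]
      | succ l => simp [hS]
    have hP : 1 ≤ (n + 1) ^ c.depth := Nat.one_le_pow _ _ (by omega)
    -- the last `l` rounds
    have key : ∀ l ≤ n + b, ∃ t, Exec (.loop (.sub (.add (.reg 3) (.lit b)) (.reg i))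
        (.seq c.compile (.setReg i (.add (.reg i) (.lit 1))))) (S (n + b - l)) t (S (n + b)) ∧
        t ≤ l * ((K + 12) * (n + 1) ^ c.depth) + 6 := by
      intro l
      induction l with
      | zero =>
        intro _
        refine ⟨_, .loopStop ?_, ?_⟩
        · simp [Expr.eval, hS3, hSi]
        · simp [Expr.cost]
      | succ l ih =>
        intro hl
        obtain ⟨t, ht, htl⟩ := ih (by omega)
        obtain ⟨u, hu, huK⟩ := hK n (S (n + b - (l + 1))) (hS3 _)
        have hnext : S (n + b - l) =
            (c.run n (S (n + b - (l + 1)))).setReg i (n + b - (l + 1) + 1) := by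
          rw [show n + b - l = n + b - (l + 1) + 1 by omega]
        have hstep := Exec.setReg (c.run n (S (n + b - (l + 1)))) i (.add (.reg i) (.lit 1))
        have heval : (Expr.add (.reg i) (.lit 1)).eval (c.run n (S (n + b - (l + 1)))) =
            n + b - (l + 1) + 1 := by
          simp [Expr.eval, run_reg hci, hSi]
        rw [heval, ← hnext] at hstep
        refine ⟨_, .loopStep ?_ (.seq hu hstep) ht, ?_⟩
        · simp only [Expr.eval, hS3, hSi]
          omega
        · simp only [Expr.cost]
          nlinarith
    obtain ⟨t, ht, htl⟩ := key (n + b) le_rfl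
    rw [Nat.sub_self] at ht
    refine ⟨_, .seq (.setReg s i (.lit 0)) ht, ?_⟩
    simp only [Expr.cost, depth]
    have h1 : n + b ≤ (b + 1) * (n + 1) := by nlinarith
    have h2 := Nat.mul_le_mul_right ((K + 12) * (n + 1) ^ c.depth) h1
    have h3 : 1 ≤ (n + 1) ^ (c.depth + 1) := Nat.one_le_pow _ _ (by omega)
    calc 1 + 1 + t ≤ (b + 1) * (n + 1) * ((K + 12) * (n + 1) ^ c.depth) + 12 * 1 := by omega
      _ ≤ (b + 1) * (n + 1) * ((K + 12) * (n + 1) ^ c.depth) + 12 * (n + 1) ^ (c.depth + 1) := by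
        gcongr
      _ = _ := by ring

/-- The invariant rule for bounded loops. Inside the loop everything that the body does not write
may be assumed to be unchanged. -/
theorem run_rep {n b i : ℕ} {c : Prog} {s : Store} (I : ℕ → Store → Prop)
    (h0 : I 0 (s.setReg i 0))
    (hstep : ∀ j < n + b, ∀ t, t.reg i = j →
      (∀ l, l ≠ i → c.WritesReg l = false → t.reg l = s.reg l) →
      (∀ a, c.WritesArr a = false → t.arr a = s.arr a) →
      I j t → I (j + 1) ((c.run n t).setReg i (j + 1))) :
    I (n + b) ((rep b i c).run n s) := by
  have key : ∀ j ≤ n + b, I j (Nat.rec (s.setReg i 0)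
      (fun j t => (c.run n t).setReg i (j + 1)) j : Store) ∧
      (Nat.rec (s.setReg i 0) (fun j t => (c.run n t).setReg i (j + 1)) j : Store).reg i = j ∧
      (∀ l, l ≠ i → c.WritesReg l = false → (Nat.rec (s.setReg i 0)
        (fun j t => (c.run n t).setReg i (j + 1)) j : Store).reg l = s.reg l) ∧
      (∀ a, c.WritesArr a = false → (Nat.rec (s.setReg i 0)
        (fun j t => (c.run n t).setReg i (j + 1)) j : Store).arr a = s.arr a) := by
    intro j
    induction j with
    | zero => exact fun _ => ⟨h0, by simp, fun l hl _ => by simp [hl], fun a _ => rfl⟩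
    | succ j ih =>
      intro hj
      obtain ⟨h1, h2, h3, h4⟩ := ih (by omega)
      refine ⟨hstep j (by omega) _ h2 h3 h4 h1, by simp, fun l hl hc => ?_, fun a ha => ?_⟩
      · simp only [Store.setReg_reg, hl, if_false]
        rw [run_reg hc, h3 l hl hc]
      · simp only [Store.setReg_arr]
        rw [run_arr ha, h4 a ha]
  exact (key _ le_rfl).1

/-- Run `c` if all the expressions are nonzero. -/
def whenAll (es : List Expr) (c : Prog) : Prog := es.foldr (fun e c => ifte e c skip) c

theorem run_whenAll {n : ℕ} {es : List Expr} {c : Prog} {s : Store} :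
    (whenAll es c).run n s = open Classical in
      if ∀ e ∈ es, e.eval s ≠ 0 then c.run n s else s := by
  classical
  induction es with
  | nil => simp [whenAll]
  | cons e es ih =>
    change (ifte e (whenAll es c) skip).run n s = _
    by_cases he : e.eval s = 0
    · simp [run, he]
    · simp [run, he, ih]

theorem whenAll_writesReg {es : List Expr} {c : Prog} {i : ℕ} :
    (whenAll es c).WritesReg i = c.WritesReg i := by
  induction es with
  | nil => rfl
  | cons e es ih =>
    change ((whenAll es c).WritesReg i || false) = _
    simp [ih]

theorem whenAll_writesArr {es : List Expr} {c : Prog} {a : ℕ} :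
    (whenAll es c).WritesArr a = c.WritesArr a := by
  induction es with
  | nil => rfl
  | cons e es ih =>
    change ((whenAll es c).WritesArr a || false) = _
    simp [ih]

end Prog

/-! ### Building blocks of the program -/

/-!
The memory is used as follows. Register `0` holds the number of vertices, `1` the parameter, `2`
the kind of the output, `3` the number `n` of vertices of the given digraph, `4` intermediate
results, `5` the root of the tree, and `9` the source of a search; `6`, `7`, `8` and `10` to `13`
are loop counters, where `12` and `13` serve also as flags; `14` to `20` belong to the search for
augmenting paths.

Array `0` holds the adjacency matrix, `1` the tree that is output, `2` a copy of the adjacency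
matrix, `3` the multiples of `n`, which replace the multiplications in the addresses of matrix
entries, `4` and `6` the marks and the predecessors of a search, `5` the parents in the tree, `7`
and `8` the indicator functions of its spare leaves and internal vertices, `9` to `11` the
matching, `12` the list of the remaining vertices, and `13` the multiples of their number.
-/

section Blocks

open Prog

/-- Nonzero if and only if the values are equal. -/
def eqE (e f : Expr) : Expr := .sub (.lit 1) (.add (.sub e f) (.sub f e))

/-- Nonzero if and only if the value is zero. -/
def notE (e : Expr) : Expr := .sub (.lit 1) e

/-- The entry of the adjacency matrix at `(e, f)`; array `3` holds the multiples of `n`. -/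
def arcE (e f : Expr) : Expr := .cell 0 (.add (.cell 3 e) f)

@[simp] theorem eval_eqE {e f : Expr} {s : Store} :
    (eqE e f).eval s = 0 ↔ e.eval s ≠ f.eval s := by
  simp only [eqE, Expr.eval]
  omega

@[simp] theorem eval_notE {e : Expr} {s : Store} : (notE e).eval s = 0 ↔ e.eval s ≠ 0 := by
  simp only [notE, Expr.eval]
  omega

section

variable (n a i m : ℕ) (e f : Expr) (s : Store)

@[simp] theorem run_setReg : (Prog.setReg i e).run n s = s.setReg i (e.eval s) := rfl

@[simp] theorem run_setCell : (Prog.setCell a e f).run n s = s.setCell a (e.eval s) (f.eval s) :=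
  rfl

@[simp] theorem eval_lit : (Expr.lit m).eval s = m := rfl

@[simp] theorem eval_reg : (Expr.reg i).eval s = s.reg i := rfl

@[simp] theorem eval_cell : (Expr.cell a e).eval s = s.arr a (e.eval s) := rfl

@[simp] theorem eval_add : (Expr.add e f).eval s = e.eval s + f.eval s := rfl

@[simp] theorem eval_sub : (Expr.sub e f).eval s = e.eval s - f.eval s := rfl

end

/-- Sequential composition. -/
def Prog.block (cs : List Prog) : Prog := cs.foldr .seq .skip

@[simp] theorem run_block_nil {n : ℕ} {s : Store} : (block []).run n s = s := rfl

@[simp] theorem run_block_cons {n : ℕ} {c : Prog} {cs : List Prog} {s : Store} :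
    (block (c :: cs)).run n s = (block cs).run n (c.run n s) := rfl

/-- Registers `0`, `3` and arrays `0`, `3` are set up for the relation `G` on the numbers below
`n`. -/
structure Ctx (n : ℕ) (G : ℕ → ℕ → Prop) (s : Store) : Prop where
  reg : s.reg 3 = n
  adj : ∀ u < n, ∀ v < n, s.arr 0 (u * n + v) ≠ 0 ↔ G u v
  row : ∀ u < n, s.arr 3 u = u * n

variable {n : ℕ} {G : ℕ → ℕ → Prop} {s t : Store}

theorem Ctx.congr (h : Ctx n G s) (h3 : t.reg 3 = s.reg 3) (ha0 : t.arr 0 = s.arr 0)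
    (ha3 : t.arr 3 = s.arr 3) : Ctx n G t :=
  ⟨h3.trans h.reg, by rw [ha0]; exact h.adj, by rw [ha3]; exact h.row⟩

theorem Ctx.eval_arcE (h : Ctx n G s) {e f : Expr} (he : e.eval s < n) (hf : f.eval s < n) :
    (arcE e f).eval s ≠ 0 ↔ G (e.eval s) (f.eval s) := by
  simp only [arcE, Expr.eval]
  rw [h.row _ he, h.adj _ he _ hf]

/-- Store the first `n` multiples of register `l` in array `a`. -/
def rows (a l : ℕ) : Prog :=
  block [.setReg 4 (.lit 0),
    .rep 0 6 (block [.setCell a (.reg 6) (.reg 4), .setReg 4 (.add (.reg 4) (.reg l))])]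

theorem run_rows {a l : ℕ} (h4 : l ≠ 4) (h6 : l ≠ 6) :
    ∀ i < n, ((rows a l).run n s).arr a i = i * s.reg l := by
  have := run_rep (n := n) (b := 0) (i := 6)
    (c := block [.setCell a (.reg 6) (.reg 4), .setReg 4 (.add (.reg 4) (.reg l))])
    (s := s.setReg 4 0)
    (fun j t => t.reg l = s.reg l ∧ t.reg 4 = j * s.reg l ∧ ∀ i < j, t.arr a i = i * s.reg l)
    (by simp [h4, h6]) ?_
  · exact this.2.2
  · rintro j - t ht - - ⟨h1, h2, h3⟩
    refine ⟨by simp [run, h4, h6, h1], by simp [run, h1, h2]; ring, ?_⟩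
    intro i hi
    simp only [run_block_cons, run_block_nil, run_setCell, run_setReg, eval_reg,
      Store.setReg_arr, Store.setCell_arr, if_true, Function.update_apply, ht, h2]
    split_ifs with hij
    · rw [hij]
    · exact h3 i (by omega)

/-- Clear the first `n` cells of array `a`. -/
def clear (a : ℕ) : Prog := .rep 0 7 (.setCell a (.reg 7) (.lit 0))

theorem run_clear {a : ℕ} : ∀ i < n, ((clear a).run n s).arr a i = 0 := by
  refine run_rep (n := n) (b := 0) (fun j t => ∀ i < j, t.arr a i = 0) (by simp) ?_
  rintro j - t ht - - h i hi
  simp only [run_setCell, eval_lit, eval_reg, Store.setReg_arr, Store.setCell_arr, if_true,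
    Function.update_apply, ht]
  split_ifs with hij
  · rfl
  · exact h i (by omega)

/-! ### Graph search -/

/-- If vertex `u` (register `6`) is marked in array `4`, vertex `v` (register `7`) is not, and the
tests succeed, then mark `v` and make `u` its predecessor in array `6`. -/
def searchStep (tests : List Expr) : Prog :=
  whenAll (.cell 4 (.reg 6) :: notE (.cell 4 (.reg 7)) :: tests)
    (block [.setCell 4 (.reg 7) (.lit 1), .setCell 6 (.reg 7) (.reg 6)])

/-- Mark in array `4` all the vertices that can be reached from the vertex in register `9` along
the pairs that pass the tests. -/
def search (tests : List Expr) : Prog :=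
  block [clear 4, .setCell 4 (.reg 9) (.lit 1), .rep 0 8 (.rep 0 6 (.rep 0 7 (searchStep tests)))]

/-- `t` differs from `s` only in the memory written by a search. -/
structure SearchFrame (s t : Store) : Prop where
  reg : ∀ i, i ≠ 6 → i ≠ 7 → i ≠ 8 → t.reg i = s.reg i
  arr : ∀ a, a ≠ 4 → a ≠ 6 → t.arr a = s.arr a

theorem SearchFrame.setReg (h : SearchFrame s t) {i m : ℕ} (hi : i = 6 ∨ i = 7 ∨ i = 8) :
    SearchFrame s (t.setReg i m) :=
  ⟨fun l h6 h7 h8 => by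
    have : l ≠ i := by rintro rfl; omega
    simp [this, h.reg l h6 h7 h8], h.arr⟩

/-- The marked vertices. -/
def Marked (n : ℕ) (t : Store) (v : ℕ) : Prop := v < n ∧ t.arr 4 v ≠ 0

/-- The predecessors of the marked vertices form a tree with root `r` that consists of pairs
in `E`. -/
def SearchTree (n : ℕ) (E : ℕ → ℕ → Prop) (r : ℕ) (t : Store) : Prop :=
  Marked n t r ∧ ∃ d : ℕ → ℕ, ∀ v, Marked n t v → v ≠ r →
    Marked n t (t.arr 6 v) ∧ E (t.arr 6 v) v ∧ d (t.arr 6 v) < d v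

/-- A set of numbers below `n` is closed under `E`. -/
def ClosedUnder (n : ℕ) (E : ℕ → ℕ → Prop) (M : ℕ → Prop) : Prop :=
  ∀ u, M u → ∀ v < n, E u v → M v

variable {E : ℕ → ℕ → Prop} {tests : List Expr} {r : ℕ}

theorem run_searchStep (htest : ∀ t, SearchFrame s t → t.reg 6 < n → t.reg 7 < n →
      ((∀ e ∈ tests, e.eval t ≠ 0) ↔ E (t.reg 6) (t.reg 7)))
    (hf : SearchFrame s t) (hu : t.reg 6 < n) (hv : t.reg 7 < n) :
    SearchFrame s ((searchStep tests).run n t) ∧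
    (∀ x, Marked n ((searchStep tests).run n t) x ↔
      Marked n t x ∨ (x = t.reg 7 ∧ Marked n t (t.reg 6) ∧ E (t.reg 6) x)) ∧
    (SearchTree n E r t → SearchTree n E r ((searchStep tests).run n t)) := by
  classical
  have hcond : (∀ e ∈ (.cell 4 (.reg 6) :: notE (.cell 4 (.reg 7)) :: tests : List Expr),
      e.eval t ≠ 0) ↔ Marked n t (t.reg 6) ∧ ¬ Marked n t (t.reg 7) ∧ E (t.reg 6) (t.reg 7) := by
    rw [List.forall_mem_cons, List.forall_mem_cons, htest t hf hu hv]
    simp [Marked, hu, hv]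
  rw [searchStep, run_whenAll]
  by_cases h : Marked n t (t.reg 6) ∧ ¬ Marked n t (t.reg 7) ∧ E (t.reg 6) (t.reg 7)
  swap
  · rw [if_neg (mt hcond.1 h)]
    refine ⟨hf, fun x => ⟨Or.inl, ?_⟩, id⟩
    rintro (hx | ⟨rfl, h1, h2⟩)
    · exact hx
    · by_contra h3
      exact h ⟨h1, h3, h2⟩
  rw [if_pos (hcond.2 h)]
  obtain ⟨h1, h2, h3⟩ := h
  set t' := (block [.setCell 4 (.reg 7) (.lit 1), .setCell 6 (.reg 7) (.reg 6)]).run n t with ht'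
  have ha4 : ∀ x, t'.arr 4 x = if x = t.reg 7 then 1 else t.arr 4 x := fun x => by
    simp [ht', run, Function.update_apply]
  have ha6 : ∀ x, t'.arr 6 x = if x = t.reg 7 then t.reg 6 else t.arr 6 x := fun x => by
    simp [ht', run, Function.update_apply]
  have hM : ∀ x, Marked n t' x ↔ Marked n t x ∨ (x = t.reg 7) := by
    intro x
    simp only [Marked, ha4]
    by_cases hx : x = t.reg 7 <;> simp [hx, hv]
  refine ⟨⟨fun i h6 h7 h8 => ?_, fun a h4 h6 => ?_⟩, fun x => ?_, ?_⟩
  · rw [← hf.reg i h6 h7 h8]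
    rfl
  · rw [← hf.arr a h4 h6, ht']
    simp [run, h4, h6]
  · rw [hM]
    refine or_congr_right ⟨?_, fun h => h.1⟩
    rintro rfl
    exact ⟨rfl, h1, h3⟩
  · rintro ⟨hr, d, hd⟩
    refine ⟨(hM r).2 (Or.inl hr), Function.update d (t.reg 7) (d (t.reg 6) + 1),
      fun v hvM hvr => ?_⟩
    have hne : t.reg 6 ≠ t.reg 7 := fun e => h2 (e ▸ h1)
    by_cases hv7 : v = t.reg 7
    · subst hv7
      simp [ha6, hM, h1, h3, hne]
    · have hvM' : Marked n t v := ((hM v).1 hvM).resolve_right hv7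
      obtain ⟨h4, h5, h6⟩ := hd v hvM' hvr
      have hne' : t.arr 6 v ≠ t.reg 7 := fun e => h2 (e ▸ h4)
      simp [ha6, hM, hv7, h4, h5, hne', h6]

/-- Each of the `n` rounds marks a new vertex unless the marked set is already closed. -/
theorem run_search (hr : s.reg 9 = r) (hrn : r < n)
    (htest : ∀ t, SearchFrame s t → t.reg 6 < n → t.reg 7 < n →
      ((∀ e ∈ tests, e.eval t ≠ 0) ↔ E (t.reg 6) (t.reg 7))) :
    SearchFrame s ((search tests).run n s) ∧ SearchTree n E r ((search tests).run n s) ∧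
      ClosedUnder n E (Marked n ((search tests).run n s)) := by
  classical
  -- one round for a fixed `u`
  have hinner : ∀ t, SearchFrame s t → t.reg 6 < n → SearchTree n E r t →
      SearchFrame s ((rep 0 7 (searchStep tests)).run n t) ∧
      SearchTree n E r ((rep 0 7 (searchStep tests)).run n t) ∧
      ∀ x, Marked n ((rep 0 7 (searchStep tests)).run n t) x ↔
        Marked n t x ∨ (x < n ∧ Marked n t (t.reg 6) ∧ E (t.reg 6) x) := by
    intro t₀ hf₀ hu hT₀
    refine (run_rep (n := n) (b := 0) (i := 7) (c := searchStep tests) (s := t₀)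
      (fun j t => t.reg 6 = t₀.reg 6 ∧ SearchFrame s t ∧ SearchTree n E r t ∧
        ∀ x, Marked n t x ↔ Marked n t₀ x ∨ (x < j ∧ Marked n t₀ (t₀.reg 6) ∧ E (t₀.reg 6) x))
      ⟨by simp, hf₀.setReg (by simp), hT₀, fun x => by simp; rfl⟩ ?_).2
    rintro j hj t ht7 - - ⟨ht6, hf, hT, hM⟩
    obtain ⟨h1, h2, h3⟩ := run_searchStep (r := r) htest hf (by omega) (by omega)
    refine ⟨?_, h1.setReg (by simp), h3 hT, fun x => ?_⟩
    · rw [← ht6]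
      rw [Store.setReg_reg, if_neg (by decide)]
      refine run_reg ?_
      simp [searchStep, whenAll_writesReg, WritesReg, block]
    · refine (h2 x).trans ?_
      have h4 : Marked n t (t₀.reg 6) ↔ Marked n t₀ (t₀.reg 6) := by
        rw [hM]
        tauto
      rw [hM x, ht6, ht7, h4, Nat.lt_succ_iff, le_iff_lt_or_eq]
      tauto
  have hround : ∀ t, SearchFrame s t → SearchTree n E r t →
      SearchFrame s ((rep 0 6 (rep 0 7 (searchStep tests))).run n t) ∧
      SearchTree n E r ((rep 0 6 (rep 0 7 (searchStep tests))).run n t) ∧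
      (∀ x, Marked n t x → Marked n ((rep 0 6 (rep 0 7 (searchStep tests))).run n t) x) ∧
      (∀ u < n, Marked n t u → ∀ v < n, E u v →
        Marked n ((rep 0 6 (rep 0 7 (searchStep tests))).run n t) v) ∧
      (ClosedUnder n E (Marked n t) →
        ∀ x, Marked n ((rep 0 6 (rep 0 7 (searchStep tests))).run n t) x → Marked n t x) := by
    intro t₀ hf₀ hT₀
    refine run_rep (n := n) (b := 0) (i := 6) (s := t₀)
      (fun j t => SearchFrame s t ∧ SearchTree n E r t ∧ (∀ x, Marked n t₀ x → Marked n t x) ∧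
        (∀ u < j, Marked n t₀ u → ∀ v < n, E u v → Marked n t v) ∧
        (ClosedUnder n E (Marked n t₀) → ∀ x, Marked n t x → Marked n t₀ x))
      ⟨hf₀.setReg (by simp), hT₀, fun x hx => hx, by simp, fun _ x hx => hx⟩ ?_
    rintro j hj t ht6 - - ⟨hf, hT, h1, h2, h3⟩
    obtain ⟨g1, g2, g3⟩ := hinner t hf (by omega) hT
    rw [ht6] at g3
    refine ⟨g1.setReg (by simp), g2, fun x hx => (g3 x).2 (Or.inl (h1 x hx)), ?_, ?_⟩
    · intro u hu huM v hv huv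
      rcases Nat.lt_succ_iff_lt_or_eq.1 hu with hu | rfl
      · exact (g3 v).2 (Or.inl (h2 u hu huM v hv huv))
      · exact (g3 v).2 (Or.inr ⟨hv, h1 u huM, huv⟩)
    · intro hc x hx
      rcases (g3 x).1 hx with hx | ⟨hxn, hj, hjx⟩
      · exact h3 hc x hx
      · exact hc j (h3 hc j hj) x hxn hjx
  have hmain := run_rep (n := n) (b := 0) (i := 8) (c := rep 0 6 (rep 0 7 (searchStep tests)))
    (s := (block [clear 4, .setCell 4 (.reg 9) (.lit 1)]).run n s)
    (fun j t => SearchFrame s t ∧ SearchTree n E r t ∧ (ClosedUnder n E (Marked n t) ∨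
      j + 1 ≤ ((Finset.range n).filter (Marked n t)).card)) ?_ ?_
  · obtain ⟨h1, h2, h3⟩ := hmain
    refine ⟨h1, h2, h3.resolve_right fun h => ?_⟩
    have := (Finset.card_filter_le (Finset.range n) _).trans_lt' h
    simp at this
  · set t := (block [clear 4, .setCell 4 (.reg 9) (.lit 1)]).run n s with ht
    have h9 : ((clear 4).run n s).reg 9 = r := by rw [run_reg rfl, hr]
    have hM : ∀ v, Marked n t v ↔ v = r := by
      intro v
      simp only [Marked, ht, run_block_cons, run_block_nil, run_setCell, eval_lit, eval_reg, h9,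
        Store.setCell_arr, if_true, Function.update_apply]
      by_cases hv : v = r
      · simp [hv, hrn]
      · simp only [hv, if_false, iff_false, not_and, not_not]
        exact run_clear v
    have hM' : ∀ v, Marked n (t.setReg 8 0) v ↔ v = r := hM
    have hf : SearchFrame s t := by
      refine ⟨fun i h6 h7 h8 => ?_, fun a h4 h6 => ?_⟩
      · exact run_reg (c := clear 4) (by simp [clear, WritesReg, h7])
      · simp only [ht, run_block_cons, run_block_nil, run, Store.setCell_arr, h4, if_false]
        exact run_arr (by simp [clear, WritesArr, h4])
    refine ⟨hf.setReg (by simp), ⟨(hM' r).2 rfl, 0, fun v hv hvr => absurd ((hM' v).1 hv) hvr⟩,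
      Or.inr ?_⟩
    rw [zero_add, Nat.one_le_iff_ne_zero, ← Nat.pos_iff_ne_zero, Finset.card_pos]
    exact ⟨r, by simp [hM', hrn]⟩
  · rintro j hj t - - - ⟨hf, hT, hor⟩
    obtain ⟨g1, g2, g3, g4, g5⟩ := hround t hf hT
    set t' := (rep 0 6 (rep 0 7 (searchStep tests))).run n t with ht'
    refine ⟨g1.setReg (by simp), g2, ?_⟩
    change ClosedUnder n E (Marked n t') ∨ _ ≤ ((Finset.range n).filter (Marked n t')).card
    by_cases hc : ClosedUnder n E (Marked n t)
    · refine Or.inl fun u hu v hv huv => g3 v (hc u (g5 hc u hu) v hv huv)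
    · refine Or.inr ?_
      have h1 := hor.resolve_left hc
      simp only [ClosedUnder, not_forall] at hc
      obtain ⟨u, hu, v, hv, huv, hvM⟩ := hc
      refine (Nat.succ_le_succ h1).trans (Finset.card_lt_card ?_)
      refine (Finset.ssubset_iff_of_subset ?_).2 ⟨v, ?_, ?_⟩
      · intro x hx
        rw [Finset.mem_filter] at hx ⊢
        exact ⟨hx.1, g3 x hx.2⟩
      · rw [Finset.mem_filter]
        exact ⟨Finset.mem_range.2 hv, g4 u hu.1 hu v hv huv⟩
      · rw [Finset.mem_filter]
        exact fun h => hvM h.2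

end Blocks

section Tree

open Prog

variable {n : ℕ} {G : ℕ → ℕ → Prop} {s t : Store}

/-! ### Finding an out-branching -/

theorem run_ifte_of_ne {e : Expr} {c d : Prog} (h : e.eval s ≠ 0) :
    (Prog.ifte e c d).run n s = c.run n s := if_neg h

theorem run_ifte_of_eq {e : Expr} {c d : Prog} (h : e.eval s = 0) :
    (Prog.ifte e c d).run n s = d.run n s := if_pos h

theorem run_whenAll_setReg {es : List Expr} {i : ℕ} {e : Expr} :
    ((whenAll es (.setReg i e)).run n s).reg i = open Classical in
      if ∀ e ∈ es, e.eval s ≠ 0 then e.eval s else s.reg i := by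
  rw [run_whenAll]
  split_ifs <;> simp

theorem run_whenAll_setCell {es : List Expr} {a x : ℕ} {e f : Expr} :
    ((whenAll es (.setCell a e f)).run n s).arr a x = open Classical in
      if x = e.eval s ∧ ∀ e ∈ es, e.eval s ≠ 0 then f.eval s else s.arr a x := by
  rw [run_whenAll]
  split_ifs with h1 h2 h2
  · simp [h2.1]
  · have : x ≠ e.eval s := fun h => h2 ⟨h, h1⟩
    simp [this]
  · exact absurd h2.2 h1
  · rfl

theorem Arb.congr {r : ℕ} {p p' : ℕ → ℕ} (h : Arb G (Set.Iio n) r p) (hp : ∀ v < n, p' v = p v) :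
    Arb G (Set.Iio n) r p' := by
  obtain ⟨d, hd⟩ := h.rank
  refine ⟨h.root_mem, fun v hv hvr => ?_, fun v hv hvr => ?_, d, fun v hv hvr => ?_⟩ <;>
    rw [hp v hv]
  exacts [h.parent_mem v hv hvr, h.adj v hv hvr, hd v hv hvr]

/-- Set register `4` to a nonzero value if and only if all vertices are marked. -/
def allMarked : Prog :=
  block [.setReg 4 (.lit 1), .rep 0 7 (.ifte (.cell 4 (.reg 7)) .skip (.setReg 4 (.lit 0)))]

theorem run_allMarked : (allMarked.run n s).reg 4 ≠ 0 ↔ ∀ v < n, s.arr 4 v ≠ 0 := by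
  refine (run_rep (n := n) (b := 0) (i := 7)
    (c := .ifte (.cell 4 (.reg 7)) .skip (.setReg 4 (.lit 0))) (s := s.setReg 4 1)
    (fun j t => t.arr 4 = s.arr 4 ∧ (t.reg 4 ≠ 0 ↔ ∀ v < j, s.arr 4 v ≠ 0)) (by simp) ?_).2
  rintro j - t ht - - ⟨h4, h⟩
  simp only [run, Expr.eval, ht, h4, Nat.forall_lt_succ_right]
  by_cases h0 : s.arr 4 j = 0
  · simp [h0, h4]
  · rw [if_neg h0]
    simp [h0, h4, h]

/-- Copy the first `n` cells of array `b` to array `a`. -/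
def copy (a b : ℕ) : Prog := .rep 0 7 (.setCell a (.reg 7) (.cell b (.reg 7)))

theorem run_copy {a b : ℕ} (hab : b ≠ a) : ∀ i < n, ((copy a b).run n s).arr a i = s.arr b i := by
  refine (run_rep (n := n) (b := 0) (i := 7) (s := s)
    (fun j t => t.arr b = s.arr b ∧ ∀ i < j, t.arr a i = s.arr b i) (by simp) ?_).2
  rintro j - t ht - - ⟨hb, h⟩
  refine ⟨by simp [run, hab, hb], fun i hi => ?_⟩
  simp only [run_setCell, eval_cell, eval_reg, Store.setReg_arr, Store.setCell_arr, if_true,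
    Function.update_apply, ht, hb]
  split_ifs with hij
  · rw [hij]
  · exact h i (by omega)

/-- Try all vertices as roots; register `5` receives the root and array `5` the parents. -/
def findTree : Prog :=
  block [.setReg 4 (.lit 0), .rep 0 10 (.ifte (.reg 4) .skip (block
    [.setReg 9 (.reg 10), search [arcE (.reg 6) (.reg 7)], allMarked,
      .ifte (.reg 4) (block [.setReg 5 (.reg 10), copy 5 6]) .skip]))]

theorem Arb.mem_of_closed {r : ℕ} {p : ℕ → ℕ} (h : Arb G (Set.Iio n) r p) {M : ℕ → Prop}
    (hr : M r) (hM : ClosedUnder n G M) : ∀ v < n, M v := by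
  obtain ⟨d, hd⟩ := h.rank
  have : ∀ i, ∀ v < n, d v ≤ i → M v := by
    intro i
    induction i with
    | zero =>
      intro v hv hi
      by_cases hvr : v = r
      · rwa [hvr]
      · have := hd v hv hvr
        omega
    | succ i ih =>
      intro v hv hi
      by_cases hvr : v = r
      · rwa [hvr]
      · have := hd v hv hvr
        exact hM _ (ih _ (h.parent_mem v hv hvr) (by omega)) v hv (h.adj v hv hvr)
  exact fun v hv => this _ v hv le_rfl

theorem run_findTree (hs : Ctx n G s) (hG : HasArb G (Set.Iio n) 0) :
    Arb G (Set.Iio n) ((findTree.run n s).reg 5) ((findTree.run n s).arr 5) := by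
  have key := run_rep (n := n) (b := 0) (i := 10) (c := .ifte (.reg 4) .skip (block
    [.setReg 9 (.reg 10), search [arcE (.reg 6) (.reg 7)], allMarked,
      .ifte (.reg 4) (block [.setReg 5 (.reg 10), copy 5 6]) .skip])) (s := s.setReg 4 0)
    (fun j t => (t.reg 4 = 0 → ∀ r < j, ∀ p, ¬ Arb G (Set.Iio n) r p) ∧
      (t.reg 4 ≠ 0 → Arb G (Set.Iio n) (t.reg 5) (t.arr 5))) (by simp) ?_
  · change (((findTree.run n s).reg 4 = 0 → _) ∧ ((findTree.run n s).reg 4 ≠ 0 → _)) at key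
    obtain ⟨h1, h2⟩ := key
    refine h2 fun h0 => ?_
    obtain ⟨r, p, h, -⟩ := hG
    exact h1 h0 r h.root_mem p h
  rintro j hj t ht10 hreg harr ⟨h1, h2⟩
  have hctx : Ctx n G t := hs.congr (by rw [hreg 3 (by decide) rfl]; rfl)
    (by rw [harr 0 rfl]; rfl) (by rw [harr 3 rfl]; rfl)
  by_cases h4 : t.reg 4 = 0
  swap
  · rw [run_ifte_of_ne (e := .reg 4) h4]
    exact ⟨fun h => absurd h h4, fun _ => h2 h4⟩
  rw [run_ifte_of_eq (e := .reg 4) h4]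
  simp only [run_block_cons, run_block_nil]
  set t₁ := (Prog.setReg 9 (.reg 10)).run n t with ht₁
  have ht₁9 : t₁.reg 9 = j := by simp [ht₁, run, Expr.eval, ht10]
  have htest : ∀ t', SearchFrame t₁ t' → t'.reg 6 < n → t'.reg 7 < n →
      ((∀ e ∈ [arcE (.reg 6) (.reg 7)], e.eval t' ≠ 0) ↔ G (t'.reg 6) (t'.reg 7)) := by
    intro t' hf h6 h7
    have : Ctx n G t' := hctx.congr (hf.reg 3 (by decide) (by decide) (by decide))
      (hf.arr 0 (by decide) (by decide)) (hf.arr 3 (by decide) (by decide))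
    rw [List.forall_mem_singleton, this.eval_arcE (e := .reg 6) (f := .reg 7) h6 h7]
    rfl
  obtain ⟨g1, g2, g3⟩ := run_search ht₁9 (by omega) htest
  set t₂ := (search [arcE (.reg 6) (.reg 7)]).run n t₁ with ht₂
  have hall := run_allMarked (n := n) (s := t₂)
  set t₃ := allMarked.run n t₂ with ht₃
  have hclosed : ∀ p, Arb G (Set.Iio n) j p → ∀ v < n, t₂.arr 4 v ≠ 0 := fun p hp v hv =>
    (hp.mem_of_closed g2.1 g3 v hv).2
  by_cases h : t₃.reg 4 = 0
  · rw [run_ifte_of_eq (e := .reg 4) h]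
    refine ⟨fun _ r hr p hp => ?_, fun h' => absurd h h'⟩
    rcases Nat.lt_succ_iff_lt_or_eq.1 hr with hr | rfl
    · exact h1 h4 r hr p hp
    · exact hall.2 (hclosed p hp) h
  · rw [run_ifte_of_ne (e := .reg 4) h]
    simp only [run_block_cons, run_block_nil]
    set t₄ := (Prog.setReg 5 (.reg 10)).run n t₃ with ht₄
    have h10 : t₃.reg 10 = j := by
      rw [ht₃, run_reg rfl, ht₂, run_reg rfl, ht₁, run_reg rfl, ht10]
    have h5 : ((copy 5 6).run n t₄).reg 5 = j := by
      rw [run_reg rfl]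
      simp [ht₄, run, Expr.eval, h10]
    have h45 : ((copy 5 6).run n t₄).reg 4 = t₃.reg 4 := by
      rw [run_reg rfl]
      simp [ht₄, run]
    refine ⟨fun h' => absurd (h45.symm.trans h') h, fun _ => ?_⟩
    have hp : ∀ v < n, ((copy 5 6).run n t₄).arr 5 v = t₂.arr 6 v := by
      intro v hv
      rw [run_copy (by decide) v hv]
      exact congrFun (run_arr rfl : t₃.arr 6 = t₂.arr 6) v
    have hM : ∀ v < n, Marked n t₂ v := fun v hv => ⟨hv, hall.1 h v hv⟩
    obtain ⟨-, d, hd⟩ := g2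
    change Arb G (Set.Iio n) (((copy 5 6).run n t₄).reg 5) (((copy 5 6).run n t₄).arr 5)
    rw [h5]
    refine Arb.congr (p := t₂.arr 6) ⟨show j < n by omega, ?_, ?_, d, ?_⟩ hp
    · exact fun v hv hvr => (hd v (hM v hv) hvr).1.1
    · exact fun v hv hvr => (hd v (hM v hv) hvr).2.1
    · exact fun v hv hvr => (hd v (hM v hv) hvr).2.2

theorem run_findTree_ctx (hs : Ctx n G s) : Ctx n G (findTree.run n s) :=
  hs.congr (run_reg rfl) (run_arr rfl) (run_arr rfl)

/-! ### Moving spare leaves -/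

/-- For the vertex `u` in register `6`, set register `12` to a nonzero value if and only if `u` is
a leaf of the tree, and register `13` if and only if `u` has a sibling. -/
def testFamily : Prog :=
  block [.setReg 12 (.lit 1), .setReg 13 (.lit 0),
    .rep 0 7 (whenAll [notE (eqE (.reg 7) (.reg 5))] (block
      [whenAll [eqE (.cell 5 (.reg 7)) (.reg 6)] (.setReg 12 (.lit 0)),
        whenAll [notE (eqE (.reg 7) (.reg 6)), eqE (.cell 5 (.reg 7)) (.cell 5 (.reg 6))]
          (.setReg 13 (.lit 1))]))]

theorem run_testFamily {r u : ℕ} {p : ℕ → ℕ} (h5 : s.reg 5 = r) (h6 : s.reg 6 = u)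
    (hp : s.arr 5 = p) :
    ((testFamily.run n s).reg 12 ≠ 0 ↔ ∀ z < n, z ≠ r → p z ≠ u) ∧
      ((testFamily.run n s).reg 13 ≠ 0 ↔ ∃ z < n, z ≠ r ∧ z ≠ u ∧ p z = p u) := by
  refine run_rep (n := n) (b := 0) (i := 7)
    (fun j t => (t.reg 12 ≠ 0 ↔ ∀ z < j, z ≠ r → p z ≠ u) ∧
      (t.reg 13 ≠ 0 ↔ ∃ z < j, z ≠ r ∧ z ≠ u ∧ p z = p u)) (by simp) ?_
  rintro z hz t hz7 hreg harr ⟨h1, h2⟩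
  have h5 : t.reg 5 = r := (hreg 5 (by decide) rfl).trans h5
  have h6 : t.reg 6 = u := (hreg 6 (by decide) rfl).trans h6
  have hp : t.arr 5 = p := (harr 5 rfl).trans hp
  rw [run_whenAll]
  by_cases hzr : z = r
  · subst hzr
    rw [if_neg (by simp [hz7, h5])]
    constructor
    · rw [Store.setReg_reg, if_neg (by decide), h1, Nat.forall_lt_succ_right]
      simp
    · rw [Store.setReg_reg, if_neg (by decide), h2, Nat.exists_lt_succ_right]
      simp
  rw [if_pos (by simp [hz7, h5, hzr])]
  simp only [run_block_cons, run_block_nil]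
  set t₁ := (whenAll [eqE (.cell 5 (.reg 7)) (.reg 6)] (.setReg 12 (.lit 0))).run n t with ht₁
  have g12 : t₁.reg 12 = if p z = u then 0 else t.reg 12 := by
    rw [ht₁, run_whenAll_setReg]
    simp [hz7, h6, hp]
  have g13 : t₁.reg 13 = t.reg 13 := run_reg rfl
  have g7 : t₁.reg 7 = z := (run_reg rfl : _ = t.reg 7).trans hz7
  have g6 : t₁.reg 6 = u := (run_reg rfl : _ = t.reg 6).trans h6
  have g5 : t₁.arr 5 = p := (run_arr rfl : _ = t.arr 5).trans hp
  clear_value t₁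
  set t₂ := (whenAll [notE (eqE (.reg 7) (.reg 6)), eqE (.cell 5 (.reg 7)) (.cell 5 (.reg 6))]
          (.setReg 13 (.lit 1))).run n t₁ with ht₂
  have f13 : t₂.reg 13 = if z ≠ u ∧ p z = p u then 1 else t.reg 13 := by
    rw [ht₂, run_whenAll_setReg, g13]
    simp [g7, g6, g5]
  have f12 : t₂.reg 12 = t₁.reg 12 := run_reg rfl
  clear_value t₂
  simp only [Store.setReg_reg, f12, f13, g12, Nat.forall_lt_succ_right, Nat.exists_lt_succ_right,
    ← h1, ← h2, Nat.reduceEqDiff, if_false, hzr, ne_eq, not_false_eq_true,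
    true_and, forall_const]
  constructor
  · split_ifs with h <;> simp [h]
  · split_ifs with h
    · simp [h]
    · simp only [h, or_false]

/-- Mark the spare leaves of the tree in array `7` and its internal vertices in array `8`. -/
def markSpare : Prog :=
  .rep 0 6 (block [testFamily, .setCell 8 (.reg 6) (notE (.reg 12)),
    .setCell 7 (.reg 6) (.lit 0),
    whenAll [.reg 12, .reg 13, notE (eqE (.reg 6) (.reg 5))] (.setCell 7 (.reg 6) (.lit 1))])

theorem run_markSpare :
    (∀ u < n, (markSpare.run n s).arr 7 u ≠ 0 ↔ u ∈ spare (Set.Iio n) (s.reg 5) (s.arr 5)) ∧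
    ∀ u < n, (markSpare.run n s).arr 8 u = open Classical in
      if u ∈ inner (Set.Iio n) (s.reg 5) (s.arr 5) then 1 else 0 := by
  classical
  set r := s.reg 5 with hr
  set p := s.arr 5 with hp
  refine run_rep (n := n) (b := 0) (i := 6) (s := s)
    (fun j t => (∀ u < j, t.arr 7 u ≠ 0 ↔ u ∈ spare (Set.Iio n) r p) ∧
      ∀ u < j, t.arr 8 u = if u ∈ inner (Set.Iio n) r p then 1 else 0) (by simp) ?_
  rintro u hu t ht6 hreg harr ⟨h1, h2⟩
  have hr5 : t.reg 5 = r := hreg 5 (by decide) rfl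
  have hp5 : t.arr 5 = p := harr 5 rfl
  obtain ⟨h3, h4⟩ := run_testFamily (n := n) hr5 ht6 hp5
  simp only [run_block_cons, run_block_nil]
  have g5 : (testFamily.run n t).reg 5 = r := by rw [run_reg rfl, ← hr5]
  have g6 : (testFamily.run n t).reg 6 = u := by rw [run_reg rfl, ← ht6]
  have g7 : (testFamily.run n t).arr 7 = t.arr 7 := by rw [run_arr rfl]
  have g8 : (testFamily.run n t).arr 8 = t.arr 8 := by rw [run_arr rfl]
  set t₂ := testFamily.run n t with ht₂
  clear_value t₂
  have hinner : u ∈ inner (Set.Iio n) r p ↔ t₂.reg 12 = 0 := by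
    rw [← not_iff_not, ← ne_eq (t₂.reg 12), h3, mem_inner]
    simp
  have hspare : u ∈ spare (Set.Iio n) r p ↔ t₂.reg 12 ≠ 0 ∧ t₂.reg 13 ≠ 0 ∧ u ≠ r := by
    rw [h3, h4]
    exact ⟨fun h => ⟨h.2.2.1, h.2.2.2, h.2.1⟩, fun h => ⟨hu, h.2.2, h.1, h.2.1⟩⟩
  clear hreg harr h3 h4
  constructor
  · intro v hv
    rw [Store.setReg_arr, run_whenAll_setCell]
    simp only [run_setCell, eval_reg, eval_lit, Store.setCell_reg, Store.setCell_arr, g6, g7]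
    rcases Nat.lt_succ_iff_lt_or_eq.1 hv with hv | rfl
    · rw [← h1 v hv]
      simp [hv.ne]
    · rw [hspare]
      simp [g5, g6]
  · intro v hv
    have h8 : (notE (.reg 12)).eval t₂ = if u ∈ inner (Set.Iio n) r p then 1 else 0 := by
      rw [hinner]
      simp only [notE, Expr.eval]
      split_ifs <;> omega
    rw [Store.setReg_arr, run_arr (by decide)]
    simp only [run_setCell, eval_reg, eval_lit, Store.setCell_reg, Store.setCell_arr, g6, g8, h8]
    rcases Nat.lt_succ_iff_lt_or_eq.1 hv with hv | rfl
    · rw [← h2 v hv]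
      simp [hv.ne]
    · simp

theorem markSpare_ctx (hs : Ctx n G s) : Ctx n G (markSpare.run n s) :=
  hs.congr (run_reg rfl) (run_arr rfl) (run_arr rfl)

/-- A single pass over the arcs: whenever both ends of an arc are spare leaves, the head is moved
below the tail. -/
def moveSpare : Prog :=
  .rep 0 10 (.rep 0 11 (block [markSpare,
    whenAll [arcE (.reg 10) (.reg 11), .cell 7 (.reg 10), .cell 7 (.reg 11)]
      (.setCell 5 (.reg 11) (.reg 10))]))

/-- The spare leaves only decrease, so that an arc that does not join two of them never will. -/
theorem run_moveSpare (hG : ∀ u, ¬ G u u) (hs : Ctx n G s)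
    (hA : Arb G (Set.Iio n) (s.reg 5) (s.arr 5)) :
    Arb G (Set.Iio n) ((moveSpare.run n s).reg 5) ((moveSpare.run n s).arr 5) ∧
    ∀ u < n, ∀ v < n, G u v →
      ¬ (u ∈ spare (Set.Iio n) ((moveSpare.run n s).reg 5) ((moveSpare.run n s).arr 5) ∧
        v ∈ spare (Set.Iio n) ((moveSpare.run n s).reg 5) ((moveSpare.run n s).arr 5)) := by
  have hreg5 : ∀ t : Store, (moveSpare.run n t).reg 5 = t.reg 5 := fun t => run_reg rfl
  simp only [hreg5]
  set r := s.reg 5 with hr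
  set c : Prog := block [markSpare,
    whenAll [arcE (.reg 10) (.reg 11), .cell 7 (.reg 10), .cell 7 (.reg 11)]
      (.setCell 5 (.reg 11) (.reg 10))] with hc
  have hstep : ∀ t, Ctx n G t → t.reg 5 = r → Arb G (Set.Iio n) r (t.arr 5) →
      t.reg 10 < n → t.reg 11 < n →
      Arb G (Set.Iio n) r ((c.run n t).arr 5) ∧
      spare (Set.Iio n) r ((c.run n t).arr 5) ⊆ spare (Set.Iio n) r (t.arr 5) ∧
      (G (t.reg 10) (t.reg 11) → ¬ (t.reg 10 ∈ spare (Set.Iio n) r ((c.run n t).arr 5) ∧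
        t.reg 11 ∈ spare (Set.Iio n) r ((c.run n t).arr 5))) := by
    intro t ht h5 hA h10 h11
    have hmark := (run_markSpare (n := n) (s := t)).1
    have hctx := markSpare_ctx ht
    have g5 : (markSpare.run n t).arr 5 = t.arr 5 := run_arr rfl
    have g10 : (markSpare.run n t).reg 10 = t.reg 10 := run_reg rfl
    have g11 : (markSpare.run n t).reg 11 = t.reg 11 := run_reg rfl
    rw [h5] at hmark
    have hrun : c.run n t = (whenAll
      [arcE (.reg 10) (.reg 11), .cell 7 (.reg 10), .cell 7 (.reg 11)]
      (.setCell 5 (.reg 11) (.reg 10))).run n (markSpare.run n t) := rfl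
    have harc := hctx.eval_arcE (e := .reg 10) (f := .reg 11) (by rwa [eval_reg, g10])
      (by rwa [eval_reg, g11])
    simp only [eval_reg, g10, g11] at harc
    set t₁ := markSpare.run n t with ht₁
    clear_value t₁
    have hcond : (∀ e ∈ [arcE (.reg 10) (.reg 11), .cell 7 (.reg 10), .cell 7 (.reg 11)],
        e.eval t₁ ≠ 0) ↔ G (t.reg 10) (t.reg 11) ∧ t.reg 10 ∈ spare (Set.Iio n) r (t.arr 5) ∧
          t.reg 11 ∈ spare (Set.Iio n) r (t.arr 5) := by
      rw [List.forall_mem_cons, List.forall_mem_cons, List.forall_mem_singleton, harc, eval_cell,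
        eval_cell, eval_reg, eval_reg, g10, g11, hmark _ h10, hmark _ h11]
    have harr : (c.run n t).arr 5 = open Classical in
        if G (t.reg 10) (t.reg 11) ∧ t.reg 10 ∈ spare (Set.Iio n) r (t.arr 5) ∧
          t.reg 11 ∈ spare (Set.Iio n) r (t.arr 5) then
        Function.update (t.arr 5) (t.reg 11) (t.reg 10) else t.arr 5 := by
      rw [hrun, run_whenAll]
      by_cases h : G (t.reg 10) (t.reg 11) ∧ t.reg 10 ∈ spare (Set.Iio n) r (t.arr 5) ∧
          t.reg 11 ∈ spare (Set.Iio n) r (t.arr 5)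
      · rw [if_pos (hcond.2 h), if_pos h]
        simp [g5, g10, g11]
      · rw [if_neg (mt hcond.1 h), if_neg h, g5]
    rw [harr]
    split_ifs with h
    · have hne : t.reg 10 ≠ t.reg 11 := fun e => hG (t.reg 11) (by
        have := h.1
        rwa [e] at this)
      have hsub := spare_update_subset h.2.1 h.2.2 hne
      exact ⟨hA.update h10 h.2.2 h.1 hne, hsub.trans Set.sdiff_subset,
        fun _ h' => (hsub h'.2).2 rfl⟩
    · exact ⟨hA, subset_rfl, fun h1 h2 => h ⟨h1, h2⟩⟩
  have hinner : ∀ t, Ctx n G t → t.reg 5 = r → Arb G (Set.Iio n) r (t.arr 5) → t.reg 10 < n →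
      Arb G (Set.Iio n) r (((rep 0 11 c).run n t).arr 5) ∧
      spare (Set.Iio n) r (((rep 0 11 c).run n t).arr 5) ⊆ spare (Set.Iio n) r (t.arr 5) ∧
      ∀ v < n, G (t.reg 10) v → ¬ (t.reg 10 ∈ spare (Set.Iio n) r (((rep 0 11 c).run n t).arr 5) ∧
        v ∈ spare (Set.Iio n) r (((rep 0 11 c).run n t).arr 5)) := by
    intro t₀ ht h5 hA h10
    refine run_rep (n := n) (b := 0) (i := 11) (c := c) (s := t₀)
      (fun j t => Arb G (Set.Iio n) r (t.arr 5) ∧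
        spare (Set.Iio n) r (t.arr 5) ⊆ spare (Set.Iio n) r (t₀.arr 5) ∧
        ∀ v < j, G (t₀.reg 10) v → ¬ (t₀.reg 10 ∈ spare (Set.Iio n) r (t.arr 5) ∧
          v ∈ spare (Set.Iio n) r (t.arr 5))) ⟨hA, subset_rfl, by simp⟩ ?_
    rintro j hj t ht11 hreg harr ⟨h1, h2, h3⟩
    have k10 : t.reg 10 = t₀.reg 10 := hreg 10 (by decide) rfl
    obtain ⟨k1, k2, k3⟩ := hstep t (ht.congr (hreg 3 (by decide) rfl) (harr 0 rfl) (harr 3 rfl))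
      ((hreg 5 (by decide) rfl).trans h5) h1 (by omega) (by omega)
    rw [k10, ht11] at k3
    refine ⟨k1, k2.trans h2, fun v hv hG' h' => ?_⟩
    rcases Nat.lt_succ_iff_lt_or_eq.1 hv with hv | rfl
    · exact h3 v hv hG' ⟨k2 h'.1, k2 h'.2⟩
    · exact k3 hG' h'
  refine run_rep (n := n) (b := 0) (i := 10) (c := rep 0 11 c) (s := s)
    (fun j t => Arb G (Set.Iio n) r (t.arr 5) ∧ ∀ u < j, ∀ v < n, G u v →
      ¬ (u ∈ spare (Set.Iio n) r (t.arr 5) ∧ v ∈ spare (Set.Iio n) r (t.arr 5)))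
    ⟨hA, by simp⟩ ?_
  rintro j hj t ht10 hreg harr ⟨h1, h2⟩
  obtain ⟨k1, k2, k3⟩ := hinner t (hs.congr (hreg 3 (by decide) rfl) (harr 0 rfl) (harr 3 rfl))
    (hreg 5 (by decide) rfl) h1 (by omega)
  rw [ht10] at k3
  refine ⟨k1, fun u hu v hv hG' h' => ?_⟩
  rcases Nat.lt_succ_iff_lt_or_eq.1 hu with hu | rfl
  · exact h2 u hu v hv hG' ⟨k2 h'.1, k2 h'.2⟩
  · exact k3 v hv hG' h'

theorem moveSpare_ctx (hs : Ctx n G s) : Ctx n G (moveSpare.run n s) :=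
  hs.congr (run_reg rfl) (run_arr rfl) (run_arr rfl)

/-- Set register `4` to the sum of the first `n` entries of array `8`. -/
def countInner : Prog :=
  block [.setReg 4 (.lit 0), .rep 0 6 (.setReg 4 (.add (.reg 4) (.cell 8 (.reg 6))))]

theorem run_countInner : (countInner.run n s).reg 4 = ∑ i ∈ Finset.range n, s.arr 8 i := by
  refine run_rep (n := n) (b := 0) (i := 6)
    (fun j t => t.reg 4 = ∑ i ∈ Finset.range j, s.arr 8 i) (by simp) ?_
  rintro j - t ht - harr h
  rw [Finset.sum_range_succ, ← h, ← (show t.arr 8 = s.arr 8 from harr 8 rfl)]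
  simp [ht]

theorem sum_inner_eq_ncard {r : ℕ} {p : ℕ → ℕ} {f : ℕ → ℕ} (hA : Arb G (Set.Iio n) r p)
    (hf : ∀ u < n, f u = open Classical in if u ∈ inner (Set.Iio n) r p then 1 else 0) :
    ∑ i ∈ Finset.range n, f i = (inner (Set.Iio n) r p).ncard := by
  classical
  rw [Finset.sum_congr rfl fun i hi => hf i (Finset.mem_range.1 hi), Finset.sum_boole, Nat.cast_id,
    ← Set.ncard_coe_finset]
  congr 1
  ext u
  simp only [Finset.coe_filter, Finset.mem_range, Set.mem_ofPred_eq, and_iff_right_iff_imp]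
  intro hu
  obtain ⟨v, hv, hvr, rfl⟩ := mem_inner.1 hu
  exact hA.parent_mem v hv hvr

end Tree

section Matching

open Prog

variable {n : ℕ} {G : ℕ → ℕ → Prop} {s t : Store}

/-! ### Augmenting a matching -/

theorem Matches.update {V : Type*} [DecidableEq V] {G : V → V → Prop} {M : Set V}
    {m : V → V × Option V} (h : Matches G M m) {c : V} {q : V × Option V}
    (hq : ∀ v ∈ M, v ≠ c → m v ≠ q) (h1 : G q.1 c) (h2 : ∀ y, q.2 = some y → G c y) :
    Matches G (insert c M) (Function.update m c q) := by
  refine ⟨?_, ?_, ?_⟩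
  · intro u hu v hv huv
    by_cases huc : u = c <;> by_cases hvc : v = c
    · rw [huc, hvc]
    · rw [huc, Function.update_self, Function.update_of_ne hvc] at huv
      exact absurd huv.symm (hq v (hv.resolve_left hvc) hvc)
    · rw [hvc, Function.update_self, Function.update_of_ne huc] at huv
      exact absurd huv (hq u (hu.resolve_left huc) huc)
    · rw [Function.update_of_ne huc, Function.update_of_ne hvc] at huv
      exact h.injOn (hu.resolve_left huc) (hv.resolve_left hvc) huv
  · intro v hv
    by_cases hvc : v = c
    · subst hvc; simpa
    · rw [Function.update_of_ne hvc]
      exact h.adj_fst v (hv.resolve_left hvc)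
  · intro v hv
    by_cases hvc : v = c
    · subst hvc; simpa
    · rw [Function.update_of_ne hvc]
      exact h.adj_snd v (hv.resolve_left hvc)

theorem Matches.mono {V : Type*} {G : V → V → Prop} {M M' : Set V} {m : V → V × Option V}
    (h : Matches G M m) (hM : M' ⊆ M) : Matches G M' m :=
  ⟨h.injOn.mono hM, fun v hv => h.adj_fst v (hM hv), fun v hv => h.adj_snd v (hM hv)⟩

/-- The vertex of the auxiliary graph with code `(x, y)`; the value `y = n` stands for a missing
second component. -/
def decode (n x y : ℕ) : ℕ × Option ℕ := (x, if y = n then none else some y)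

theorem decode_inj {x y x' y' : ℕ} : decode n x y = decode n x' y' ↔ x = x' ∧ y = y' := by
  unfold decode
  rw [Prod.mk.injEq]
  refine and_congr_right fun _ => ?_
  split_ifs with h1 h2 h2
  · simp [h1, h2]
  · simp only [false_iff]
    exact fun e => h2 (e ▸ h1)
  · simp only [false_iff]
    exact fun e => h1 (e ▸ h2)
  · exact Option.some_inj

/-- The code `(x, y)` is adjacent to `v`. -/
def CodeAdj (n : ℕ) (G : ℕ → ℕ → Prop) (x y v : ℕ) : Prop := G x v ∧ (y = n ∨ G v y)

theorem CodeAdj.snd {x y v : ℕ} (h : CodeAdj n G x y v) :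
    ∀ z, (decode n x y).2 = some z → G v z := by
  intro z hz
  simp only [decode] at hz
  split_ifs at hz with hy
  rw [Option.some_inj] at hz
  exact hz ▸ h.2.resolve_left hy

/-- The matched vertices are marked in array `9`. -/
def matched (n : ℕ) (t : Store) : Set ℕ := {v | v < n ∧ t.arr 9 v ≠ 0}

/-- The matches are stored in arrays `10` and `11`. -/
def matchOf (n : ℕ) (t : Store) (v : ℕ) : ℕ × Option ℕ := decode n (t.arr 10 v) (t.arr 11 v)

theorem Matches.codeAdj (h : Matches G (matched n s) (matchOf n s)) {v : ℕ} (hv : v ∈ matched n s) :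
    CodeAdj n G (s.arr 10 v) (s.arr 11 v) v := by
  refine ⟨h.adj_fst v hv, ?_⟩
  by_cases hy : s.arr 11 v = n
  · exact Or.inl hy
  · exact Or.inr (h.adj_snd v hv _ (by simp [matchOf, decode, hy]))

/-- An alternating step leads from `u` to the vertex `v` matched to a neighbour of `u`. -/
def AltStep (n : ℕ) (G : ℕ → ℕ → Prop) (s : Store) (u v : ℕ) : Prop :=
  v ∈ matched n s ∧ CodeAdj n G (s.arr 10 v) (s.arr 11 v) u

/-- Nonzero if `(x, y)` is adjacent to `v` and the values are in the correct ranges. -/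
def codeAdjE (x y v : Expr) : List Expr := [arcE x v, .add (eqE y (.reg 3)) (arcE v y)]

theorem eval_codeAdjE (hs : Ctx n G s) {x y v : Expr} (hx : x.eval s < n) (hy : y.eval s ≤ n)
    (hv : v.eval s < n) : (∀ e ∈ codeAdjE x y v, e.eval s ≠ 0) ↔
      CodeAdj n G (x.eval s) (y.eval s) (v.eval s) := by
  rw [codeAdjE, List.forall_mem_cons, List.forall_mem_singleton, hs.eval_arcE hx hv, CodeAdj,
    eval_add]
  refine and_congr_right fun _ => ?_
  by_cases h : y.eval s = n
  · have : (eqE y (.reg 3)).eval s ≠ 0 := by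
      rw [ne_eq, eval_eqE, not_not, h, eval_reg, hs.reg]
    simp only [h, true_or, iff_true]
    omega
  · have : (eqE y (.reg 3)).eval s = 0 := by
      rw [eval_eqE, eval_reg, hs.reg]
      exact h
    rw [this, zero_add, hs.eval_arcE hv (by omega)]
    simp [h]

/-- The tests for an alternating step from register `6` to register `7`. -/
def altTests : List Expr :=
  .cell 9 (.reg 7) :: codeAdjE (.cell 10 (.reg 7)) (.cell 11 (.reg 7)) (.reg 6)

theorem eval_altTests (hG : ∀ u v, G u v → u < n ∧ v < n) (hs : Ctx n G s)
    (hm : Matches G (matched n s) (matchOf n s)) (ht : SearchFrame s t)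
    (h6 : t.reg 6 < n) (h7 : t.reg 7 < n) :
    (∀ e ∈ altTests, e.eval t ≠ 0) ↔ AltStep n G s (t.reg 6) (t.reg 7) := by
  have hctx : Ctx n G t := hs.congr (ht.reg 3 (by decide) (by decide) (by decide))
    (ht.arr 0 (by decide) (by decide)) (ht.arr 3 (by decide) (by decide))
  have h9 : t.arr 9 = s.arr 9 := ht.arr 9 (by decide) (by decide)
  have h10 : t.arr 10 = s.arr 10 := ht.arr 10 (by decide) (by decide)
  have h11 : t.arr 11 = s.arr 11 := ht.arr 11 (by decide) (by decide)
  rw [altTests, List.forall_mem_cons, AltStep, eval_cell, eval_reg, h9]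
  by_cases hv : s.arr 9 (t.reg 7) = 0
  · simp [hv, matched]
  have hvM : t.reg 7 ∈ matched n s := ⟨h7, hv⟩
  have hc := hm.codeAdj hvM
  rw [eval_codeAdjE hctx]
  · simp only [eval_cell, eval_reg, h10, h11]
    exact and_congr_left fun _ => iff_of_true hv hvM
  · simpa [h10] using (hG _ _ hc.1).1
  · simp only [eval_cell, eval_reg, h11]
    exact hc.2.elim (fun h => h.le) fun h => (hG _ _ h).2.le
  · exact h6

/-- Ranks can be chosen below `n`. -/
theorem exists_rank_lt (d : ℕ → ℕ) :
    ∃ d' : ℕ → ℕ, (∀ v < n, d' v < n) ∧ ∀ u < n, ∀ v, d u < d v → d' u < d' v := by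
  refine ⟨fun v => ((Finset.range n).filter fun u => d u < d v).card, fun v hv => ?_,
    fun u hu v huv => ?_⟩
  · refine (Finset.card_lt_card ((Finset.ssubset_iff_of_subset (Finset.filter_subset _ _)).2
      ⟨v, Finset.mem_range.2 hv, ?_⟩)).trans_eq (Finset.card_range n)
    simp
  · refine Finset.card_lt_card ((Finset.ssubset_iff_of_subset fun x hx => ?_).2 ⟨u, ?_, ?_⟩)
    · rw [Finset.mem_filter] at hx ⊢
      exact ⟨hx.1, hx.2.trans huv⟩
    · simp [hu, huv]
    · simp

/-- One step back along an alternating path: the vertex in register `15` is matched to the code in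
registers `16` and `17`, and its old match is passed on to its predecessor. -/
def augmentStep : Prog :=
  block [.setReg 19 (.cell 10 (.reg 15)), .setReg 20 (.cell 11 (.reg 15)),
    .setCell 10 (.reg 15) (.reg 16), .setCell 11 (.reg 15) (.reg 17),
    .ifte (eqE (.reg 15) (.reg 9)) (block [.setReg 18 (.lit 1), .setCell 9 (.reg 9) (.lit 1)])
      (block [.setReg 16 (.reg 19), .setReg 17 (.reg 20), .setReg 15 (.cell 6 (.reg 15))])]

/-- Augment the matching along the path from register `15` back to the vertex in register `9`. -/
def augment : Prog :=
  block [.setReg 18 (.lit 0), .rep 0 8 (.ifte (.reg 18) .skip augmentStep)]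

theorem matchOf_update {x y c : ℕ} (h10 : t.arr 10 = Function.update (s.arr 10) c x)
    (h11 : t.arr 11 = Function.update (s.arr 11) c y) :
    matchOf n t = Function.update (matchOf n s) c (decode n x y) := by
  funext v
  by_cases hv : v = c
  · subst hv; simp [matchOf, h10, h11]
  · simp [matchOf, h10, h11, hv]

theorem matchOf_setReg {i m : ℕ} : matchOf n (s.setReg i m) = matchOf n s := rfl

/-- The path runs along decreasing ranks, so that `n` rounds suffice. The matches of the vertices
that have not been visited are the original ones. -/
theorem run_augment {w : ℕ} (hw : s.reg 9 = w)
    (hm : Matches G (matched n s) (matchOf n s)) (hT : SearchTree n (AltStep n G s) w s)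
    (hmark : Marked n s (s.reg 15)) (hadj : CodeAdj n G (s.reg 16) (s.reg 17) (s.reg 15))
    (hfree : ∀ v ∈ matched n s, matchOf n s v ≠ decode n (s.reg 16) (s.reg 17)) :
    matched n (augment.run n s) = insert w (matched n s) ∧
      Matches G (insert w (matched n s)) (matchOf n (augment.run n s)) := by
  obtain ⟨hMw, d₀, hd₀⟩ := hT
  obtain ⟨d, hdn, hd⟩ := exists_rank_lt (n := n) d₀
  have hpred : ∀ v, Marked n s v → v ≠ w → Marked n s (s.arr 6 v) ∧ AltStep n G s (s.arr 6 v) v ∧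
      d (s.arr 6 v) < d v := fun v hv hvw =>
    ⟨(hd₀ v hv hvw).1, (hd₀ v hv hvw).2.1, hd _ (hd₀ v hv hvw).1.1 _ (hd₀ v hv hvw).2.2⟩
  have key := run_rep (n := n) (b := 0) (i := 8) (c := .ifte (.reg 18) .skip augmentStep)
    (s := s.setReg 18 0)
    (fun j t => (t.reg 18 ≠ 0 ∧ matched n t = insert w (matched n s) ∧
        Matches G (insert w (matched n s)) (matchOf n t)) ∨
      (t.reg 18 = 0 ∧ t.arr 9 = s.arr 9 ∧ Matches G (matched n s) (matchOf n t) ∧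
        Marked n s (t.reg 15) ∧ CodeAdj n G (t.reg 16) (t.reg 17) (t.reg 15) ∧
        (∀ v ∈ matched n s, matchOf n t v ≠ decode n (t.reg 16) (t.reg 17)) ∧
        d (t.reg 15) + j < n ∧
        ∀ v, d v ≤ d (t.reg 15) → t.arr 10 v = s.arr 10 v ∧ t.arr 11 v = s.arr 11 v))
    (Or.inr ⟨by simp, rfl, hm, hmark, hadj, hfree, hdn _ hmark.1, fun _ _ => ⟨rfl, rfl⟩⟩) ?_
  · rcases key with ⟨-, h1, h2⟩ | ⟨-, -, -, -, -, -, h, -⟩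
    · exact ⟨h1, h2⟩
    · omega
  rintro j hj t - hreg harr h
  have h9 : t.reg 9 = w := (hreg 9 (by decide) rfl).trans hw
  have h6 : t.arr 6 = s.arr 6 := harr 6 rfl
  clear hreg harr
  rcases h with ⟨h18, h⟩ | ⟨h18, h9a, hmt, hmk, hca, hfr, hdj, heq⟩
  · rw [run_ifte_of_ne (e := .reg 18) h18]
    exact Or.inl ⟨h18, h⟩
  rw [run_ifte_of_eq (e := .reg 18) h18, augmentStep]
  simp only [run_block_cons, run_block_nil]
  set t₁ := (Prog.setCell 11 (.reg 15) (.reg 17)).run n ((Prog.setCell 10 (.reg 15) (.reg 16)).run n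
    ((Prog.setReg 20 (.cell 11 (.reg 15))).run n
      ((Prog.setReg 19 (.cell 10 (.reg 15))).run n t))) with ht₁
  have k10 : t₁.arr 10 = Function.update (t.arr 10) (t.reg 15) (t.reg 16) := by simp [ht₁]
  have k11 : t₁.arr 11 = Function.update (t.arr 11) (t.reg 15) (t.reg 17) := by simp [ht₁]
  have k19 : t₁.reg 19 = t.arr 10 (t.reg 15) := by simp [ht₁]
  have k20 : t₁.reg 20 = t.arr 11 (t.reg 15) := by simp [ht₁]
  have k15 : t₁.reg 15 = t.reg 15 := by simp [ht₁]
  have k18 : t₁.reg 18 = 0 := by simp [ht₁, h18]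
  have k9 : t₁.reg 9 = w := by simp [ht₁, h9]
  have k9a : t₁.arr 9 = s.arr 9 := by simp [ht₁, h9a]
  have k6 : t₁.arr 6 = s.arr 6 := by simp [ht₁, h6]
  clear_value t₁
  have hnew := hmt.update (c := t.reg 15) (q := decode n (t.reg 16) (t.reg 17))
    (fun v hv _ => hfr v hv) hca.1 hca.snd
  by_cases hcw : t.reg 15 = w
  · rw [run_ifte_of_ne (by simp [k15, k9, hcw])]
    refine Or.inl ⟨by simp, ?_, ?_⟩
    · ext v
      have hwn : w < n := hMw.1
      simp only [matched, run_block_cons, run_block_nil, run_setCell, run_setReg, eval_reg,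
        Store.setReg_arr, Store.setCell_arr, Store.setReg_reg, if_true, k9, k9a, eval_lit,
        Set.mem_ofPred_eq, Set.mem_insert_iff, Function.update_apply, Nat.reduceEqDiff, if_false]
      by_cases hv : v = w <;> simp [hv, hwn]
    · rw [hcw] at hnew
      rw [matchOf_update (s := t) (c := w) (x := t.reg 16) (y := t.reg 17)]
      · exact hnew
      · simp [k10, hcw]
      · simp [k11, hcw]
  · rw [run_ifte_of_eq (by simp [k15, k9, hcw])]
    obtain ⟨p1, ⟨p2, p3⟩, p4⟩ := hpred _ hmk hcw
    obtain ⟨e10, e11⟩ := heq _ le_rfl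
    have hins : insert (t.reg 15) (matched n s) = matched n s := Set.insert_eq_of_mem p2
    rw [hins] at hnew
    have hmo : matchOf n t₁ =
        Function.update (matchOf n t) (t.reg 15) (decode n (t.reg 16) (t.reg 17)) :=
      matchOf_update k10 k11
    simp only [run_block_cons, run_block_nil, run_setReg, eval_reg, eval_cell, Store.setReg_reg,
      Store.setReg_arr, k19, k20, k15, k6, k18, k9a, hmo, matchOf_setReg,
      Nat.reduceEqDiff, if_true, if_false]
    refine Or.inr ⟨trivial, trivial, ?_, p1, ?_, ?_, by omega, ?_⟩
    · exact hnew
    · rw [e10, e11]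
      exact p3
    · intro v hv
      by_cases hvc : v = t.reg 15
      · subst hvc
        rw [Function.update_self]
        exact (hfr _ hv).symm
      · rw [Function.update_of_ne hvc]
        exact fun e => hvc (hmt.injOn hv p2 e)
    · intro v hv
      have hvc : v ≠ t.reg 15 := by
        rintro rfl
        omega
      rw [k10, k11, Function.update_of_ne hvc, Function.update_of_ne hvc]
      exact heq v (by omega)

end Matching

section Matching

open Prog

variable {n : ℕ} {G : ℕ → ℕ → Prop} {s t : Store} {W : Set ℕ}

/-! ### Free neighbours -/

/-- Set register `4` to a nonzero value if and only if the code in registers `12` and `13` is not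
matched. -/
def testFree : Prog :=
  block [.setReg 4 (.lit 1), .rep 0 7 (whenAll [.cell 9 (.reg 7), eqE (.cell 10 (.reg 7)) (.reg 12),
    eqE (.cell 11 (.reg 7)) (.reg 13)] (.setReg 4 (.lit 0)))]

theorem run_testFree : (testFree.run n s).reg 4 ≠ 0 ↔
    ∀ v < n, ¬ (s.arr 9 v ≠ 0 ∧ s.arr 10 v = s.reg 12 ∧ s.arr 11 v = s.reg 13) := by
  refine run_rep (n := n) (b := 0) (i := 7) (fun j t => t.reg 4 ≠ 0 ↔
    ∀ v < j, ¬ (s.arr 9 v ≠ 0 ∧ s.arr 10 v = s.reg 12 ∧ s.arr 11 v = s.reg 13)) (by simp) ?_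
  rintro j - t ht hreg harr h
  have h12 : t.reg 12 = s.reg 12 := hreg 12 (by decide) rfl
  have h13 : t.reg 13 = s.reg 13 := hreg 13 (by decide) rfl
  have h9 : t.arr 9 = s.arr 9 := harr 9 rfl
  have h10 : t.arr 10 = s.arr 10 := harr 10 rfl
  have h11 : t.arr 11 = s.arr 11 := harr 11 rfl
  have hc : (∀ e ∈ [.cell 9 (.reg 7), eqE (.cell 10 (.reg 7)) (.reg 12),
      eqE (.cell 11 (.reg 7)) (.reg 13)], e.eval t ≠ 0) ↔
      s.arr 9 j ≠ 0 ∧ s.arr 10 j = s.reg 12 ∧ s.arr 11 j = s.reg 13 := by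
    simp [ht, h12, h13, h9, h10, h11]
  rw [Store.setReg_reg, if_neg (by decide), run_whenAll_setReg, Nat.forall_lt_succ_right, ← h]
  by_cases hj : s.arr 9 j ≠ 0 ∧ s.arr 10 j = s.reg 12 ∧ s.arr 11 j = s.reg 13
  · rw [if_pos (hc.2 hj)]
    exact iff_of_false (fun h => h rfl) fun h => h.2 hj
  · rw [if_neg (mt hc.1 hj)]
    exact ⟨fun h => ⟨h, hj⟩, fun h => h.1⟩

/-- The code `(x, y)` is adjacent to the marked vertex `u` and not matched. -/
def FreeCode (n : ℕ) (G : ℕ → ℕ → Prop) (s : Store) (u x y : ℕ) : Prop :=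
  Marked n s u ∧ CodeAdj n G x y u ∧ ∀ v ∈ matched n s, matchOf n s v ≠ decode n x y

/-- Put the code in registers `12` and `13`, together with the vertex in register `11`, into
registers `15`, `16`, `17` if it is adjacent to the vertex, which is marked, and not matched. -/
def recordFree : Prog :=
  whenAll (.cell 4 (.reg 11) :: codeAdjE (.reg 12) (.reg 13) (.reg 11)) (block [testFree,
    whenAll [.reg 4] (block [.setReg 14 (.lit 1), .setReg 15 (.reg 11), .setReg 16 (.reg 12),
      .setReg 17 (.reg 13)])])

/-- Find an unmatched code that is adjacent to a marked vertex; register `14` tells whether there is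
one. -/
def findFree : Prog :=
  block [.setReg 14 (.lit 0), .rep 0 11 (.rep 0 12 (.rep 1 13 recordFree))]

theorem run_recordFree (hs : Ctx n G s) (h11 : s.reg 11 < n) (h12 : s.reg 12 < n)
    (h13 : s.reg 13 ≤ n) :
    (FreeCode n G s (s.reg 11) (s.reg 12) (s.reg 13) ∧ (recordFree.run n s).reg 14 = 1 ∧
      (recordFree.run n s).reg 15 = s.reg 11 ∧ (recordFree.run n s).reg 16 = s.reg 12 ∧
      (recordFree.run n s).reg 17 = s.reg 13) ∨
    (¬ FreeCode n G s (s.reg 11) (s.reg 12) (s.reg 13) ∧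
      (recordFree.run n s).reg 14 = s.reg 14 ∧
      (recordFree.run n s).reg 15 = s.reg 15 ∧ (recordFree.run n s).reg 16 = s.reg 16 ∧
      (recordFree.run n s).reg 17 = s.reg 17) := by
  have hc : (∀ e ∈ (.cell 4 (.reg 11) :: codeAdjE (.reg 12) (.reg 13) (.reg 11) : List Expr),
      e.eval s ≠ 0) ↔ Marked n s (s.reg 11) ∧ CodeAdj n G (s.reg 12) (s.reg 13) (s.reg 11) := by
    rw [List.forall_mem_cons, eval_codeAdjE hs (x := .reg 12) (y := .reg 13) (v := .reg 11)
      h12 h13 h11]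
    simp [Marked, h11]
  rw [recordFree, run_whenAll]
  by_cases h : Marked n s (s.reg 11) ∧ CodeAdj n G (s.reg 12) (s.reg 13) (s.reg 11)
  swap
  · rw [if_neg (mt hc.1 h)]
    exact Or.inr ⟨fun h' => h ⟨h'.1, h'.2.1⟩, rfl, rfl, rfl, rfl⟩
  rw [if_pos (hc.2 h)]
  simp only [run_block_cons, run_block_nil]
  have hfree := run_testFree (n := n) (s := s)
  have hiff : FreeCode n G s (s.reg 11) (s.reg 12) (s.reg 13) ↔ (testFree.run n s).reg 4 ≠ 0 := by
    rw [hfree, FreeCode, and_iff_right h.1, and_iff_right h.2]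
    constructor
    · exact fun h v hv hv' => h v ⟨hv, hv'.1⟩ (decode_inj.2 hv'.2)
    · exact fun h v hv e => h v hv.1 ⟨hv.2, decode_inj.1 e⟩
  have k11 : (testFree.run n s).reg 11 = s.reg 11 := run_reg rfl
  have k12 : (testFree.run n s).reg 12 = s.reg 12 := run_reg rfl
  have k13 : (testFree.run n s).reg 13 = s.reg 13 := run_reg rfl
  have k14 : (testFree.run n s).reg 14 = s.reg 14 := run_reg rfl
  have k15 : (testFree.run n s).reg 15 = s.reg 15 := run_reg rfl
  have k16 : (testFree.run n s).reg 16 = s.reg 16 := run_reg rfl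
  have k17 : (testFree.run n s).reg 17 = s.reg 17 := run_reg rfl
  rw [hiff, run_whenAll]
  by_cases h4 : (testFree.run n s).reg 4 = 0
  · rw [if_neg (by simp [h4])]
    exact Or.inr ⟨fun h => h h4, k14, k15, k16, k17⟩
  · rw [if_pos (by simp [h4])]
    exact Or.inl ⟨h4, by simp, by simp [k11], by simp [k12], by simp [k13]⟩

theorem run_findFree (hG : ∀ u v, G u v → u < n ∧ v < n) (hs : Ctx n G s) :
    ((findFree.run n s).reg 14 = 0 → ∀ u x y, ¬ FreeCode n G s u x y) ∧
    ((findFree.run n s).reg 14 ≠ 0 → FreeCode n G s ((findFree.run n s).reg 15)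
      ((findFree.run n s).reg 16) ((findFree.run n s).reg 17)) := by
  -- `found t P` says that a free code has been recorded or there is none that satisfies `P`
  set found : Store → (ℕ → ℕ → ℕ → Prop) → Prop := fun t P =>
    (t.reg 14 = 0 → ∀ u x y, P u x y → ¬ FreeCode n G s u x y) ∧
    (t.reg 14 ≠ 0 → FreeCode n G s (t.reg 15) (t.reg 16) (t.reg 17)) with hfound
  have hsame : ∀ t : Store, t.arr 4 = s.arr 4 → t.arr 9 = s.arr 9 → t.arr 10 = s.arr 10 →
      t.arr 11 = s.arr 11 → ∀ u x y, FreeCode n G t u x y ↔ FreeCode n G s u x y := by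
    intro t h4 h9 h10 h11 u x y
    simp only [FreeCode, Marked, matched, matchOf, h4, h9, h10, h11]
  have h3 : ∀ t, t.reg 3 = s.reg 3 → (∀ a, t.arr a = s.arr a) → t.reg 11 < n → t.reg 12 < n →
      ∀ P, found t P → found ((rep 1 13 recordFree).run n t)
        fun u x y => P u x y ∨ (u = t.reg 11 ∧ x = t.reg 12 ∧ y < n + 1) := by
    intro t₀ h3 ha h11 h12 P hP
    refine run_rep (n := n) (b := 1) (i := 13) (c := recordFree) (s := t₀)
      (fun j t => found t fun u x y => P u x y ∨ (u = t₀.reg 11 ∧ x = t₀.reg 12 ∧ y < j))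
      (by simpa [hfound] using hP) ?_
    rintro j hj t ht13 hreg harr ht
    have k11 : t.reg 11 = t₀.reg 11 := hreg 11 (by decide) rfl
    have k12 : t.reg 12 = t₀.reg 12 := hreg 12 (by decide) rfl
    have hctx : Ctx n G t := hs.congr ((hreg 3 (by decide) rfl).trans h3)
      ((harr 0 rfl).trans (ha 0)) ((harr 3 rfl).trans (ha 3))
    have hfc := hsame t ((harr 4 rfl).trans (ha 4)) ((harr 9 rfl).trans (ha 9))
      ((harr 10 rfl).trans (ha 10)) ((harr 11 rfl).trans (ha 11))
    have hrec := run_recordFree hctx (by omega) (by omega) (by omega)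
    rw [hfc, k11, k12, ht13] at hrec
    simp only [hfound, Store.setReg_reg, Nat.reduceEqDiff, if_false]
    rcases hrec with ⟨r1, r14, r15, r16, r17⟩ | ⟨r1, r14, r15, r16, r17⟩ <;>
      rw [r14, r15, r16, r17]
    · exact ⟨fun h => absurd h one_ne_zero, fun _ => r1⟩
    · refine ⟨fun h u x y hp => ?_, ht.2⟩
      rcases hp with hp | ⟨rfl, rfl, hy⟩
      · exact ht.1 h u x y (Or.inl hp)
      · rcases Nat.lt_succ_iff_lt_or_eq.1 hy with hy | rfl
        · exact ht.1 h _ _ _ (Or.inr ⟨rfl, rfl, hy⟩)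
        · exact r1
  have h2 : ∀ t, t.reg 3 = s.reg 3 → (∀ a, t.arr a = s.arr a) → t.reg 11 < n →
      ∀ P, found t P → found ((rep 0 12 (rep 1 13 recordFree)).run n t)
        fun u x y => P u x y ∨ (u = t.reg 11 ∧ x < n ∧ y < n + 1) := by
    intro t₀ h3' ha h11 P hP
    refine run_rep (n := n) (b := 0) (i := 12) (c := rep 1 13 recordFree) (s := t₀)
      (fun j t => found t fun u x y => P u x y ∨ (u = t₀.reg 11 ∧ x < j ∧ y < n + 1))
      (by simpa [hfound] using hP) ?_
    rintro j hj t ht12 hreg harr ht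
    have k11 : t.reg 11 = t₀.reg 11 := hreg 11 (by decide) rfl
    have := h3 t ((hreg 3 (by decide) rfl).trans h3') (fun a => (harr a rfl).trans (ha a))
      (by omega) (by omega) _ ht
    rw [k11, ht12] at this
    refine ⟨fun h u x y hp => this.1 h u x y ?_, this.2⟩
    rcases hp with hp | ⟨rfl, hx, hy⟩
    · exact Or.inl (Or.inl hp)
    · rcases Nat.lt_succ_iff_lt_or_eq.1 hx with hx | rfl
      · exact Or.inl (Or.inr ⟨rfl, hx, hy⟩)
      · exact Or.inr ⟨rfl, rfl, hy⟩
  have h1 : found (findFree.run n s) fun u x y => u < n ∧ x < n ∧ y < n + 1 := by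
    refine run_rep (n := n) (b := 0) (i := 11) (c := rep 0 12 (rep 1 13 recordFree))
      (s := s.setReg 14 0)
      (fun j t => found t fun u x y => u < j ∧ x < n ∧ y < n + 1) (by simp [hfound]) ?_
    rintro j hj t ht11 hreg harr ht
    have := h2 t (hreg 3 (by decide) rfl) (fun a => harr a rfl) (by omega) _ ht
    rw [ht11] at this
    refine ⟨fun h u x y hp => this.1 h u x y ?_, this.2⟩
    obtain ⟨hu, hx, hy⟩ := hp
    rcases Nat.lt_succ_iff_lt_or_eq.1 hu with hu | rfl
    · exact Or.inl ⟨hu, hx, hy⟩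
    · exact Or.inr ⟨rfl, hx, hy⟩
  refine ⟨fun h u x y hf => h1.1 h u x y ⟨hf.1.1, (hG _ _ hf.2.1.1).1, ?_⟩ hf, h1.2⟩
  rcases hf.2.1.2 with h | h
  · omega
  · have := (hG _ _ h).2
    omega

/-! ### The reduction -/

/-- Try to match the vertex in register `10` if it is a spare leaf. -/
def matchStep : Prog :=
  whenAll [.cell 7 (.reg 10)] (block [.setReg 9 (.reg 10), search altTests, findFree,
    whenAll [.reg 14] augment])

/-- Compute a matching of spare leaves; those that cannot be matched are given up. -/
def matching : Prog := block [clear 9, .rep 0 10 matchStep]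

/-- The vertices that have not been given up when the spare leaves below `w` have been treated. -/
def alive (n : ℕ) (W : Set ℕ) (w : ℕ) (t : Store) : Set ℕ :=
  {v | v < n ∧ ¬ (v ∈ W ∧ v < w ∧ t.arr 9 v = 0)}

/-- After the spare leaves below `w` have been treated: the matching consists of such vertices, and
the vertices given up are not needed. -/
structure MatchInv (n : ℕ) (G : ℕ → ℕ → Prop) (W : Set ℕ) (w : ℕ) (t : Store) : Prop where
  sub : ∀ v ∈ matched n t, v ∈ W ∧ v < w
  matches_ : Matches G (matched n t) (matchOf n t)
  hasArb : ∀ k, HasArb G (Set.Iio n) k ↔ HasArb G (alive n W w t) k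

theorem MatchInv.congr {w : ℕ} (h : MatchInv n G W w s) (h9 : t.arr 9 = s.arr 9)
    (h10 : t.arr 10 = s.arr 10) (h11 : t.arr 11 = s.arr 11) : MatchInv n G W w t := by
  have hM : matched n t = matched n s := by simp [matched, h9]
  have hm : matchOf n t = matchOf n s := by
    funext v
    simp [matchOf, h10, h11]
  refine ⟨by rw [hM]; exact h.sub, by rw [hM, hm]; exact h.matches_, fun k => ?_⟩
  rw [h.hasArb]
  simp [alive, h9]

/-- If there is an unmatched code next to a marked vertex, the matching is augmented; otherwise the
marked vertices are saturated by the matching, and `w` is not needed. -/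
theorem run_matchStep (hG : ∀ u v, G u v → u < n ∧ v < n)
    (hcov : ∀ u v, G u v → ¬ (u ∈ W ∧ v ∈ W)) (hin : ∀ v ∈ W, ∃ u, G u v) (hs : Ctx n G s)
    (h7 : ∀ v < n, s.arr 7 v ≠ 0 ↔ v ∈ W) {w : ℕ} (h10 : s.reg 10 = w) (hw : w < n)
    (h : MatchInv n G W w s) : MatchInv n G W (w + 1) (matchStep.run n s) := by
  rw [matchStep, run_whenAll]
  by_cases hwW : w ∈ W
  swap
  · rw [if_neg (by simpa [h10] using fun e => hwW ((h7 w hw).1 e))]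
    refine ⟨fun v hv => ⟨(h.sub v hv).1, (h.sub v hv).2.trans (Nat.lt_succ_self w)⟩, h.matches_,
      fun k => ?_⟩
    rw [h.hasArb]
    have : alive n W (w + 1) s = alive n W w s := by
      ext v
      simp only [alive, Set.mem_ofPred_eq]
      refine and_congr_right fun _ =>
        not_congr (and_congr_right fun hv => and_congr_left fun _ => ?_)
      have : v ≠ w := fun e => hwW (e ▸ hv)
      omega
    rw [this]
  rw [if_pos (by simpa [h10] using (h7 w hw).2 hwW)]
  simp only [run_block_cons, run_block_nil, run_setReg, eval_reg, h10]
  set s₁ := s.setReg 9 w with hs₁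
  have hctx₁ : Ctx n G s₁ := hs.congr (by simp [hs₁]) rfl rfl
  have h₁ : MatchInv n G W w s₁ := h.congr rfl rfl rfl
  have hwM : w ∉ matched n s₁ := fun h => (h₁.sub w h).2.false
  obtain ⟨hf, hT, hcl⟩ := run_search (s := s₁) (r := w) (tests := altTests) (E := AltStep n G s₁)
    (by simp [hs₁]) hw fun t ht h6 h7 => eval_altTests hG hctx₁ h₁.matches_ ht h6 h7
  set s₂ := (search altTests).run n s₁ with hs₂
  have e9 : s₂.arr 9 = s₁.arr 9 := hf.arr 9 (by decide) (by decide)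
  have e10 : s₂.arr 10 = s₁.arr 10 := hf.arr 10 (by decide) (by decide)
  have e11 : s₂.arr 11 = s₁.arr 11 := hf.arr 11 (by decide) (by decide)
  have hr9 : s₂.reg 9 = w := by
    rw [hf.reg 9 (by decide) (by decide) (by decide)]
    simp [hs₁]
  have hctx₂ : Ctx n G s₂ := hctx₁.congr (hf.reg 3 (by decide) (by decide) (by decide))
    (hf.arr 0 (by decide) (by decide)) (hf.arr 3 (by decide) (by decide))
  have h₂ : MatchInv n G W w s₂ := h₁.congr e9 e10 e11
  have hMeq : matched n s₂ = matched n s₁ := by simp [matched, e9]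
  rw [← hMeq] at hwM
  have halt : AltStep n G s₁ = AltStep n G s₂ := by
    funext u v
    simp only [AltStep, hMeq, e10, e11]
  rw [halt] at hT hcl
  clear_value s₂
  obtain ⟨hno, hyes⟩ := run_findFree hG hctx₂
  have f9 : (findFree.run n s₂).reg 9 = w := (run_reg rfl).trans hr9
  have fa : ∀ a, (findFree.run n s₂).arr a = s₂.arr a := fun a => run_arr rfl
  set s₃ := findFree.run n s₂ with hs₃
  clear_value s₃
  have h₃ : MatchInv n G W w s₃ := h₂.congr (fa 9) (fa 10) (fa 11)
  have hM₃ : matched n s₃ = matched n s₂ := by simp [matched, fa]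
  have hm₃ : matchOf n s₃ = matchOf n s₂ := by
    funext v
    simp [matchOf, fa]
  rw [run_whenAll]
  by_cases h14 : s₃.reg 14 = 0
  · -- the marked set shows that `w` can be removed
    rw [if_neg (by simp [h14])]
    have hno' := hno h14
    refine ⟨fun v hv => ⟨(h₃.sub v hv).1, (h₃.sub v hv).2.trans (Nat.lt_succ_self w)⟩, h₃.matches_,
      fun k => ?_⟩
    rw [h₃.hasArb]
    have hal : alive n W (w + 1) s₃ = alive n W w s₃ \ {w} := by
      have : s₃.arr 9 w = 0 := by
        by_contra h0
        exact hwM (hM₃ ▸ (⟨hw, h0⟩ : w ∈ matched n s₃))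
      ext v
      simp only [alive, Set.mem_ofPred_eq, Set.mem_sdiff, Set.mem_singleton_iff]
      by_cases hvw : v = w
      · subst hvw
        simp [hwW, this]
      · have : v < w + 1 ↔ v < w := by omega
        simp [hvw, this]
    rw [hal]
    have hfin : (alive n W w s₃).Finite := (Set.finite_Iio n).subset fun v hv => hv.1
    have hUA : Set.Iio n \ W ⊆ alive n W w s₃ := fun v hv => ⟨hv.1, fun h => hv.2 h.1⟩
    have hcov' : ∀ u v, G u v → u ∈ Set.Iio n \ W ∨ v ∈ Set.Iio n \ W := by
      intro u v huv
      by_cases hu : u ∈ W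
      · exact Or.inr ⟨(hG u v huv).2, fun hv => hcov u v huv ⟨hu, hv⟩⟩
      · exact Or.inl ⟨(hG u v huv).1, hu⟩
    have hwA : w ∈ alive n W w s₃ := ⟨hw, fun h => h.2.1.false⟩
    refine ⟨fun hk => ?_, fun hk => hk.of_diff_singleton hfin hUA hwA (fun h => h.2 hwW) hcov'
      (hin w hwW)⟩
    have hR : ∀ v, Marked n s₂ v → v ≠ w → v ∈ matched n s₂ := by
      intro v hv hvw
      obtain ⟨-, d, hd⟩ := hT
      exact (hd v hv hvw).2.1.1
    have hRW : ∀ v, Marked n s₂ v → v ∈ W := by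
      intro v hv
      by_cases hvw : v = w
      · rwa [hvw]
      · exact (h₂.sub v (hR v hv hvw)).1
    have hcode : ∀ v x y, Marked n s₂ v → CodeAdj n G x y v →
        ∃ v' ∈ {v | Marked n s₂ v} \ {w}, matchOf n s₂ v' = decode n x y := by
      intro v x y hv hxy
      have := hno' v x y
      simp only [FreeCode, hv, hxy, true_and, not_forall, not_not] at this
      obtain ⟨v', hv', e⟩ := this
      have e' := decode_inj.1 e
      refine ⟨v', ⟨hcl v hv v' hv'.1 ⟨hv', ?_⟩, fun h => hwM (Set.mem_singleton_iff.1 h ▸ hv')⟩, e⟩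
      rwa [e'.1, e'.2]
    refine hk.diff_singleton (U := Set.Iio n \ W) (R := {v | Marked n s₂ v}) (m := matchOf n s₂)
      hfin hUA hcov' ?_ ?_ hT.1 (fun v hv => hin v (hRW v hv)) (h₂.matches_.mono ?_) ?_
    · intro v hv
      refine ⟨hv.1, fun h => ?_⟩
      have := hR v hv h.2.1.ne
      rw [← hM₃] at this
      exact this.2 h.2.2
    · exact Set.disjoint_left.2 fun v hv hv' => hv'.2 (hRW v hv)
    · exact fun v hv => hR v hv.1 hv.2
    · intro v hv x hx
      refine ⟨?_, fun y hy => ?_⟩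
      · simpa [decode] using hcode v x n hv ⟨hx, Or.inl rfl⟩
      · have : y ≠ n := (hG v y hy).2.ne
        simpa [decode, this] using hcode v x y hv ⟨hx, Or.inr hy⟩
  · rw [if_pos (by simp [h14])]
    obtain ⟨g1, g2, g3⟩ := hyes h14
    have hAlt : AltStep n G s₂ = AltStep n G s₃ := by
      funext u v
      simp only [AltStep, hM₃, fa]
    have hT₃ : SearchTree n (AltStep n G s₃) w s₃ := by
      rw [← hAlt]
      simpa only [SearchTree, Marked, fa] using hT
    obtain ⟨k1, k2⟩ := run_augment f9 h₃.matches_ hT₃ (by simpa only [Marked, fa] using g1) g2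
      (by rw [hM₃, hm₃]; exact g3)
    refine ⟨fun v hv => ?_, by rwa [k1], fun k => ?_⟩
    · rw [k1] at hv
      rcases hv with rfl | hv
      · exact ⟨hwW, Nat.lt_succ_self _⟩
      · exact ⟨(h₃.sub v hv).1, (h₃.sub v hv).2.trans (Nat.lt_succ_self w)⟩
    · rw [h₃.hasArb]
      have : alive n W (w + 1) (augment.run n s₃) = alive n W w s₃ := by
        ext v
        simp only [alive, Set.mem_ofPred_eq]
        refine and_congr_right fun hv => not_congr (and_congr_right fun _ => ?_)
        have h9 : (augment.run n s₃).arr 9 v = 0 ↔ v ≠ w ∧ s₃.arr 9 v = 0 := by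
          have : v ∈ matched n (augment.run n s₃) ↔ v = w ∨ v ∈ matched n s₃ := by rw [k1]; rfl
          simp only [matched, Set.mem_ofPred_eq, hv, true_and] at this
          rw [← not_iff_not, ← ne_eq (Store.arr _ _ _), this]
          tauto
        rw [h9]
        constructor
        · exact fun h => ⟨by omega, h.2.2⟩
        · exact fun h => ⟨by omega, by omega, h.2⟩
      rw [this]

theorem run_matching (hG : ∀ u v, G u v → u < n ∧ v < n)
    (hcov : ∀ u v, G u v → ¬ (u ∈ W ∧ v ∈ W)) (hin : ∀ v ∈ W, ∃ u, G u v) (hs : Ctx n G s)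
    (h7 : ∀ v < n, s.arr 7 v ≠ 0 ↔ v ∈ W) : MatchInv n G W n (matching.run n s) := by
  have hclear : ∀ v < n, ((clear 9).run n s).arr 9 v = 0 := run_clear
  refine run_rep (n := n) (b := 0) (i := 10) (c := matchStep) (s := (clear 9).run n s)
    (fun w t => MatchInv n G W w t) ?_ ?_
  · have hM : matched n ((clear 9).run n s) = ∅ := by
      ext v
      simp only [matched, Set.mem_ofPred_eq, Set.mem_empty_iff_false, iff_false, not_and, not_not]
      exact hclear v
    have : MatchInv n G W 0 ((clear 9).run n s) := by
      refine ⟨by simp [hM], by rw [hM]; exact ⟨by simp, by simp, by simp⟩, fun k => ?_⟩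
      have : alive n W 0 ((clear 9).run n s) = Set.Iio n := by
        ext v
        simp [alive]
      rw [this]
    exact this.congr rfl rfl rfl
  · rintro w hw t ht10 hreg harr h
    have hctx : Ctx n G t := hs.congr ((hreg 3 (by decide) rfl).trans (run_reg rfl))
      ((harr 0 rfl).trans (run_arr rfl)) ((harr 3 rfl).trans (run_arr rfl))
    have h7' : t.arr 7 = s.arr 7 := (harr 7 rfl).trans (run_arr rfl)
    exact (run_matchStep hG hcov hin hctx (by rwa [h7']) ht10 (by omega) h).congr rfl rfl rfl

end Matching

section Output

open Prog

variable {n : ℕ} {G : ℕ → ℕ → Prop} {s t : Store} {W : Set ℕ}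

/-! ### Writing the output -/

theorem mul_add_inj {m u v u' v' : ℕ} (hv : v < m) (hv' : v' < m) :
    u * m + v = u' * m + v' ↔ u = u' ∧ v = v' := by
  refine ⟨fun h => ?_, fun h => by rw [h.1, h.2]⟩
  have h1 := congrArg (· % m) h
  simp only [Nat.mul_add_mod_self_right, Nat.mod_eq_of_lt hv, Nat.mod_eq_of_lt hv'] at h1
  subst h1
  exact ⟨Nat.eq_of_mul_eq_mul_right (by omega) (Nat.add_right_cancel h), rfl⟩

/-- For all `u` (register `6`) and `v` (register `7`) that pass the tests `es`, write the value of
`e` to the entry `(u, v)` of the matrix in array `a`, whose row offsets are in array `b`. The tests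
select the entries of a matrix with fewer than `n` rows. -/
def fill (a b : ℕ) (es : List Expr) (e : Expr) : Prog :=
  .rep 0 6 (.rep 0 7 (whenAll es (.setCell a (.add (.cell b (.reg 6)) (.reg 7)) e)))

theorem run_fill {a b m : ℕ} {es : List Expr} {e : Expr} {f : ℕ → ℕ → ℕ} (hab : b ≠ a)
    (hb : ∀ u < m, s.arr b u = u * m) (hm : m ≤ n)
    (he : ∀ t, (∀ i, i ≠ 6 → i ≠ 7 → t.reg i = s.reg i) → (∀ c, c ≠ a → t.arr c = s.arr c) →
      t.reg 6 < n → t.reg 7 < n → ((∀ e ∈ es, e.eval t ≠ 0) ↔ t.reg 6 < m ∧ t.reg 7 < m) ∧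
        (t.reg 6 < m → t.reg 7 < m → e.eval t = f (t.reg 6) (t.reg 7))) :
    ∀ u < m, ∀ v < m, ((fill a b es e).run n s).arr a (u * m + v) = f u v := by
  set c : Prog := whenAll es (.setCell a (.add (.cell b (.reg 6)) (.reg 7)) e) with hc
  have hcr : ∀ i, c.WritesReg i = false := fun i => by simp [hc, whenAll_writesReg, WritesReg]
  have hca : ∀ d, d ≠ a → c.WritesArr d = false := fun d hd => by
    simp [hc, whenAll_writesArr, WritesArr, hd]
  have hinner : ∀ t, (∀ i, i ≠ 6 → i ≠ 7 → t.reg i = s.reg i) → (∀ c, c ≠ a → t.arr c = s.arr c) →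
      t.reg 6 < n → (∀ u < t.reg 6, u < m → ∀ v < m, t.arr a (u * m + v) = f u v) →
      ∀ u < t.reg 6 + 1, u < m → ∀ v < m, ((rep 0 7 c).run n t).arr a (u * m + v) = f u v := by
    intro t₀ hreg₀ harr₀ h6 h₀
    have := run_rep (n := n) (b := 0) (i := 7) (c := c) (s := t₀)
      (fun j t => ∀ u v, u < m → v < m → u < t₀.reg 6 ∨ (u = t₀.reg 6 ∧ v < j) →
        t.arr a (u * m + v) = f u v) (by
          intro u v hu hv h
          rcases h with h | h
          · exact h₀ u h hu v hv
          · omega) ?_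
    · intro u hu hum v hv
      rcases Nat.lt_succ_iff_lt_or_eq.1 hu with hu | hu
      · exact this u v hum hv (Or.inl hu)
      · exact this u v hum hv (Or.inr ⟨hu, by omega⟩)
    · rintro j hj t ht7 hreg harr ht u v hu hv huv
      have k6 : t.reg 6 = t₀.reg 6 := hreg 6 (by decide) (hcr 6)
      have kb : t.arr b = s.arr b := (harr b (hca b hab)).trans (harr₀ b hab)
      obtain ⟨he1, he2⟩ := he t (fun i hi6 hi7 => (hreg i hi7 (hcr i)).trans (hreg₀ i hi6 hi7))
        (fun d hd => (harr d (hca d hd)).trans (harr₀ d hd)) (by omega) (by omega)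
      rw [Store.setReg_arr, hc, run_whenAll]
      by_cases hlt : t.reg 6 < m ∧ t.reg 7 < m
      · rw [if_pos (he1.2 hlt)]
        simp only [run_setCell, eval_add, eval_cell, eval_reg, Store.setCell_arr, if_true,
          Function.update_apply, kb, hb _ hlt.1, he2 hlt.1 hlt.2, mul_add_inj hv hlt.2]
        split_ifs with h
        · rw [h.1, h.2]
        · exact ht u v hu hv (by omega)
      · rw [if_neg (mt he1.1 hlt)]
        exact ht u v hu hv (by omega)
  have := run_rep (n := n) (b := 0) (i := 6) (c := rep 0 7 c) (s := s)
    (fun j t => ∀ u < j, u < m → ∀ v < m, t.arr a (u * m + v) = f u v) (by simp) ?_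
  · exact fun u hu => this u (by omega) hu
  · rintro j hj t ht6 hreg harr ht
    have := hinner t (fun i h6 h7 => hreg i h6 (by simp [WritesReg, h7, hcr]))
      (fun d hd => harr d (hca d hd)) (by omega) (by rwa [ht6])
    rwa [ht6] at this

/-- Nonzero unless the vertex in register `6` is an unmatched spare leaf. -/
def aliveE : Expr := .add (notE (.cell 7 (.reg 6))) (.cell 9 (.reg 6))

/-- List the remaining vertices in array `12` and their number in register `4`. -/
def listAlive : Prog :=
  block [.setReg 4 (.lit 0), .rep 0 6 (whenAll [aliveE] (block
    [.setCell 12 (.reg 4) (.reg 6), .setReg 4 (.add (.reg 4) (.lit 1))]))]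

theorem run_listAlive (h7 : ∀ v < n, s.arr 7 v ≠ 0 ↔ v ∈ W) :
    Set.InjOn ((listAlive.run n s).arr 12) (Set.Iio ((listAlive.run n s).reg 4)) ∧
    (listAlive.run n s).arr 12 '' Set.Iio ((listAlive.run n s).reg 4) = alive n W n s ∧
    (listAlive.run n s).reg 4 ≤ n := by
  set A : Set ℕ := alive n W n s with hA
  have key := run_rep (n := n) (b := 0) (i := 6) (s := s.setReg 4 0) (c := whenAll [aliveE] (block
    [.setCell 12 (.reg 4) (.reg 6), .setReg 4 (.add (.reg 4) (.lit 1))]))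
    (fun j t => Set.InjOn (t.arr 12) (Set.Iio (t.reg 4)) ∧
      t.arr 12 '' Set.Iio (t.reg 4) = {v | v ∈ A ∧ v < j} ∧ t.reg 4 ≤ j) (by simp) ?_
  · obtain ⟨h1, h2, h3⟩ := key
    refine ⟨h1, h2.trans ?_, h3⟩
    ext v
    exact ⟨fun h => h.1, fun h => ⟨h, h.1⟩⟩
  rintro j hj t ht6 - harr ⟨h1, h2, h3⟩
  have hjA : aliveE.eval t ≠ 0 ↔ j ∈ A := by
    have k7 : t.arr 7 = s.arr 7 := harr 7 rfl
    have k9 : t.arr 9 = s.arr 9 := harr 9 rfl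
    have hjn : j < n := hj
    simp only [aliveE, notE, eval_add, eval_sub, eval_lit, eval_cell, eval_reg, ht6, k7, k9, hA,
      alive, Set.mem_ofPred_eq, hjn, true_and, ← h7 j hj]
    omega
  rw [run_whenAll]
  by_cases hj' : j ∈ A
  · rw [if_pos (by simpa using hjA.2 hj')]
    simp only [run_block_cons, run_block_nil, run_setCell, run_setReg, eval_reg, eval_add, eval_lit,
      Store.setReg_reg, Store.setReg_arr, Store.setCell_reg, Store.setCell_arr, if_true, ht6,
      Nat.reduceEqDiff, if_false]
    have himg : ∀ i < t.reg 4, Function.update (t.arr 12) (t.reg 4) j i = t.arr 12 i := fun i hi =>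
      Function.update_of_ne hi.ne _ _
    have hlt : ∀ i < t.reg 4, t.arr 12 i < j := by
      intro i hi
      have : t.arr 12 i ∈ {v | v ∈ A ∧ v < j} := h2 ▸ ⟨i, hi, rfl⟩
      exact this.2
    refine ⟨?_, ?_, by omega⟩
    · intro i hi i' hi' h
      rcases Nat.lt_succ_iff_lt_or_eq.1 hi with hi | rfl <;>
        rcases Nat.lt_succ_iff_lt_or_eq.1 hi' with hi' | rfl
      · rw [himg i hi, himg i' hi'] at h
        exact h1 hi hi' h
      · rw [himg i hi, Function.update_self] at h
        exact absurd h (hlt i hi).ne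
      · rw [himg i' hi', Function.update_self] at h
        exact absurd h.symm (hlt i' hi').ne
      · rfl
    · ext v
      constructor
      · rintro ⟨i, hi, rfl⟩
        rcases Nat.lt_succ_iff_lt_or_eq.1 hi with hi | rfl
        · beta_reduce
          rw [himg i hi]
          have : t.arr 12 i ∈ {v | v ∈ A ∧ v < j} := h2 ▸ ⟨i, hi, rfl⟩
          exact ⟨this.1, this.2.trans (Nat.lt_succ_self j)⟩
        · beta_reduce
          rw [Function.update_self]
          exact ⟨hj', Nat.lt_succ_self j⟩
      · rintro ⟨hv, hvj⟩
        rcases Nat.lt_succ_iff_lt_or_eq.1 hvj with hvj | rfl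
        · have : v ∈ t.arr 12 '' Set.Iio (t.reg 4) := h2 ▸ ⟨hv, hvj⟩
          obtain ⟨i, hi, rfl⟩ := this
          exact ⟨i, Nat.lt_succ_of_lt hi, himg i hi⟩
        · exact ⟨t.reg 4, Nat.lt_succ_self _, Function.update_self _ _ _⟩
  · rw [if_neg (by simpa using mt hjA.1 hj')]
    refine ⟨h1, h2.trans ?_, h3.trans (Nat.le_succ j)⟩
    ext v
    refine and_congr_right fun hv => ?_
    have : v ≠ j := fun e => hj' (e ▸ hv)
    omega

/-- Write the subdigraph induced by the remaining vertices into array `0`, using array `2` for a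
copy of the adjacency matrix. -/
def outputInduced : Prog :=
  block [listAlive, .setReg 0 (.reg 4),
    fill 2 3 [] (notE (notE (.cell 0 (.add (.cell 3 (.reg 6)) (.reg 7))))), rows 13 0,
    fill 0 13 [.sub (.reg 0) (.reg 6), .sub (.reg 0) (.reg 7)]
      (.cell 2 (.add (.cell 3 (.cell 12 (.reg 6))) (.cell 12 (.reg 7)))), .setReg 2 (.lit 0)]

theorem run_outputInduced (hs : Ctx n G s) (h7 : ∀ v < n, s.arr 7 v ≠ 0 ↔ v ∈ W) :
    ∃ (n' : ℕ) (sel : ℕ → ℕ), (outputInduced.run n s).reg 0 = n' ∧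
      (outputInduced.run n s).reg 2 = 0 ∧ Set.InjOn sel (Set.Iio n') ∧
      sel '' Set.Iio n' = alive n W n s ∧
      ∀ u < n', ∀ v < n', (outputInduced.run n s).arr 0 (u * n' + v) =
        open Classical in if G (sel u) (sel v) then 1 else 0 := by
  classical
  obtain ⟨h1, h2, h3⟩ := run_listAlive h7
  set s₁ := listAlive.run n s with hs₁
  have hctx : Ctx n G s₁ := hs.congr (run_reg rfl) (run_arr rfl) (run_arr rfl)
  have hrun : outputInduced.run n s = ((fill 0 13 [.sub (.reg 0) (.reg 6), .sub (.reg 0) (.reg 7)]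
      (.cell 2 (.add (.cell 3 (.cell 12 (.reg 6))) (.cell 12 (.reg 7))))).run n
      ((rows 13 0).run n ((fill 2 3 [] (notE (notE (.cell 0 (.add (.cell 3 (.reg 6))
        (.reg 7)))))).run n (s₁.setReg 0 (s₁.reg 4))))).setReg 2 0 := rfl
  rw [hrun]
  clear hrun
  clear_value s₁
  set n' := s₁.reg 4 with hn'
  set sel := s₁.arr 12 with hsel
  set s₂ := s₁.setReg 0 n' with hs₂
  have hctx₂ : Ctx n G s₂ := hctx.congr (by simp [hs₂]) rfl rfl
  set e : Expr := notE (notE (.cell 0 (.add (.cell 3 (.reg 6)) (.reg 7)))) with he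
  have hcopy := run_fill (n := n) (s := s₂) (a := 2) (b := 3) (m := n) (es := []) (e := e)
    (f := fun u v => if G u v then 1 else 0) (by decide) hctx₂.row le_rfl ?_
  swap
  · rintro t hreg harr h6 h7
    refine ⟨by simp [h6, h7], fun _ _ => ?_⟩
    have hctx' : Ctx n G t := hctx₂.congr (hreg 3 (by decide) (by decide)) (harr 0 (by decide))
      (harr 3 (by decide))
    have := hctx'.eval_arcE (e := .reg 6) (f := .reg 7) h6 h7
    simp only [eval_reg, arcE] at this
    simp only [← this, he, notE, eval_sub, eval_lit]
    split_ifs with h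
    · omega
    · rw [not_not] at h
      omega
  set s₃ := (fill 2 3 [] e).run n s₂ with hs₃
  have r30 : s₃.reg 0 = n' := (run_reg rfl : s₃.reg 0 = s₂.reg 0).trans (by simp [hs₂])
  have a12 : s₃.arr 12 = sel := run_arr rfl
  have a3 : s₃.arr 3 = s₁.arr 3 := run_arr rfl
  clear_value s₃
  have hrows := run_rows (n := n) (s := s₃) (a := 13) (l := 0) (by decide) (by decide)
  set s₄ := (rows 13 0).run n s₃ with hs₄
  have r40 : s₄.reg 0 = n' := (run_reg rfl : s₄.reg 0 = s₃.reg 0).trans r30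
  have b12 : s₄.arr 12 = sel := (run_arr rfl : s₄.arr 12 = s₃.arr 12).trans a12
  have b3 : s₄.arr 3 = s₁.arr 3 := (run_arr rfl : s₄.arr 3 = s₃.arr 3).trans a3
  have b2 : s₄.arr 2 = s₃.arr 2 := run_arr rfl
  clear_value s₄
  have hseln : ∀ i < n', sel i < n := by
    intro i hi
    have : sel i ∈ alive n W n s := h2 ▸ ⟨i, hi, rfl⟩
    exact this.1
  have hfill := run_fill (n := n) (s := s₄) (a := 0) (b := 13) (m := n')
    (es := [.sub (.reg 0) (.reg 6), .sub (.reg 0) (.reg 7)])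
    (e := .cell 2 (.add (.cell 3 (.cell 12 (.reg 6))) (.cell 12 (.reg 7))))
    (f := fun u v => if G (sel u) (sel v) then 1 else 0) (by decide)
    (fun u hu => by rw [hrows u (by omega), r30]) h3 ?_
  swap
  · rintro t hreg harr h6 h7
    have k0 : t.reg 0 = n' := (hreg 0 (by decide) (by decide)).trans r40
    refine ⟨by simp [k0, Nat.sub_eq_zero_iff_le], fun h6 h7 => ?_⟩
    have k2 : t.arr 2 = s₃.arr 2 := (harr 2 (by decide)).trans b2
    have k3 : t.arr 3 = s₁.arr 3 := (harr 3 (by decide)).trans b3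
    have k12 : t.arr 12 = sel := (harr 12 (by decide)).trans b12
    simp only [eval_cell, eval_add, eval_reg, k2, k3, k12, hctx.row _ (hseln _ h6)]
    exact hcopy _ (hseln _ h6) _ (hseln _ h7)
  set s₅ := (fill 0 13 [.sub (.reg 0) (.reg 6), .sub (.reg 0) (.reg 7)]
    (.cell 2 (.add (.cell 3 (.cell 12 (.reg 6))) (.cell 12 (.reg 7))))).run n s₄ with hs₅
  have r50 : s₅.reg 0 = n' := (run_reg rfl : s₅.reg 0 = s₄.reg 0).trans r40
  exact ⟨n', sel, by simp [r50], by simp, h1, h2, hfill⟩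

/-- Nonzero if and only if the tree has an arc from register `6` to register `7`. -/
def treeArcE : Expr :=
  notE (.add (notE (eqE (.cell 5 (.reg 7)) (.reg 6))) (eqE (.reg 7) (.reg 5)))

/-- Write the tree into array `1`, and the instance that consists of a single arc and the parameter
`1`. -/
def outputTree : Prog :=
  block [fill 1 3 [] treeArcE, .setCell 0 (.lit 0) (.lit 0), .setCell 0 (.lit 1) (.lit 1),
    .setCell 0 (.lit 2) (.lit 0), .setCell 0 (.lit 3) (.lit 0), .setReg 0 (.lit 2),
    .setReg 1 (.lit 1), .setReg 2 (.lit 1)]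

theorem run_outputTree (hs : Ctx n G s) :
    ((outputTree.run n s).reg 0 = 2 ∧ (outputTree.run n s).reg 1 = 1 ∧
      (outputTree.run n s).reg 2 = 1) ∧
    ((outputTree.run n s).arr 0 0 = 0 ∧ (outputTree.run n s).arr 0 1 = 1 ∧
      (outputTree.run n s).arr 0 2 = 0 ∧ (outputTree.run n s).arr 0 3 = 0) ∧
    ∀ u < n, ∀ v < n, (outputTree.run n s).arr 1 (u * n + v) =
      if v ≠ s.reg 5 ∧ s.arr 5 v = u then 1 else 0 := by
  have hfill := run_fill (n := n) (s := s) (a := 1) (b := 3) (m := n) (es := []) (e := treeArcE)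
    (f := fun u v => if v ≠ s.reg 5 ∧ s.arr 5 v = u then 1 else 0) (by decide) hs.row le_rfl ?_
  · refine ⟨by simp [outputTree], by simp [outputTree], fun u hu v hv => ?_⟩
    rw [← hfill u hu v hv]
    simp [outputTree]
  · rintro t hreg harr h6 h7
    refine ⟨by simp [h6, h7], fun _ _ => ?_⟩
    have k5 : t.reg 5 = s.reg 5 := hreg 5 (by decide) (by decide)
    have a5 : t.arr 5 = s.arr 5 := harr 5 (by decide)
    have h1 := eval_notE (e := .add (notE (eqE (.cell 5 (.reg 7)) (.reg 6)))
      (eqE (.reg 7) (.reg 5))) (s := t)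
    have h2 : treeArcE.eval t ≤ 1 := Nat.sub_le _ _
    have h3 : treeArcE.eval t ≠ 0 ↔ t.reg 7 ≠ s.reg 5 ∧ s.arr 5 (t.reg 7) = t.reg 6 := by
      rw [treeArcE, ne_eq, h1, not_not, eval_add, Nat.add_eq_zero_iff, eval_notE]
      simp [k5, a5, and_comm]
    split_ifs with h
    · have := h3.2 h
      omega
    · by_contra h0
      exact h (h3.1 h0)

/-! ### The kernelization program -/

/-- The kernelization, to be started with `n` in register `3`. After `countInner`, register `4`
holds the number of internal vertices of the tree; the test succeeds if it is less than the
parameter. -/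
def kernelProg : Prog :=
  block [rows 3 3, findTree, moveSpare, markSpare, countInner,
    .ifte (.sub (.reg 1) (.reg 4)) (block [matching, outputInduced]) outputTree]

/-- The vertices that remain are those that are not spare, at most `2 k - 1` in number, and the
matched ones. -/
theorem ncard_alive_le {k r : ℕ} {p : ℕ → ℕ} (hG : ∀ u v, G u v → u < n ∧ v < n)
    (hcov : ∀ u v, G u v → ¬ (u ∈ spare (Set.Iio n) r p ∧ v ∈ spare (Set.Iio n) r p))
    (hk : (inner (Set.Iio n) r p).ncard < k) (h : MatchInv n G (spare (Set.Iio n) r p) n s) :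
    (alive n (spare (Set.Iio n) r p) n s).ncard ≤ 8 * k ^ 2 + 6 * k := by
  classical
  set W := spare (Set.Iio n) r p with hW
  set U : Set ℕ := Set.Iio n \ W with hU
  have hUfin : U.Finite := (Set.finite_Iio n).subset Set.sdiff_subset
  have hUle : U.ncard ≤ 2 * k - 1 :=
    (ncard_diff_spare_le (Set.finite_Iio n)).trans (by omega)
  have hMle : (matched n s).ncard ≤ U.ncard * (U.ncard + 1) := by
    have hfin : (insert none (some '' U) : Set (Option ℕ)).Finite := (hUfin.image _).insert _
    calc (matched n s).ncard ≤ (U ×ˢ (insert none (some '' U) : Set (Option ℕ))).ncard := by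
          refine Set.ncard_le_ncard_of_injOn (matchOf n s) ?_ h.matches_.injOn (hUfin.prod hfin)
          intro v hv
          have hvW := (h.sub v hv).1
          have h1 := h.matches_.adj_fst v hv
          refine ⟨⟨(hG _ _ h1).1, fun hx => hcov _ _ h1 ⟨hx, hvW⟩⟩, ?_⟩
          have h2 := h.matches_.adj_snd v hv
          cases hy : (matchOf n s v).2 with
          | none => exact Or.inl rfl
          | some y =>
            have := h2 y hy
            exact Or.inr ⟨y, ⟨(hG _ _ this).2, fun hy => hcov _ _ this ⟨hvW, hy⟩⟩, rfl⟩
      _ = U.ncard * (insert none (some '' U) : Set (Option ℕ)).ncard := Set.ncard_prod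
      _ ≤ U.ncard * (U.ncard + 1) := by
        gcongr
        refine (Set.ncard_insert_le _ _).trans ?_
        rw [Set.ncard_image_of_injective _ (Option.some_injective _)]
  have hsub : alive n W n s ⊆ U ∪ matched n s := by
    rintro v ⟨hv, h'⟩
    by_cases hvW : v ∈ W
    · exact Or.inr ⟨hv, fun h0 => h' ⟨hvW, hv, h0⟩⟩
    · exact Or.inl ⟨hv, hvW⟩
  have hMfin : (matched n s).Finite := (Set.finite_Iio n).subset fun v hv => hv.1
  have h1 := (Set.ncard_le_ncard hsub (hUfin.union hMfin)).trans (Set.ncard_union_le _ _)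
  obtain ⟨j, rfl⟩ : ∃ j, k = j + 1 := ⟨k - 1, by omega⟩
  have h2 : U.ncard ≤ 2 * j + 1 := by omega
  have h3 : U.ncard * (U.ncard + 1) ≤ (2 * j + 1) * (2 * j + 2) := Nat.mul_le_mul h2 (by omega)
  nlinarith

/-- What the program achieves: either the tree found has at least `k` internal vertices and is
output, or an equivalent induced subdigraph is. -/
theorem run_kernelProg {k : ℕ} (hG : ∀ u v, G u v → u < n ∧ v < n) (hirr : ∀ u, ¬ G u u)
    (harb : HasArb G (Set.Iio n) 0) (h1 : s.reg 1 = k) (h3 : s.reg 3 = n)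
    (hadj : ∀ u < n, ∀ v < n, s.arr 0 (u * n + v) ≠ 0 ↔ G u v) :
    (∃ r p, Arb G (Set.Iio n) r p ∧ k ≤ (inner (Set.Iio n) r p).ncard ∧
      ((kernelProg.run n s).reg 0 = 2 ∧ (kernelProg.run n s).reg 1 = 1 ∧
        (kernelProg.run n s).reg 2 = 1) ∧
      ((kernelProg.run n s).arr 0 0 = 0 ∧ (kernelProg.run n s).arr 0 1 = 1 ∧
        (kernelProg.run n s).arr 0 2 = 0 ∧ (kernelProg.run n s).arr 0 3 = 0) ∧
      ∀ u < n, ∀ v < n, (kernelProg.run n s).arr 1 (u * n + v) =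
        if v ≠ r ∧ p v = u then 1 else 0) ∨
    ∃ (n' : ℕ) (sel : ℕ → ℕ), (kernelProg.run n s).reg 0 = n' ∧ (kernelProg.run n s).reg 1 = k ∧
      (kernelProg.run n s).reg 2 = 0 ∧ Set.InjOn sel (Set.Iio n') ∧ (∀ i < n', sel i < n) ∧
      n' ≤ 8 * k ^ 2 + 6 * k ∧
      (∀ l, HasArb G (Set.Iio n) l ↔ HasArb G (sel '' Set.Iio n') l) ∧
      ∀ u < n', ∀ v < n', (kernelProg.run n s).arr 0 (u * n' + v) =
        open Classical in if G (sel u) (sel v) then 1 else 0 := by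
  have hrows := run_rows (n := n) (s := s) (a := 3) (l := 3) (by decide) (by decide)
  set s₁ := (rows 3 3).run n s with hs₁
  have hctx₁ : Ctx n G s₁ := by
    refine ⟨(run_reg rfl).trans h3, ?_, fun u hu => by rw [hrows u hu, h3]⟩
    rw [(run_arr rfl : s₁.arr 0 = s.arr 0)]
    exact hadj
  have hk₁ : s₁.reg 1 = k := (run_reg rfl : s₁.reg 1 = s.reg 1).trans h1
  clear_value s₁
  have hA₂ := run_findTree hctx₁ harb
  have hctx₂ := run_findTree_ctx hctx₁
  have hk₂ : (findTree.run n s₁).reg 1 = k := (run_reg rfl).trans hk₁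
  set s₂ := findTree.run n s₁ with hs₂
  clear_value s₂
  obtain ⟨hA₃, hcov₃⟩ := run_moveSpare hirr hctx₂ hA₂
  have hctx₃ := moveSpare_ctx hctx₂
  have hk₃ : (moveSpare.run n s₂).reg 1 = k := (run_reg rfl).trans hk₂
  set s₃ := moveSpare.run n s₂ with hs₃
  clear_value s₃
  obtain ⟨h7, h8⟩ := run_markSpare (n := n) (s := s₃)
  have hctx₄ := markSpare_ctx hctx₃
  have hk₄ : (markSpare.run n s₃).reg 1 = k := (run_reg rfl).trans hk₃
  have r₄ : (markSpare.run n s₃).reg 5 = s₃.reg 5 := run_reg rfl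
  have p₄ : (markSpare.run n s₃).arr 5 = s₃.arr 5 := run_arr rfl
  set s₄ := markSpare.run n s₃ with hs₄
  clear_value s₄
  set r := s₃.reg 5 with hr
  set p := s₃.arr 5 with hp
  have hcount : (countInner.run n s₄).reg 4 = (inner (Set.Iio n) r p).ncard :=
    run_countInner.trans (sum_inner_eq_ncard hA₃ h8)
  have hctx₅ : Ctx n G (countInner.run n s₄) :=
    hctx₄.congr (run_reg rfl) (run_arr rfl) (run_arr rfl)
  have hk₅ : (countInner.run n s₄).reg 1 = k := (run_reg rfl).trans hk₄
  have r₅ : (countInner.run n s₄).reg 5 = r := (run_reg rfl).trans r₄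
  have p₅ : (countInner.run n s₄).arr 5 = p := (run_arr rfl).trans p₄
  have q₅ : (countInner.run n s₄).arr 7 = s₄.arr 7 := run_arr rfl
  have hrun : kernelProg.run n s = (Prog.ifte (.sub (.reg 1) (.reg 4))
      (block [matching, outputInduced]) outputTree).run n (countInner.run n s₄) := by
    rw [hs₄, hs₃, hs₂, hs₁]
    rfl
  rw [hrun]
  set s₅ := countInner.run n s₄ with hs₅
  clear_value s₅
  by_cases hle : k ≤ (inner (Set.Iio n) r p).ncard
  · rw [run_ifte_of_eq (by simp only [eval_sub, eval_reg, hk₅, hcount]; omega)]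
    obtain ⟨g1, g2, g3⟩ := run_outputTree hctx₅
    rw [r₅, p₅] at g3
    exact Or.inl ⟨r, p, hA₃, hle, g1, g2, g3⟩
  · rw [run_ifte_of_ne (by simp only [eval_sub, eval_reg, hk₅, hcount]; omega)]
    simp only [run_block_cons, run_block_nil]
    set W := spare (Set.Iio n) r p with hW
    have hcov : ∀ u v, G u v → ¬ (u ∈ W ∧ v ∈ W) := fun u v huv =>
      hcov₃ u (hG u v huv).1 v (hG u v huv).2 huv
    have hin : ∀ v ∈ W, ∃ u, G u v := fun v hv => ⟨_, hA₃.adj v hv.1 hv.2.1⟩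
    have h7' : ∀ v < n, s₅.arr 7 v ≠ 0 ↔ v ∈ W := by rwa [q₅]
    have hmatch := run_matching hG hcov hin hctx₅ h7'
    have hctx₆ : Ctx n G (matching.run n s₅) :=
      hctx₅.congr (run_reg rfl) (run_arr rfl) (run_arr rfl)
    have hk₆ : (matching.run n s₅).reg 1 = k := (run_reg rfl).trans hk₅
    have q₆ : (matching.run n s₅).arr 7 = s₅.arr 7 := run_arr rfl
    set s₆ := matching.run n s₅ with hs₆
    clear_value s₆
    obtain ⟨n', sel, g1, g2, g3, g4, g5⟩ := run_outputInduced (W := W) hctx₆ (by rwa [q₆])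
    refine Or.inr
      ⟨n', sel, g1, (run_reg rfl).trans hk₆, g2, g3, fun i hi => ?_, ?_, fun l => ?_, g5⟩
    · have : sel i ∈ alive n W n s₆ := g4 ▸ ⟨i, hi, rfl⟩
      exact this.1
    · have := ncard_alive_le hG hcov (not_le.1 hle) hmatch
      rw [← hW, ← g4, g3.ncard_image,
        ← Finset.coe_Iio, Set.ncard_coe_finset, Nat.card_Iio] at this
      exact this
    · rw [g4]
      exact hmatch.hasArb l

end Output

section Kernel

open Prog

variable {n : ℕ} {D : Digraph (Fin n)} {k : ℕ}

/-! ### Digraphs on `{0, …, n - 1}` -/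

/-- The arcs of a digraph on `{0, …, n - 1}` as a relation between natural numbers. -/
def natAdj (D : Digraph (Fin n)) (u v : ℕ) : Prop :=
  ∃ (hu : u < n) (hv : v < n), D.Adj ⟨u, hu⟩ ⟨v, hv⟩

theorem natAdj_val {u v : Fin n} : natAdj D u v ↔ D.Adj u v :=
  ⟨fun ⟨_, _, h⟩ => h, fun h => ⟨u.2, v.2, h⟩⟩

theorem hasArb_iff_natAdj (l : ℕ) :
    HasArb D.Adj Set.univ l ↔ HasArb (natAdj D) (Set.Iio n) l := by
  rw [hasArb_range_iff (G' := natAdj D) Fin.val Fin.val_injective (fun _ _ => natAdj_val.symm) l,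
    Fin.range_val]

theorem initStore_arr_ne_zero_iff {u v : ℕ} (hu : u < n) (hv : v < n) :
    (initStore D k).arr 0 (u * n + v) ≠ 0 ↔ natAdj D u v := by
  have : (∃ u' v' : Fin n, D.Adj u' v' ∧ u * n + v = u' * n + v') ↔ natAdj D u v := by
    constructor
    · rintro ⟨u', v', h, he⟩
      obtain ⟨rfl, rfl⟩ := (mul_add_inj hv v'.2).1 he
      exact natAdj_val.2 h
    · rintro ⟨hu, hv, h⟩
      exact ⟨_, _, h, rfl⟩
  simp [initStore, this]

/-- An arborescence given by a parent function on `ℕ`, as an out-branching of a digraph on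
`{0, …, n - 1}`. -/
theorem Arb.exists_isOutBranching {r : ℕ} {p : ℕ → ℕ} (h : Arb (natAdj D) (Set.Iio n) r p) :
    ∃ T : Digraph (Fin n), IsOutBranching D T ∧
      (internals T).ncard = (inner (Set.Iio n) r p).ncard ∧
      ∀ u v : Fin n, T.Adj u v ↔ (v : ℕ) ≠ r ∧ p v = u := by
  have hr : r < n := h.root_mem
  set q : Fin n → Fin n := fun v => if hv : p v < n then ⟨p v, hv⟩ else ⟨r, hr⟩ with hq
  have hpq : ∀ v : Fin n, (v : ℕ) ≠ r → (q v : ℕ) = p v := by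
    intro v hv
    have : p v < n := h.parent_mem v v.2 hv
    simp [hq, this]
  have hne : ∀ v : Fin n, v ≠ ⟨r, hr⟩ ↔ (v : ℕ) ≠ r := fun v => by simp [Fin.ext_iff]
  have hq' : Arb D.Adj Set.univ ⟨r, hr⟩ q := by
    refine ⟨trivial, fun _ _ _ => trivial, fun v _ hv => ?_, ?_⟩
    · have := (hne v).1 hv
      rw [← natAdj_val, hpq v this]
      exact h.adj v v.2 this
    · obtain ⟨d, hd⟩ := h.rank
      refine ⟨fun v => d v, fun v _ hv => ?_⟩
      have := (hne v).1 hv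
      simp only [hpq v this]
      exact hd v v.2 this
  have hT : ∀ u v : Fin n, (treeOf ⟨r, hr⟩ q).Adj u v ↔ (v : ℕ) ≠ r ∧ p v = u := by
    intro u v
    refine and_congr (hne v) Iff.rfl |>.trans (and_congr_right fun hv => ?_)
    rw [← hpq v hv, Fin.ext_iff]
  refine ⟨treeOf ⟨r, hr⟩ q, hq'.isOutBranching, ?_, hT⟩
  rw [← Set.ncard_image_of_injective _ Fin.val_injective]
  congr 1
  ext u
  constructor
  · rintro ⟨u, ⟨v, huv⟩, rfl⟩
    obtain ⟨hv, he⟩ := (hT u v).1 huv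
    exact ⟨v, ⟨v.2, hv⟩, he⟩
  · rintro ⟨v, ⟨hv, hvr⟩, rfl⟩
    have := h.parent_mem v hv hvr
    exact ⟨⟨p v, this⟩, ⟨⟨v, hv⟩, (hT _ _).2 ⟨hvr, rfl⟩⟩, rfl⟩

/-! ### The kernelization -/

/-- The digraph that consists of a single arc, the positive instance that is output along with a
tree. -/
def singleArc : Digraph (Fin 2) where
  Adj u v := u = 0 ∧ v = 1

theorem hasArb_singleArc : HasArb singleArc.Adj Set.univ 1 := by
  refine ⟨0, fun _ => 0, ⟨trivial, fun _ _ _ => trivial, fun v _ hv => ⟨rfl, by omega⟩,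
    fun v => v, fun v _ hv => ?_⟩, ?_⟩
  · simp only [Fin.val_zero]
    exact Nat.pos_of_ne_zero fun h => hv (Fin.ext h)
  · refine Nat.one_le_iff_ne_zero.2 (Set.ncard_ne_zero_of_mem (a := 0) ?_ (Set.toFinite _))
    exact ⟨1, ⟨trivial, by simp⟩, rfl⟩

theorem HasArb.mono {V : Type*} {G : V → V → Prop} {A : Set V} {l m : ℕ} (h : HasArb G A m)
    (hl : l ≤ m) : HasArb G A l :=
  let ⟨r, p, hA, hk⟩ := h
  ⟨r, p, hA, hl.trans hk⟩

/-- The complete kernelization: the loop bound is kept in register `3`, and the program that follows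
never writes to that register. -/
def kernelCmd : Cmd := .seq (.setReg 3 (.reg 0)) kernelProg.compile

theorem exists_exec_kernelCmd :
    ∃ c, ∀ (n : ℕ) (D : Digraph (Fin n)) (k : ℕ), 0 < n →
      ∃ t, Exec kernelCmd (initStore D k) t (kernelProg.run n ((initStore D k).setReg 3 n)) ∧
        t ≤ c * n ^ 6 := by
  obtain ⟨K, hK⟩ := exists_exec kernelProg (by decide)
  refine ⟨2 + K * 64, fun n D k hn => ?_⟩
  obtain ⟨t, ht, hle⟩ := hK n ((initStore D k).setReg 3 n) (by simp)
  refine ⟨_, .seq (.setReg _ 3 (.reg 0)) ht, ?_⟩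
  have hd : kernelProg.depth ≤ 6 := by decide
  have h1 : (n + 1) ^ kernelProg.depth ≤ 64 * n ^ 6 :=
    calc (n + 1) ^ kernelProg.depth ≤ (2 * n) ^ 6 :=
          (Nat.pow_le_pow_left (by omega) _).trans (Nat.pow_le_pow_right (by omega) hd)
      _ = 64 * n ^ 6 := by ring
  have h2 : 1 ≤ n ^ 6 := Nat.one_le_pow _ _ hn
  have h3 : K * (n + 1) ^ kernelProg.depth ≤ K * (64 * n ^ 6) := Nat.mul_le_mul_left _ h1
  have h4 : Expr.cost (.reg 0) = 1 := rfl
  rw [h4]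
  linarith

theorem kernelProg_correct (hD : IsInstance D k) {s : Store}
    (hs : s = kernelProg.run n ((initStore D k).setReg 3 n)) :
    ∃ (n' : ℕ) (D' : Digraph (Fin n')) (k' : ℕ), EncodesInstance s D' k' ∧
      IsInstance D' k' ∧ n' ≤ 8 * k ^ 2 + 6 * k ∧ k' ≤ k ∧ (Yes D k ↔ Yes D' k') ∧
      ((s.reg 2 = 1 ∧ ∃ T, IsOutBranching D T ∧ (leaves T).ncard + k ≤ n ∧
          EncodesArcs (s.arr 1) T) ∨
        (s.reg 2 = 0 ∧ k' = k ∧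
          ∃ f : Fin n' ↪ Fin n, ∀ u v, D'.Adj u v ↔ D.Adj (f u) (f v))) := by
  obtain ⟨hloop, hpos, hk⟩ := hD
  have harb : HasArb (natAdj D) (Set.Iio n) 0 :=
    (hasArb_iff_natAdj 0).1 (lmin_pos_iff_hasArb.1 hpos)
  have hrun := run_kernelProg (n := n) (G := natAdj D) (s := (initStore D k).setReg 3 n) (k := k)
    (fun u v ⟨hu, hv, _⟩ => ⟨hu, hv⟩) (fun u ⟨_, _, h⟩ => hloop _ h) harb
    (by simp [initStore]) (by simp) (fun u hu v hv => initStore_arr_ne_zero_iff (k := k) hu hv)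
  rw [← hs] at hrun
  clear hs
  rcases hrun with ⟨r, p, hA, hin, ⟨h0, h1, h2⟩, ⟨c0, c1, c2, c3⟩, htree⟩ |
    ⟨n', sel, h0, h1, h2, hinj, hsel, hcard, heq, hadj⟩
  · obtain ⟨T, hT, hTin, hTadj⟩ := hA.exists_isOutBranching
    have hpos' : 0 < lmin singleArc := lmin_pos_iff_hasArb.2 (hasArb_singleArc.mono (by omega))
    refine ⟨2, singleArc, 1, ⟨h0, h1, ?_⟩, ⟨?_, hpos', le_rfl⟩, by nlinarith, hk,
      iff_of_true ((yes_iff_hasArb hpos k).2 (exists_isOutBranching_iff.1 ⟨T, hT, by omega⟩))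
        ((yes_iff_hasArb hpos' 1).2 hasArb_singleArc), Or.inl ⟨h2, T, hT, ?_, ?_⟩⟩
    · intro u v
      fin_cases u <;> fin_cases v <;> simp [singleArc, c0, c1, c2, c3]
    · rintro v ⟨h, h'⟩
      exact absurd (h.symm.trans h') (by decide)
    · have := ncard_leaves_add_ncard_internals T
      rw [Nat.card_fin] at this
      omega
    · intro u v
      rw [htree u u.2 v v.2, hTadj]
      exact ⟨fun h => if_pos h, fun h => if_neg h⟩
  · set f : Fin n' → Fin n := fun i => ⟨sel i, hsel i i.2⟩ with hf
    have hfinj : Function.Injective f := fun i j h =>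
      Fin.ext (hinj i.2 j.2 (congrArg Fin.val h))
    set D' : Digraph (Fin n') := ⟨fun i j => D.Adj (f i) (f j)⟩ with hD'
    have htrans : ∀ l, HasArb D.Adj Set.univ l ↔ HasArb D'.Adj Set.univ l := by
      intro l
      have hrange : Set.range (fun i : Fin n' => sel i) = sel '' Set.Iio n' := by
        rw [← Fin.range_val, ← Set.range_comp]
        rfl
      rw [hasArb_iff_natAdj, heq, hasArb_range_iff (G' := natAdj D) (fun i : Fin n' => sel i)
        (fun i j h => Fin.ext (hinj i.2 j.2 h))
        (fun i j => (natAdj_val (u := f i) (v := f j)).symm) l, hrange]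
    have hpos' : 0 < lmin D' :=
      lmin_pos_iff_hasArb.2 ((htrans 0).1 (lmin_pos_iff_hasArb.1 hpos))
    refine ⟨n', D', k, ⟨h0, h1, fun u v => ?_⟩, ⟨fun v => hloop _, hpos', hk⟩, hcard, le_rfl, ?_,
      Or.inr ⟨h2, rfl, ⟨f, hfinj⟩, fun u v => Iff.rfl⟩⟩
    · have huv : natAdj D (sel u) (sel v) ↔ D'.Adj u v := natAdj_val (u := f u) (v := f v)
      rw [hadj u u.2 v v.2, huv]
      exact ⟨fun h => if_pos h, fun h => if_neg h⟩
    · rw [yes_iff_hasArb hpos, yes_iff_hasArb hpos', htrans]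

end Kernel

end MinLOB

theorem mainTheorem2 :
    -- irreducible digraphs on more than `8k² + 6k` vertices
    (∀ (V : Type*) [Fintype V] (D : Digraph V) (k : ℕ), MinLOB.IsInstance D k →
      8 * k ^ 2 + 6 * k < Fintype.card V → MinLOB.Irreducible D →
      ∃ T, MinLOB.IsOutBranching D T ∧ k ≤ (MinLOB.internals T).ncard) ∧
    -- irreducibility tested only on the vertex cover that comes from a minimal out-branching
    (∀ (V : Type*) [Fintype V] (D T : Digraph V) (k : ℕ), MinLOB.IsInstance D k →
      8 * k ^ 2 + 6 * k < Fintype.card V → MinLOB.IsMinimalOutBranching D T →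
      ¬ MinLOB.RuleApplies D (MinLOB.coverOf T) →
      k ≤ (MinLOB.internals T).ncard) ∧
    -- the kernelization, in `O(n⁶)` steps
    (∃ (P : MinLOB.Cmd) (c : ℕ), ∀ (n : ℕ) (D : Digraph (Fin n)) (k : ℕ),
      MinLOB.IsInstance D k →
      ∃ (t : ℕ) (s : MinLOB.Store), MinLOB.Exec P (MinLOB.initStore D k) t s ∧ t ≤ c * n ^ 6 ∧
      ∃ (n' : ℕ) (D' : Digraph (Fin n')) (k' : ℕ), MinLOB.EncodesInstance s D' k' ∧
        MinLOB.IsInstance D' k' ∧ n' ≤ 8 * k ^ 2 + 6 * k ∧ k' ≤ k ∧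
        (MinLOB.Yes D k ↔ MinLOB.Yes D' k') ∧
        ((s.reg 2 = 1 ∧ ∃ T, MinLOB.IsOutBranching D T ∧ (MinLOB.leaves T).ncard + k ≤ n ∧
            MinLOB.EncodesArcs (s.arr 1) T) ∨
          (s.reg 2 = 0 ∧ k' = k ∧
            ∃ f : Fin n' ↪ Fin n, ∀ u v, D'.Adj u v ↔ D.Adj (f u) (f v)))) := by
  refine ⟨fun V _ D k hD hcard hirr => ?_, fun V _ D T k _ hcard hT hrule => ?_, ?_⟩
  · obtain ⟨T, hT⟩ := MinLOB.exists_isMinimalOutBranching hD.2.1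
    rw [← Nat.card_eq_fintype_card] at hcard
    exact ⟨T, hT.1, MinLOB.le_ncard_internals_of_not_ruleApplies hT.1 hcard
      (hirr _ (MinLOB.isVertexCover_coverOf hD.1 hT))⟩
  · rw [← Nat.card_eq_fintype_card] at hcard
    exact MinLOB.le_ncard_internals_of_not_ruleApplies hT.1 hcard hrule
  · obtain ⟨c, hc⟩ := MinLOB.exists_exec_kernelCmd
    refine ⟨MinLOB.kernelCmd, c, fun n D k hD => ?_⟩
    obtain ⟨r, _⟩ := MinLOB.lmin_pos_iff_hasArb.1 hD.2.1
    obtain ⟨t, ht, hle⟩ := hc n D k r.pos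
    exact ⟨t, _, ht, hle, MinLOB.kernelProg_correct hD rfl⟩
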